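/- **Setting.** Let $G$ be a second countable locally compact (Hausdorff) group, $\mu$ a Borel probability measure on $G$, $\Omega=G^{\{1,2,\dots\}}$ with $\mathbb P=\mu^{\otimes\{1,2,\dots\}}$, expectation $\mathbb E$ and coordinates $g_1,g_2,\dots$; write $\mathbb E(Y;A)=\mathbb E(Y\mathbf 1_A)$. Let $X$ be a second countable locally compact (Hausdorff) space with a continuous action of $G$, and $\nu$ a $\mu$-stationary Borel probability measure on $X$. Let $\sigma:G\times X\to\mathbb R$ be a continuous cocycle, $\sigma(g_2g_1,x)=\sigma(g_2,g_1x)+\sigma(g_1,x)$, such that $\int_G e^{\alpha_0\sup_{x}|\sigma(g,x)|}\,\mu(dg)<\infty$ for some $\alpha_0>0$, and $\int_G\sigma(g,x)\,\mu(dg)=0$ for every $x\in X$. Put $S_n^x=\sigma(g_n\cdots g_1,x)$ (with $S^x_0=0$) and $T((g_1,g_2,\dots),x)=((g_2,g_3,\dots),g_1x)$. Assume strong approximation: there are $\mathbf v>0$ and constants $c_\varepsilon$, $\varepsilon\in(0,\frac14)$, such that for every $x\in X$ some extension of the probability space $(\Omega,\mathbb P)$ carries a standard Brownian motion $(B_t)_{t\ge0}$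 (which may depend on $x$) with $$\mathbb P\Big(\sup_{0\le t\le1}|S^x_{\lfloor nt\rfloor}-\mathbf vB_{nt}|>n^{1/2-\varepsilon}\Big)\le c_\varepsilon n^{-\varepsilon}\qquad\text{for all }n\ge1,\ \varepsilon\in(0,\tfrac14).$$ Let $\mathscr A_p$ ($p\ge0$) be the $\sigma$-algebra on $\Omega$ generated by $g_1,\dots,g_p$. For $\alpha,\beta>0$, a sequence $\mathfrak f=(f_n)_{n\ge0}$ of measurable functions $f_n:\Omega\times X\to\mathbb R$, and $\theta\in L^\infty(\Omega,\mathbb P)$, let $$C_\alpha(\mathfrak f)=\sup_{n\ge0}\int_X\int_\Omega e^{\alpha|f_n(\omega,x)|}\,\mathbb P(d\omega)\,\nu(dx),$$ $$D_{\alpha,\beta}(\mathfrak f)=\sup_{n\ge0}\sup_{p\ge0}e^{\beta p}\Big(\int_X\int_\Omega e^{\alpha|f_n(\omega,x)-\mathbb E(f_n(\cdot,x)\mid\mathscr A_p)(\omega)|}\,\mathbb P(d\omega)\,\nu(dx)-1\Big),$$ $$N_\beta(\theta)=\sup_{p\ge0}e^{\beta p}\,\mathbb E|\theta-\mathbb E(\theta\mid\mathscr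 A_p)|.$$ For $x\in X$ and $t\in\mathbb R$ let $\tau^{\mathfrak f}_{x,t}=\min\{k\ge1:\ t+S^x_k+f_k(T^k(\omega,x))-f_0(\omega,x)<0\}$ (with $\min\emptyset=\infty$), let $$U_n^{\mathfrak f,\theta}(t)=\int_X\mathbb E\Big(\big(t+S_n^x+f_n(T^n(\omega,x))-f_0(\omega,x)\big)\theta(\omega);\ \tau^{\mathfrak f}_{x,t}>n\Big)\,\nu(dx),$$ and let $\phi^+(s)=s\,e^{-s^2/2}\mathbf 1_{\{s\ge0\}}$ be the Rayleigh density. **Theorem.** Fix $\alpha,\beta>0$ and $B\ge1$. Consider sequences $\mathfrak f$ of measurable functions with $C_\alpha(\mathfrak f)\le B$ and $D_{\alpha,\beta}(\mathfrak f)\le B$, and non-negative $\theta\in L^\infty(\Omega,\mathbb P)$ with $\|\theta\|_\infty\le B$ and $N_\beta(\theta)\le B$. (i) For all such $\mathfrak f,\theta$ there is a non-decreasing function $U^{\mathfrak f,\theta}:\mathbb R\to[0,\infty)$ (necessarily unique up to a Lebesgue-null set) such that $\lim_{n\to\infty}\int_{\mathbb R}U_n^{\mathfrak f,\theta}(t)\psi(t)\,dt=\int_{\mathbb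 R}U^{\mathfrak f,\theta}(t)\psi(t)\,dt$ for every continuous compactly supported $\psi:\mathbb R\to\mathbb R$. (ii) For every $b_0>0$ and every continuous compactly supported $\varphi:\mathbb R\to\mathbb R$, uniformly over all real $b\le b_0$ and all such $\mathfrak f,\theta$, $$\lim_{n\to\infty}\frac{\mathbf v\sqrt{2\pi n}}2\int_X\int_{\mathbb R}\varphi(t)\,\mathbb E\Big(\theta;\ \frac{t+\sigma(g_n\cdots g_1,x)}{\mathbf v\sqrt n}\le b,\ \tau^{\mathfrak f}_{x,t}>n\Big)\,dt\,\nu(dx)=\int_{\mathbb R}\varphi(t)\,U^{\mathfrak f,\theta}(t)\,dt\ \int_0^{\max\{b,0\}}\phi^+(s)\,ds.$$ -/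

import Mathlib

open MeasureTheory ProbabilityTheory Filter Topology
open scoped ENNReal NNReal

universe u₁ u₂ u₃

namespace PerturbedWalk

noncomputable section

/-! The sample space is `ℕ → G`; the coordinate `ω i` is the increment `g_{i+1}`. -/

/-- The law of the sequence of independent increments with common law `μ`. -/
def pathLaw {G : Type u₁} [MeasurableSpace G] (μ : Measure G) : Measure (ℕ → G) :=
  Measure.infinitePi (fun _ : ℕ => μ)

/-- The σ-algebra spanned by the first `p` increments `g_1, …, g_p`. -/
abbrev coordAlgebra (G : Type u₁) [MeasurableSpace G] (p : ℕ) : MeasurableSpace (ℕ → G) :=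
  MeasurableSpace.comap (fun (ω : ℕ → G) (i : Fin p) => ω i) inferInstance

/-- The left product `g_n ⋯ g_1`. -/
def leftProd {G : Type u₁} [Group G] (ω : ℕ → G) : ℕ → G
  | 0 => 1
  | n + 1 => ω n * leftProd ω n

/-- The random walk `S_n^x = σ(g_n ⋯ g_1, x)`. -/
def walk {G : Type u₁} {X : Type u₂} [Group G] (σ : G → X → ℝ) (x : X) (n : ℕ) (ω : ℕ → G) : ℝ :=
  σ (leftProd ω n) x

/-- The shift `T((g_1, g_2, …), x) = ((g_2, g_3, …), g_1 x)`. -/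
def shift {G : Type u₁} {X : Type u₂} [Group G] [MulAction G X] (z : (ℕ → G) × X) :
    (ℕ → G) × X :=
  (fun i => z.1 (i + 1), z.1 0 • z.2)

/-- `σ(g₂ g₁, x) = σ(g₂, g₁ x) + σ(g₁, x)`. -/
def IsCocycle {G : Type u₁} {X : Type u₂} [Group G] [MulAction G X] (σ : G → X → ℝ) : Prop :=
  ∀ (g₂ g₁ : G) (x : X), σ (g₂ * g₁) x = σ g₂ (g₁ • x) + σ g₁ x

/-- `ν` is `μ`-stationary: if `g` and `x` are independent with laws `μ` and `ν`, then `g x` has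
law `ν`. -/
def IsStationary {G : Type u₁} {X : Type u₂} [Group G] [MulAction G X] [MeasurableSpace G]
    [MeasurableSpace X] (μ : Measure G) (ν : Measure X) : Prop :=
  Measure.map (fun z : G × X => z.1 • z.2) (μ.prod ν) = ν

/-- Exponential moment of the cocycle: for some `α > 0`, `∫ e^{α sup_x |σ(g,x)|} μ(dg) < ∞`
(the supremum is taken outside the exponential, with values in `[0, ∞]`). -/
def HasExpMoment {G : Type u₁} {X : Type u₂} [MeasurableSpace G] (μ : Measure G)
    (σ : G → X → ℝ) : Prop :=
  ∃ α : ℝ, 0 < α ∧ ∫⁻ g, ⨆ x : X, ENNReal.ofReal (Real.exp (α * |σ g x|)) ∂μ < ∞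

/-- Strong centering: `∫ σ(g,x) μ(dg) = 0` for every `x`. -/
def IsCentered {G : Type u₁} {X : Type u₂} [MeasurableSpace G] (μ : Measure G)
    (σ : G → X → ℝ) : Prop :=
  ∀ x : X, ∫ g, σ g x ∂μ = 0

/-- Strong approximation of the walk by `v` times a Brownian motion. For each starting point `x`,
the probability space `(ℕ → G, pathLaw μ)` has an extension `π : Ω' → (ℕ → G)` which carries a
standard Brownian motion `B` such that, for `0 < ε < 1/4` and `n ≥ 1`,
`ℙ(sup_{0 ≤ t ≤ 1} |S^x_{[nt]} - v B_{nt}| > n^{1/2 - ε}) ≤ c_ε n^{-ε}`,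
where `c_ε` depends neither on `x` nor on `n`. -/
def StrongApproximation {G : Type u₁} {X : Type u₂} [Group G] [MeasurableSpace G]
    (μ : Measure G) (σ : G → X → ℝ) (v : ℝ) : Prop :=
  ∃ c : ℝ → ℝ, ∀ x : X,
    ∃ (Ω' : Type u₃) (_ : MeasurableSpace Ω') (P' : Measure Ω') (π : Ω' → ℕ → G)
      (B : ℝ≥0 → Ω' → ℝ),
      MeasurePreserving π P' (pathLaw μ) ∧ IsBrownianReal B P' ∧
      ∀ ε : ℝ, 0 < ε → ε < 1 / 4 → ∀ n : ℕ, 1 ≤ n →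
        P'.real {ω' | ∃ t : ℝ≥0, t ≤ 1 ∧
            (n : ℝ) ^ (1 / 2 - ε) < |walk σ x ⌊(n : ℝ≥0) * t⌋₊ (π ω') - v * B (n * t) ω'|}
          ≤ c ε * (n : ℝ) ^ (-ε)

/-- `C_α(𝔣) = sup_n ∫∫ e^{α |f_n(ω,x)|} ℙ(dω) ν(dx)`. -/
def expMomentConst {G : Type u₁} {X : Type u₂} [MeasurableSpace G] [MeasurableSpace X]
    (μ : Measure G) (ν : Measure X) (α : ℝ) (f : ℕ → (ℕ → G) × X → ℝ) : ℝ≥0∞ :=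
  ⨆ n : ℕ, ∫⁻ x, ∫⁻ ω, ENNReal.ofReal (Real.exp (α * |f n (ω, x)|)) ∂(pathLaw μ) ∂ν

/-- `D_{α,β}(𝔣) = sup_{n,p} e^{βp} (∫∫ e^{α |f_n(ω,x) - 𝔼(f_n(·,x) | 𝒜_p)(ω)|} ℙ(dω) ν(dx) - 1)`. -/
def approxConst {G : Type u₁} {X : Type u₂} [MeasurableSpace G] [MeasurableSpace X]
    (μ : Measure G) (ν : Measure X) (α β : ℝ) (f : ℕ → (ℕ → G) × X → ℝ) : ℝ≥0∞ :=
  ⨆ (n : ℕ) (p : ℕ), ENNReal.ofReal (Real.exp (β * p)) *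
    ((∫⁻ x, ∫⁻ ω, ENNReal.ofReal (Real.exp (α *
        |f n (ω, x) - ((pathLaw μ)[fun ω' => f n (ω', x) | coordAlgebra G p]) ω|))
      ∂(pathLaw μ) ∂ν) - 1)

/-- `N_β(θ) = sup_p e^{βp} 𝔼 |θ - 𝔼(θ | 𝒜_p)|`. -/
def twistConst {G : Type u₁} [MeasurableSpace G] (μ : Measure G) (β : ℝ) (θ : (ℕ → G) → ℝ) :
    ℝ≥0∞ :=
  ⨆ p : ℕ, ENNReal.ofReal (Real.exp (β * p)) *
    ∫⁻ ω, ENNReal.ofReal |θ ω - ((pathLaw μ)[θ | coordAlgebra G p]) ω| ∂(pathLaw μ)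

/-- The perturbations with `C_α(𝔣) ≤ B` and `D_{α,β}(𝔣) ≤ B`. -/
structure AdmissiblePerturbation {G : Type u₁} {X : Type u₂} [MeasurableSpace G]
    [MeasurableSpace X] (μ : Measure G) (ν : Measure X) (α β B : ℝ)
    (f : ℕ → (ℕ → G) × X → ℝ) : Prop where
  measurable : ∀ n, Measurable (f n)
  expMoment_le : expMomentConst μ ν α f ≤ ENNReal.ofReal B
  approx_le : approxConst μ ν α β f ≤ ENNReal.ofReal B

/-- The non-negative `θ ∈ L^∞` with `‖θ‖_∞ ≤ B` and `N_β(θ) ≤ B`. -/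
structure AdmissibleTwist {G : Type u₁} [MeasurableSpace G] (μ : Measure G) (β B : ℝ)
    (θ : (ℕ → G) → ℝ) : Prop where
  memLp : MemLp θ ∞ (pathLaw μ)
  nonneg : ∀ᵐ ω ∂(pathLaw μ), 0 ≤ θ ω
  norm_le : eLpNorm θ ∞ (pathLaw μ) ≤ ENNReal.ofReal B
  approx_le : twistConst μ β θ ≤ ENNReal.ofReal B

/-- The perturbed walk started at `t`: `t + S_n^x + f_n(T^n(ω,x)) - f_0(ω,x)`. -/
def pertWalk {G : Type u₁} {X : Type u₂} [Group G] [MulAction G X] (σ : G → X → ℝ)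
    (f : ℕ → (ℕ → G) × X → ℝ) (x : X) (t : ℝ) (n : ℕ) (ω : ℕ → G) : ℝ :=
  t + walk σ x n ω + f n (shift^[n] (ω, x)) - f 0 (ω, x)

/-- The first time `k ≥ 1` at which the perturbed walk started at `t` is negative
(`∞` if there is none). -/
def exitTime {G : Type u₁} {X : Type u₂} [Group G] [MulAction G X] (σ : G → X → ℝ)
    (f : ℕ → (ℕ → G) × X → ℝ) (x : X) (t : ℝ) (ω : ℕ → G) : ℕ∞ :=
  sInf {m : ℕ∞ | ∃ k : ℕ, 1 ≤ k ∧ pertWalk σ f x t k ω < 0 ∧ m = (k : ℕ∞)}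

/-- `U_n^{𝔣,θ}(t) = ∫ 𝔼((t + S_n^x + f_n ∘ T^n - f_0) θ ; τ^𝔣_{x,t} > n) ν(dx)`. -/
def preLimit {G : Type u₁} {X : Type u₂} [Group G] [MulAction G X] [MeasurableSpace G]
    [MeasurableSpace X] (μ : Measure G) (ν : Measure X) (σ : G → X → ℝ)
    (f : ℕ → (ℕ → G) × X → ℝ) (θ : (ℕ → G) → ℝ) (n : ℕ) (t : ℝ) : ℝ :=
  ∫ x, ∫ ω in {ω | (n : ℕ∞) < exitTime σ f x t ω},
    pertWalk σ f x t n ω * θ ω ∂(pathLaw μ) ∂ν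

/-- `U` is a version of the limit function `U^{𝔣,θ}`: a non-decreasing function `ℝ → [0, ∞)` with
`∫ U_n^{𝔣,θ} ψ → ∫ U ψ` for all continuous compactly supported `ψ`. -/
structure IsLimitFunction {G : Type u₁} {X : Type u₂} [Group G] [MulAction G X] [MeasurableSpace G]
    [MeasurableSpace X] (μ : Measure G) (ν : Measure X) (σ : G → X → ℝ)
    (f : ℕ → (ℕ → G) × X → ℝ) (θ : (ℕ → G) → ℝ) (U : ℝ → ℝ) : Prop where
  mono : Monotone U
  nonneg : ∀ t, 0 ≤ U t
  tendsto : ∀ ψ : ℝ → ℝ, Continuous ψ → HasCompactSupport ψ →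
    Tendsto (fun n : ℕ => ∫ t, preLimit μ ν σ f θ n t * ψ t) atTop (𝓝 (∫ t, U t * ψ t))

/-- The standard Rayleigh density `φ⁺(t) = t e^{-t²/2} 1_{t ≥ 0}`. -/
def rayleigh (t : ℝ) : ℝ := if 0 ≤ t then t * Real.exp (-t ^ 2 / 2) else 0

/-- `(v √(2πn) / 2) ∫∫ φ(t) 𝔼(θ ; (t + σ(g_n ⋯ g_1, x)) / (v √n) ≤ b, τ^𝔣_{x,t} > n) dt ν(dx)`. -/
def scaledConditioned {G : Type u₁} {X : Type u₂} [Group G] [MulAction G X] [MeasurableSpace G]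
    [MeasurableSpace X] (μ : Measure G) (ν : Measure X) (σ : G → X → ℝ) (v : ℝ)
    (f : ℕ → (ℕ → G) × X → ℝ) (θ : (ℕ → G) → ℝ) (φ : ℝ → ℝ) (b : ℝ) (n : ℕ) : ℝ :=
  v * √(2 * Real.pi * n) / 2 *
    ∫ x, ∫ t : ℝ, φ t *
      ∫ ω in {ω | (t + walk σ x n ω) / (v * √n) ≤ b ∧ (n : ℕ∞) < exitTime σ f x t ω},
        θ ω ∂(pathLaw μ) ∂volume ∂ν

end

end PerturbedWalk

/-!
The idea is to average over the starting level `t` as well, with respect to a measure `l` of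
bounded density and compact support. For a fixed path the survival of the perturbed walk is a
monotone function of `t`, so its average over `t` is a Lipschitz function of the perturbations;
this makes it possible to replace perturbations and twist by functions of finitely many increments
(`abs_integral_sub_integral_truncSeq_le`), for which the Markov property can be used.

Two quantities are followed: the survival probability `survMass` and the mean position on survival
`meanPos`, which is the integral of `U_n` against `l`.

* For the unperturbed walk issued from `y`, strong approximation and the reflection principle for
  the Brownian motion at integer times show that the probability to stay non-negative up to time
  `n` and to end above `b v √n` is `(2 y⁺ / (v √n)) ϕ(b⁺) + O(n^{-6/25} + y² / n)`, where `ϕ` is the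
  Gaussian density, uniformly in the starting point (`exists_survProb_estimate`). A shift of the
  barrier by a small power of `n` does not matter.
* Up to a time `m` of order `n^{3/5}` the perturbed walk is followed exactly, afterwards it is
  compared with the unperturbed one. The Markov property at time `m + p`, where `p` is the range of
  the truncated perturbations, expresses the mass of the survivors at time `n` above `b v √n` as
  `(2 / (v √n)) ϕ(b⁺) meanPos m`, with an error `O(n^{-6/25} survMass m + n^{-27/50})`
  (`exists_tailMass_estimate`).
* By the centering of the cocycle, the mean position varies between `M` and `2 M` by at most a small
  power of `M` times the survival probability at time about `M` (`abs_meanPos_sub_le`). The crude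
  bound `meanPos m = O(√m)` in the previous estimate gives `survMass n = O(n^{-1/5})`, and then
  `meanPos` converges, with a rate. As it is bounded, the estimate for the survivors improves any
  rate of decay of `survMass`; two more rounds lead to `O(n^{-57/125})`, which makes its error
  negligible with respect to `n^{-1/2}`.

The survivors below `b v √n` are all survivors minus those above, which produces the factor
`1 - exp (-(b⁺)² / 2) = ∫₀^{b⁺} φ⁺`. Finally, the functions `U_n` are non-negative and monotone in
`t`, and their integrals over intervals converge: they converge to a monotone function `U` outside
of countably many points (`exists_monotone_limit`). A test function of any sign is a difference of
two densities.
-/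

set_option linter.unusedSectionVars false

namespace PerturbedWalk

/-! ### The path space -/


section PathSpace

theorem integral_comp_measurePreserving {α β : Type*} [MeasurableSpace α] [MeasurableSpace β]
    {μ : Measure α} {ν : Measure β} {f : α → β} (hf : MeasurePreserving f μ ν) {g : β → ℝ}
    (hg : AEStronglyMeasurable g ν) : ∫ a, g (f a) ∂μ = ∫ b, g b ∂ν := by
  rw [← hf.map_eq] at hg ⊢
  exact (integral_map hf.aemeasurable hg).symm

variable {G : Type*}

/-- The path whose first `q` increments are those of `ω`, followed by the path `ω'`. -/
def concat (q : ℕ) (ω ω' : ℕ → G) : ℕ → G := fun i => if i < q then ω i else ω' (i - q)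

theorem concat_apply_of_lt {q i : ℕ} (h : i < q) (ω ω' : ℕ → G) : concat q ω ω' i = ω i :=
  if_pos h

theorem concat_add (q i : ℕ) (ω ω' : ℕ → G) : concat q ω ω' (i + q) = ω' i := by
  simp [concat]

theorem concat_congr {p : ℕ} {ω₁ ω₂ : ℕ → G} (h : ∀ i < p, ω₁ i = ω₂ i) (ω' : ℕ → G) :
    concat p ω₁ ω' = concat p ω₂ ω' := by
  ext i
  unfold concat
  split_ifs with hi
  exacts [h i hi, rfl]

variable [MeasurableSpace G]

instance (μ : Measure G) [IsProbabilityMeasure μ] : IsProbabilityMeasure (pathLaw μ) := by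
  unfold pathLaw; infer_instance

theorem measurable_concat (q : ℕ) :
    Measurable (fun w : (ℕ → G) × (ℕ → G) => concat q w.1 w.2) := by
  refine measurable_pi_lambda _ fun i => ?_
  unfold concat
  split_ifs <;> fun_prop

/-- The path space is a product: the first `q` increments and the subsequent ones are independent,
and the path of the subsequent ones has the same law. -/
theorem measurePreserving_concat (μ : Measure G) [IsProbabilityMeasure μ] (q : ℕ) :
    MeasurePreserving (fun w : (ℕ → G) × (ℕ → G) => concat q w.1 w.2)
      ((pathLaw μ).prod (pathLaw μ)) (pathLaw μ) := by
  refine ⟨measurable_concat q, ?_⟩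
  unfold pathLaw
  refine Measure.eq_infinitePi _ fun s t ht => ?_
  rw [Measure.map_apply (measurable_concat q) (MeasurableSet.pi s.countable_toSet fun i _ => ht i)]
  have : (fun w : (ℕ → G) × (ℕ → G) => concat q w.1 w.2) ⁻¹' (Set.pi s t) =
      (Set.pi ((s.filter (· < q) : Finset ℕ) : Set ℕ) t) ×ˢ
        (Set.pi (((s.filter (¬ · < q)).image (· - q) : Finset ℕ) : Set ℕ) fun j => t (j + q)) := by
    ext ⟨ω, ω'⟩
    simp only [Set.mem_preimage, Set.mem_pi, Finset.mem_coe, Set.mem_prod, Finset.mem_filter,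
      Finset.mem_image, concat]
    constructor
    · intro h
      refine ⟨fun i hi => by simpa [hi.2] using h i hi.1, ?_⟩
      rintro _ ⟨i, ⟨hi, hq⟩, rfl⟩
      have := h i hi
      rw [if_neg hq] at this
      rwa [Nat.sub_add_cancel (not_lt.1 hq)]
    · rintro ⟨h₁, h₂⟩ i hi
      split_ifs with hq
      · exact h₁ i ⟨hi, hq⟩
      · have := h₂ (i - q) ⟨i, ⟨hi, hq⟩, rfl⟩
        rwa [Nat.sub_add_cancel (not_lt.1 hq)] at this
  rw [this, Measure.prod_prod, Measure.infinitePi_pi _ fun i _ => ht i,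
    Measure.infinitePi_pi _ fun i _ => ht _, Finset.prod_image,
    ← Finset.prod_filter_mul_prod_filter_not s (· < q)]
  · congr 1
    refine Finset.prod_congr rfl fun i hi => ?_
    rw [Nat.sub_add_cancel (not_lt.1 (Finset.mem_filter.1 hi).2)]
  · intro i hi j hj hij
    simp only [Finset.coe_filter, Set.mem_ofPred_eq, not_lt] at hi hj
    have : i - q = j - q := hij
    omega

theorem lintegral_concat (μ : Measure G) [IsProbabilityMeasure μ] (q : ℕ) {h : (ℕ → G) → ℝ≥0∞}
    (hm : Measurable h) : ∫⁻ ω, h ω ∂(pathLaw μ) =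
      ∫⁻ ω, ∫⁻ ω', h (concat q ω ω') ∂(pathLaw μ) ∂(pathLaw μ) := by
  rw [← (measurePreserving_concat μ q).lintegral_comp hm,
    lintegral_prod (fun w : (ℕ → G) × (ℕ → G) => h (concat q w.1 w.2))
      (hm.comp (measurable_concat q)).aemeasurable]

theorem integral_concat (μ : Measure G) [IsProbabilityMeasure μ] (q : ℕ) {h : (ℕ → G) → ℝ}
    (hi : Integrable h (pathLaw μ)) : ∫ ω, h ω ∂(pathLaw μ) =
      ∫ ω, ∫ ω', h (concat q ω ω') ∂(pathLaw μ) ∂(pathLaw μ) := by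
  rw [← integral_comp_measurePreserving (measurePreserving_concat μ q) hi.aestronglyMeasurable,
    integral_prod]
  exact (measurePreserving_concat μ q).integrable_comp_of_integrable hi

theorem measurePreserving_coord (μ : Measure G) [IsProbabilityMeasure μ] (i : ℕ) :
    MeasurePreserving (fun ω : ℕ → G => ω i) (pathLaw μ) μ :=
  measurePreserving_eval_infinitePi (fun _ : ℕ => μ) i

/-- The average of `h` over all the increments but the first `p`: a version of the conditional
expectation of `h` with respect to the first `p` increments. -/
noncomputable def trunc (μ : Measure G) (p : ℕ) (h : (ℕ → G) → ℝ) (ω : ℕ → G) : ℝ :=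
  ∫ ω', h (concat p ω ω') ∂(pathLaw μ)

theorem trunc_congr (μ : Measure G) {p : ℕ} (h : (ℕ → G) → ℝ) {ω₁ ω₂ : ℕ → G}
    (hω : ∀ i < p, ω₁ i = ω₂ i) : trunc μ p h ω₁ = trunc μ p h ω₂ := by
  unfold trunc
  simp_rw [concat_congr hω]

theorem measurable_trunc {X : Type*} [MeasurableSpace X] (μ : Measure G) [IsProbabilityMeasure μ]
    (p : ℕ) {h : (ℕ → G) × X → ℝ} (hh : Measurable h) :
    Measurable (fun z : (ℕ → G) × X => trunc μ p (fun ω => h (ω, z.2)) z.1) := by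
  unfold trunc
  refine (StronglyMeasurable.integral_prod_right (f := fun (z : (ℕ → G) × X) (ω' : ℕ → G) =>
    h (concat p z.1 ω', z.2)) ?_).measurable
  refine (hh.comp (Measurable.prodMk ?_ (by fun_prop))).stronglyMeasurable
  exact (measurable_concat p).comp (by fun_prop : Measurable fun w : ((ℕ → G) × X) × (ℕ → G) =>
    (w.1.1, w.2))

theorem measurable_trunc' (μ : Measure G) [IsProbabilityMeasure μ]
    (p : ℕ) {h : (ℕ → G) → ℝ} (hh : Measurable h) : Measurable (trunc μ p h) := by
  unfold trunc
  exact (StronglyMeasurable.integral_prod_right (f := fun (ω ω' : ℕ → G) => h (concat p ω ω'))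
    (hh.comp (measurable_concat p)).stronglyMeasurable).measurable

theorem coordAlgebra_le (p : ℕ) : coordAlgebra G p ≤ (inferInstance : MeasurableSpace (ℕ → G)) :=
  Measurable.comap_le (by fun_prop)

/-- A function of the path that depends on the first `p` increments only is measurable with
respect to them. -/
theorem measurable_coordAlgebra {p : ℕ} {h : (ℕ → G) → ℝ} (hh : Measurable h)
    (hp : ∀ ω₁ ω₂ : ℕ → G, (∀ i < p, ω₁ i = ω₂ i) → h ω₁ = h ω₂) :
    Measurable[coordAlgebra G p] h := by
  rcases isEmpty_or_nonempty (ℕ → G) with hG | ⟨⟨ω₀⟩⟩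
  · rw [show h = fun _ => 0 from funext fun ω => (hG.false ω).elim]
    exact measurable_const
  have : h = (fun y : Fin p → G => h (fun i => if hi : i < p then y ⟨i, hi⟩ else ω₀ i)) ∘
      (fun (ω : ℕ → G) (i : Fin p) => ω i) := by
    ext ω
    refine hp _ _ fun i hi => by simp [hi]
  rw [this]
  refine Measurable.comp (hh.comp (measurable_pi_lambda _ fun i => ?_)) (comap_measurable _)
  split_ifs <;> fun_prop

theorem condExp_ae_eq_trunc (μ : Measure G) [IsProbabilityMeasure μ] (p : ℕ) {h : (ℕ → G) → ℝ}
    (hm : Measurable h) (hi : Integrable h (pathLaw μ)) :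
    (pathLaw μ)[h | coordAlgebra G p] =ᵐ[pathLaw μ] trunc μ p h := by
  have hmp := measurePreserving_concat μ p
  have hint : Integrable (fun w : (ℕ → G) × (ℕ → G) => h (concat p w.1 w.2))
      ((pathLaw μ).prod (pathLaw μ)) := hmp.integrable_comp_of_integrable hi
  have htr : Integrable (trunc μ p h) (pathLaw μ) := hint.integral_prod_left
  refine (ae_eq_condExp_of_forall_setIntegral_eq (coordAlgebra_le p) hi
    (fun s _ _ => htr.integrableOn) ?_ (measurable_coordAlgebra (measurable_trunc' μ p hm)
      fun _ _ h => trunc_congr μ _ h).aestronglyMeasurable).symm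
  rintro s hs -
  have hs' : MeasurableSet s := coordAlgebra_le p s hs
  have hconc : ∀ ω ω' : ℕ → G, concat p ω ω' ∈ s ↔ ω ∈ s := by
    obtain ⟨A, -, rfl⟩ := hs
    intro ω ω'
    simp only [Set.mem_preimage]
    rw [show (fun i : Fin p => concat p ω ω' i) = fun i : Fin p => ω i from
      funext fun i => concat_apply_of_lt i.2 _ _]
  rw [← integral_indicator hs', ← integral_indicator hs',
    ← integral_comp_measurePreserving hmp (hm.indicator hs').aestronglyMeasurable,
    integral_prod]
  · refine integral_congr_ae (Eventually.of_forall fun ω => ?_)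
    by_cases hω : ω ∈ s
    · simp [Set.indicator, hconc, hω, trunc]
    · simp [Set.indicator, hconc, hω]
  · exact hmp.integrable_comp_of_integrable (hi.indicator hs')

end PathSpace

/-! ### The dynamics on paths and starting points -/

section Dynamics

variable {G X : Type*} [Group G] [MulAction G X]

theorem shift_iterate (k : ℕ) (z : (ℕ → G) × X) :
    shift^[k] z = (fun i => z.1 (i + k), leftProd z.1 k • z.2) := by
  induction k with
  | zero => simp [leftProd]
  | succ k ih =>
    rw [Function.iterate_succ_apply', ih]
    simp only [shift, leftProd, zero_add, mul_smul, Prod.mk.injEq, and_true]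
    exact funext fun i => by rw [add_right_comm, add_assoc]

theorem leftProd_add (ω : ℕ → G) (q j : ℕ) :
    leftProd ω (q + j) = leftProd (fun i => ω (i + q)) j * leftProd ω q := by
  induction j with
  | zero => simp [leftProd]
  | succ j ih => rw [← add_assoc, leftProd, ih, leftProd, mul_assoc, add_comm q j]

theorem leftProd_congr {k : ℕ} {ω₁ ω₂ : ℕ → G} (h : ∀ i < k, ω₁ i = ω₂ i) :
    leftProd ω₁ k = leftProd ω₂ k := by
  induction k with
  | zero => rfl
  | succ k ih => rw [leftProd, leftProd, h k k.lt_succ_self, ih fun i hi => h i (hi.trans k.lt_succ_self)]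

theorem leftProd_concat (q : ℕ) (ω ω' : ℕ → G) : leftProd (concat q ω ω') q = leftProd ω q :=
  leftProd_congr fun _ hi => concat_apply_of_lt hi _ _

/-- The increment `σ(g_{k+1}, g_k ⋯ g_1 x)` of the walk. -/
def incr (σ : G → X → ℝ) (x : X) (k : ℕ) (ω : ℕ → G) : ℝ := σ (ω k) (leftProd ω k • x)

theorem IsCocycle.one {σ : G → X → ℝ} (hσ : IsCocycle σ) (x : X) : σ 1 x = 0 := by
  have := hσ 1 1 x
  simp only [one_smul, mul_one] at this
  linarith

theorem walk_zero {σ : G → X → ℝ} (hσ : IsCocycle σ) (x : X) (ω : ℕ → G) : walk σ x 0 ω = 0 :=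
  hσ.one x

theorem walk_succ {σ : G → X → ℝ} (hσ : IsCocycle σ) (x : X) (k : ℕ) (ω : ℕ → G) :
    walk σ x (k + 1) ω = walk σ x k ω + incr σ x k ω := by
  rw [walk, leftProd, hσ, add_comm]; rfl

theorem walk_concat_add {σ : G → X → ℝ} (hσ : IsCocycle σ) (x : X) (q j : ℕ) (ω ω' : ℕ → G) :
    walk σ x (q + j) (concat q ω ω') = walk σ x q ω + walk σ (leftProd ω q • x) j ω' := by
  rw [walk, leftProd_add, hσ, leftProd_concat, walk, walk, add_comm]
  simp_rw [concat_add]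

theorem walk_congr (σ : G → X → ℝ) (x : X) {k : ℕ} {ω₁ ω₂ : ℕ → G} (h : ∀ i < k, ω₁ i = ω₂ i) :
    walk σ x k ω₁ = walk σ x k ω₂ := by
  rw [walk, walk, leftProd_congr h]

variable [MeasurableSpace G] [MeasurableSpace X] [MeasurableMul₂ G]

theorem measurable_leftProd (k : ℕ) : Measurable (fun ω : ℕ → G => leftProd ω k) := by
  induction k with
  | zero => exact measurable_const
  | succ k ih => exact (measurable_pi_apply k).mul ih

theorem measurable_walk {σ : G → X → ℝ} (hσ : Measurable (fun z : G × X => σ z.1 z.2)) (k : ℕ) :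
    Measurable (fun z : (ℕ → G) × X => walk σ z.2 k z.1) :=
  hσ.comp (((measurable_leftProd k).comp measurable_fst).prodMk measurable_snd)

variable [MeasurableSMul₂ G X]

theorem measurable_incr {σ : G → X → ℝ} (hσ : Measurable (fun z : G × X => σ z.1 z.2)) (k : ℕ) :
    Measurable (fun z : (ℕ → G) × X => incr σ z.2 k z.1) :=
  hσ.comp (((measurable_pi_apply k).comp measurable_fst).prodMk
    (((measurable_leftProd k).comp measurable_fst).smul measurable_snd))

omit [MeasurableMul₂ G] in
theorem measurable_shift : Measurable (shift : (ℕ → G) × X → (ℕ → G) × X) := by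
  unfold shift; fun_prop

/-- Stationarity of `ν` means that the shift preserves the law of path and starting point. -/
theorem measurePreserving_shift {μ : Measure G} [IsProbabilityMeasure μ] {ν : Measure X}
    [IsProbabilityMeasure ν] (hν : IsStationary μ ν) :
    MeasurePreserving (shift : (ℕ → G) × X → (ℕ → G) × X) ((pathLaw μ).prod ν)
      ((pathLaw μ).prod ν) := by
  have h1 : MeasurePreserving (fun w : ((ℕ → G) × (ℕ → G)) × X => (w.1.2, (w.1.1 0, w.2)))
      (((pathLaw μ).prod (pathLaw μ)).prod ν) ((pathLaw μ).prod (μ.prod ν)) := by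
    have e1 : MeasurePreserving (fun w : ((ℕ → G) × (ℕ → G)) × X => ((w.1.2, w.1.1), w.2))
        (((pathLaw μ).prod (pathLaw μ)).prod ν) (((pathLaw μ).prod (pathLaw μ)).prod ν) :=
      Measure.measurePreserving_swap.prod (MeasurePreserving.id ν)
    have e2 := measurePreserving_prodAssoc (pathLaw μ) (pathLaw μ) ν
    have e3 : MeasurePreserving (fun w : (ℕ → G) × ((ℕ → G) × X) => (w.1, (w.2.1 0, w.2.2)))
        ((pathLaw μ).prod ((pathLaw μ).prod ν)) ((pathLaw μ).prod (μ.prod ν)) :=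
      (MeasurePreserving.id _).prod ((measurePreserving_coord μ 0).prod (MeasurePreserving.id ν))
    exact e3.comp (e2.comp e1)
  have h2 : MeasurePreserving (fun w : (ℕ → G) × (G × X) => (w.1, w.2.1 • w.2.2))
      ((pathLaw μ).prod (μ.prod ν)) ((pathLaw μ).prod ν) :=
    (MeasurePreserving.id _).prod ⟨by fun_prop, hν⟩
  have h3 : MeasurePreserving (fun w : ((ℕ → G) × (ℕ → G)) × X => (concat 1 w.1.1 w.1.2, w.2))
      (((pathLaw μ).prod (pathLaw μ)).prod ν) ((pathLaw μ).prod ν) :=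
    (measurePreserving_concat μ 1).prod (MeasurePreserving.id ν)
  refine ⟨measurable_shift, ?_⟩
  conv_lhs => rw [← h3.map_eq, Measure.map_map measurable_shift h3.measurable]
  rw [← (h2.comp h1).map_eq]
  rfl

theorem measurePreserving_shift_iterate {μ : Measure G} [IsProbabilityMeasure μ] {ν : Measure X}
    [IsProbabilityMeasure ν] (hν : IsStationary μ ν) (k : ℕ) :
    MeasurePreserving (shift^[k] : (ℕ → G) × X → (ℕ → G) × X) ((pathLaw μ).prod ν)
      ((pathLaw μ).prod ν) :=
  (measurePreserving_shift hν).iterate k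

end Dynamics

/-! ### Brownian motion at integer times -/

section Reflection


variable {Ω : Type*} [MeasurableSpace Ω] {P : Measure Ω} {W : ℝ≥0 → Ω → ℝ}

theorem gaussianReal_neg_symm (v : ℝ≥0) : (gaussianReal 0 v).map (fun x => -x) = gaussianReal 0 v := by
  rw [gaussianReal_map_neg, neg_zero]

/-- Reflecting the increment after time `k` does not change its joint law with the past. -/
theorem measure_past_increment_symm (hW : IsPreBrownianReal W P) (hm : ∀ t, Measurable (W t))
    {k n : ℕ} (hkn : k ≤ n) {A : Set ((Set.Iic (k : ℝ≥0) → ℝ) × ℝ)} (hA : MeasurableSet A) :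
    P {ω | ((fun t : Set.Iic (k : ℝ≥0) => W t ω), W n ω - W k ω) ∈ A} =
      P {ω | ((fun t : Set.Iic (k : ℝ≥0) => W t ω), -(W n ω - W k ω)) ∈ A} := by
  have hP : IsProbabilityMeasure P := hW.isGaussianProcess.isProbabilityMeasure
  have hsub : ((k : ℝ≥0) + (n - k : ℕ)) = n := by exact_mod_cast Nat.add_sub_cancel' hkn
  have hind : IndepFun (fun ω (t : Set.Iic (k : ℝ≥0)) => W t ω) (fun ω => W n ω - W k ω) P := by
    have := (hW.indepFun_shift (k : ℝ≥0)).symm.comp measurable_id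
      (measurable_pi_apply ((n - k : ℕ) : ℝ≥0))
    simpa only [Function.comp_def, hsub, id] using this
  have hind' : IndepFun (fun ω (t : Set.Iic (k : ℝ≥0)) => W t ω) (fun ω => -(W n ω - W k ω)) P :=
    hind.comp measurable_id measurable_neg
  have hV : Measurable fun ω (t : Set.Iic (k : ℝ≥0)) => W t ω :=
    measurable_pi_lambda _ fun t => hm t
  have hD : Measurable fun ω => W n ω - W k ω := (hm _).sub (hm _)
  have e1 := (indepFun_iff_map_prod_eq_prod_map_map hV.aemeasurable hD.aemeasurable).1 hind
  have e2 := (indepFun_iff_map_prod_eq_prod_map_map hV.aemeasurable hD.neg.aemeasurable).1 hind'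
  have e3 : P.map (fun ω => -(W n ω - W k ω)) = P.map (fun ω => W n ω - W k ω) := by
    have hl : P.map (W n - W k) = _ := (hW.hasLaw_sub (n : ℝ≥0) k).map_eq
    rw [show (fun ω => -(W n ω - W k ω)) = (fun x => -x) ∘ (W n - W k) from rfl,
      ← Measure.map_map measurable_neg ((hm _).sub (hm _)), hl, gaussianReal_neg_symm]
    exact hl.symm
  have e4 : P.map (fun ω => ((fun t : Set.Iic (k : ℝ≥0) => W t ω), W n ω - W k ω)) =
      P.map (fun ω => ((fun t : Set.Iic (k : ℝ≥0) => W t ω), -(W n ω - W k ω))) := by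
    rw [e1]; exact (e2.trans (by rw [← e3]; rfl)).symm
  have := congrArg (fun m => m A) e4
  have hD' : Measurable fun ω => -(W n ω - W k ω) := hD.neg
  rwa [Measure.map_apply (hV.prodMk hD) hA, Measure.map_apply (hV.prodMk hD') hA] at this

/-- Reflection at the first passage below `-a` at the time `k`. -/
theorem measure_firstPassage_reflect (hW : IsPreBrownianReal W P) (hm : ∀ t, Measurable (W t))
    {k n : ℕ} (hkn : k ≤ n) (a z : ℝ) :
    P {ω | (W k ω < -a ∧ ∀ j < k, -a ≤ W j ω) ∧ z < W n ω} =
      P {ω | (W k ω < -a ∧ ∀ j < k, -a ≤ W j ω) ∧ W n ω < 2 * W k ω - z} := by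
  let V (ω : Ω) : Set.Iic (k : ℝ≥0) → ℝ := fun t => W t ω
  let e (j : ℕ) (hj : j ≤ k) : Set.Iic (k : ℝ≥0) := ⟨j, by simpa using hj⟩
  let A : Set ((Set.Iic (k : ℝ≥0) → ℝ) × ℝ) :=
    {w | (w.1 (e k le_rfl) < -a ∧ ∀ j : Fin k, -a ≤ w.1 (e j j.2.le)) ∧
      z < w.1 (e k le_rfl) + w.2}
  have hA : MeasurableSet A := by
    simp only [A, Set.ofPred_and, Set.ofPred_forall]
    refine MeasurableSet.inter (MeasurableSet.inter ?_ (MeasurableSet.iInter fun j => ?_)) ?_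
    · exact measurableSet_lt (f := fun w : (Set.Iic (k : ℝ≥0) → ℝ) × ℝ => w.1 (e k le_rfl))
        (by fun_prop) (by fun_prop)
    · exact measurableSet_le (g := fun w : (Set.Iic (k : ℝ≥0) → ℝ) × ℝ => w.1 (e j j.2.le))
        (by fun_prop) (by fun_prop)
    · exact measurableSet_lt (g := fun w : (Set.Iic (k : ℝ≥0) → ℝ) × ℝ => w.1 (e k le_rfl) + w.2)
        (by fun_prop) (by fun_prop)
  have h := measure_past_increment_symm hW hm hkn hA
  convert h using 2
  · ext ω
    simp [A, e, Fin.forall_iff]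
  · ext ω
    simp only [A, e, Fin.forall_iff, Set.mem_ofPred_eq]
    refine and_congr Iff.rfl ?_
    constructor <;> intro h <;> linarith

variable [IsProbabilityMeasure P]

theorem measureReal_firstPassage_sum (n : ℕ) (a : ℝ) (hm : ∀ t, Measurable (W t)) {D : ℕ → Set Ω}
    (hD : ∀ k, MeasurableSet (D k)) :
    P.real {ω | ∃ k ≤ n, (W k ω < -a ∧ ∀ j < k, -a ≤ W j ω) ∧ ω ∈ D k} =
      ∑ k ∈ Finset.range (n + 1), P.real {ω | (W k ω < -a ∧ ∀ j < k, -a ≤ W j ω) ∧ ω ∈ D k} := by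
  rw [← measureReal_biUnion_finset]
  · congr 1
    ext ω
    simp only [Set.mem_ofPred_eq, Finset.mem_range, Set.mem_iUnion, Nat.lt_succ_iff, exists_prop]
  · intro i _ j _ hij
    rw [Function.onFun, Set.disjoint_left]
    rintro ω ⟨⟨h1, h2⟩, -⟩ ⟨⟨h3, h4⟩, -⟩
    rcases lt_or_gt_of_ne hij with h | h
    · linarith [h4 i h]
    · linarith [h2 j h]
  · intro k _
    simp only [Set.ofPred_and, Set.ofPred_forall]
    exact ((measurableSet_lt (hm _) measurable_const).inter (MeasurableSet.iInter fun j =>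
      MeasurableSet.iInter fun _ => measurableSet_le measurable_const (hm _))).inter (hD k)

theorem exists_firstPassage {w : ℕ → ℝ} {a : ℝ} {n : ℕ} (h : ¬ ∀ j ≤ n, 0 ≤ a + w j) :
    ∃ k ≤ n, w k < -a ∧ ∀ j < k, -a ≤ w j := by
  push Not at h
  classical
  have hex : ∃ k, w k < -a := by
    obtain ⟨j, -, hj⟩ := h
    exact ⟨j, by linarith⟩
  refine ⟨Nat.find hex, ?_, Nat.find_spec hex, fun j hj => not_lt.1 (Nat.find_min hex hj)⟩
  obtain ⟨j, hjn, hj⟩ := h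
  exact (Nat.find_min' hex (by linarith)).trans hjn

/-- Reflection at the first integer time at which the process is below `-a`: the paths that survive
and end above `z` are all those that end above `z` without those that crossed before, and the latter
are as likely as their reflections. The overshoot at the crossing is kept exactly. -/
theorem measureReal_reflection (hW : IsPreBrownianReal W P) (hm : ∀ t, Measurable (W t))
    (n : ℕ) (a z : ℝ) :
    P.real {ω | (∀ j : ℕ, j ≤ n → 0 ≤ a + W j ω) ∧ z < W n ω} = P.real {ω | z < W n ω} -
      P.real {ω | ∃ k ≤ n, (W (k : ℕ) ω < -a ∧ ∀ j < k, -a ≤ W (j : ℕ) ω) ∧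
        W n ω < 2 * W k ω - z} := by
  have h1 : P.real {ω | ∃ k ≤ n, (W (k : ℕ) ω < -a ∧ ∀ j < k, -a ≤ W (j : ℕ) ω) ∧
        W n ω < 2 * W k ω - z} = P.real {ω | ∃ k ≤ n, (W (k : ℕ) ω < -a ∧ ∀ j < k, -a ≤ W (j : ℕ) ω) ∧
        z < W n ω} := by
    refine (measureReal_firstPassage_sum (D := fun k => {ω | W n ω < 2 * W (k : ℕ) ω - z}) n a hm
      fun k => measurableSet_lt (hm _) (((hm _).const_mul 2).sub_const z)).trans <| Eq.trans ?_
      (measureReal_firstPassage_sum (D := fun k => {ω | z < W n ω}) n a hm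
      fun k => measurableSet_lt measurable_const (hm _)).symm
    refine Finset.sum_congr rfl fun k hk => ?_
    have := measure_firstPassage_reflect hW hm (Nat.lt_succ_iff.1 (Finset.mem_range.1 hk)) a z
    simp only [Measure.real]
    exact congrArg _ this.symm
  have hs : MeasurableSet {ω | ∀ j : ℕ, j ≤ n → 0 ≤ a + W j ω} := by
    simp only [Set.ofPred_forall]
    exact MeasurableSet.iInter fun j => MeasurableSet.iInter fun _ =>
      measurableSet_le measurable_const ((hm _).const_add a)
  rw [h1, ← measureReal_inter_add_sdiff (s := {ω | z < W n ω}) hs, eq_sub_iff_add_eq]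
  congr 1
  · congr 1
    ext ω
    exact and_comm
  · congr 1
    ext ω
    simp only [Set.mem_ofPred_eq, Set.mem_sdiff]
    constructor
    · rintro ⟨k, hk, ⟨h2, -⟩, h4⟩
      exact ⟨h4, fun h => by linarith [h k hk]⟩
    · rintro ⟨h2, h3⟩
      obtain ⟨k, hk, h4, h5⟩ := exists_firstPassage (w := fun j => W j ω) h3
      exact ⟨k, hk, ⟨h4, h5⟩, h2⟩

theorem measureReal_lt_neg (hW : IsPreBrownianReal W P) (hm : ∀ t, Measurable (W t)) (n : ℕ)
    (c : ℝ) : P.real {ω | W n ω < -c} = P.real {ω | c < W n ω} := by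
  have hl := (hW.hasLaw_eval (n : ℝ≥0)).map_eq
  have e1 : P.real {ω | W n ω < -c} = (gaussianReal 0 n).real (Set.Iio (-c)) := by
    rw [← hl, map_measureReal_apply (hm _) measurableSet_Iio]; rfl
  have e2 : P.real {ω | c < W n ω} = (gaussianReal 0 n).real (Set.Ioi c) := by
    rw [← hl, map_measureReal_apply (hm _) measurableSet_Ioi]; rfl
  rw [e1, e2, ← gaussianReal_neg_symm n, map_measureReal_apply measurable_neg measurableSet_Ioi,
    gaussianReal_neg_symm]
  congr 1
  ext x
  simp

theorem measureReal_lt_sub (hW : IsPreBrownianReal W P) (hm : ∀ t, Measurable (W t)) (n : ℕ)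
    {c d : ℝ} (hcd : c ≤ d) : P.real {ω | c < W n ω} - P.real {ω | d < W n ω} =
      (gaussianReal 0 n).real (Set.Ioc c d) := by
  have hl := (hW.hasLaw_eval (n : ℝ≥0)).map_eq
  have e2 (c) : P.real {ω | c < W n ω} = (gaussianReal 0 n).real (Set.Ioi c) := by
    rw [← hl, map_measureReal_apply (hm _) measurableSet_Ioi]; rfl
  rw [e2, e2, ← Set.Ioi_sdiff_Ioi, measureReal_sdiff (Set.Ioi_subset_Ioi hcd) measurableSet_Ioi]

/-- Lower bound in the discrete reflection principle: the overshoot at the first passage has the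
favourable sign. -/
theorem le_measureReal_survival (hW : IsPreBrownianReal W P) (hm : ∀ t, Measurable (W t))
    (n : ℕ) {a : ℝ} (ha : 0 ≤ a) (z : ℝ) :
    (gaussianReal 0 n).real (Set.Ioc z (z + 2 * a)) ≤
      P.real {ω | (∀ j : ℕ, j ≤ n → 0 ≤ a + W j ω) ∧ z < W n ω} := by
  rw [measureReal_reflection hW hm, ← measureReal_lt_sub hW hm n (by linarith),
    ← measureReal_lt_neg hW hm n (z + 2 * a)]
  refine sub_le_sub_left (measureReal_mono ?_) _
  rintro ω ⟨k, hk, ⟨h1, -⟩, h3⟩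
  simp only [Set.mem_ofPred_eq]
  linarith

/-- Upper bound in the discrete reflection principle: the overshoot at the first passage is at most
`η`, unless some increment exceeds `η`. -/
theorem measureReal_survival_le (hW : IsPreBrownianReal W P) (hm : ∀ t, Measurable (W t))
    (n : ℕ) {a z η : ℝ} (ha : 0 ≤ a) (hη : 0 ≤ η) (hz : -a ≤ z) :
    P.real {ω | (∀ j : ℕ, j ≤ n → 0 ≤ a + W j ω) ∧ z < W n ω} ≤
      (gaussianReal 0 n).real (Set.Ioc z (z + 2 * a + 2 * η)) +
        P.real {ω | ∃ j < n, η < W (j : ℕ) ω - W (j + 1 : ℕ) ω} := by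
  rw [measureReal_reflection hW hm, ← measureReal_lt_sub hW hm n (by linarith),
    ← measureReal_lt_neg hW hm n (z + 2 * a + 2 * η)]
  suffices h : P.real {ω | W n ω < -(z + 2 * a + 2 * η)} ≤
      P.real {ω | ∃ k ≤ n, (W (k : ℕ) ω < -a ∧ ∀ j < k, -a ≤ W (j : ℕ) ω) ∧
        W n ω < 2 * W k ω - z} + P.real {ω | ∃ j < n, η < W (j : ℕ) ω - W (j + 1 : ℕ) ω} by
    linarith
  refine le_trans ?_ (measureReal_union_le _ _)
  refine ENNReal.toReal_mono (measure_ne_top _ _) (measure_mono_ae ?_)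
  filter_upwards [hW.eval_zero_ae_eq_zero] with ω h0 (hω : W n ω < -(z + 2 * a + 2 * η))
  by_cases hbad : ∃ j < n, η < W (j : ℕ) ω - W (j + 1 : ℕ) ω
  · exact Or.inr hbad
  · left
    obtain ⟨k, hk, h4, h5⟩ := exists_firstPassage (w := fun j => W j ω) (a := a) (n := n)
      (fun h => by have := h n le_rfl; linarith)
    refine ⟨k, hk, ⟨h4, h5⟩, ?_⟩
    rcases k with _ | k
    · simp only [Nat.cast_zero, h0] at h4; linarith
    · push Not at hbad
      have h6 := hbad k (by omega)
      have h7 := h5 k k.lt_succ_self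
      change W n ω < 2 * W (k + 1 : ℕ) ω - z
      change -a ≤ W (k : ℕ) ω at h7
      linarith

theorem measureReal_exists_large_increment_le (hW : IsPreBrownianReal W P)
    (n : ℕ) (η : ℝ) :
    P.real {ω | ∃ j < n, η < W (j : ℕ) ω - W (j + 1 : ℕ) ω} ≤ n * Real.exp (1 / 2 - η) := by
  have h1 (j : ℕ) : P.real {ω | η < W (j : ℕ) ω - W (j + 1 : ℕ) ω} ≤ Real.exp (1 / 2 - η) := by
    have hl : HasLaw (W (j : ℕ) - W (j + 1 : ℕ)) (gaussianReal 0 1) P := by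
      have := hW.hasLaw_sub (j : ℕ) (j + 1 : ℕ)
      rwa [show nndist ((j : ℕ) : ℝ≥0).1 ((j + 1 : ℕ) : ℝ≥0).1 = 1 by
        ext; simp] at this
    have hi : Integrable (fun ω => Real.exp (1 * (W (j : ℕ) - W (j + 1 : ℕ)) ω)) P := by
      have := (integrable_exp_mul_gaussianReal (μ := 0) (v := 1) 1)
      rw [← hl.map_eq] at this
      exact (integrable_map_measure (by fun_prop) hl.aemeasurable).1 this
    have := measure_ge_le_exp_mul_mgf (μ := P) (X := W (j : ℕ) - W (j + 1 : ℕ)) η zero_le_one hi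
    rw [mgf_gaussianReal hl.map_eq, ← Real.exp_add] at this
    refine (measureReal_mono fun ω (hω : η < _) => hω.le).trans (this.trans (le_of_eq ?_))
    congr 1; simp; ring
  have h2 : {ω | ∃ j < n, η < W (j : ℕ) ω - W (j + 1 : ℕ) ω} =
      ⋃ j ∈ Finset.range n, {ω | η < W (j : ℕ) ω - W (j + 1 : ℕ) ω} := by
    ext ω
    simp only [Set.mem_ofPred_eq, Finset.mem_range, Set.mem_iUnion, exists_prop]
  rw [h2]
  refine (measureReal_biUnion_finset_le _ _).trans ((Finset.sum_le_sum fun j _ => h1 j).trans ?_)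
  simp

end Reflection

/-! ### Gaussian estimates -/

section Gaussian

/-- The standard Gaussian density. -/
noncomputable def gaussDensity (u : ℝ) : ℝ := (√(2 * Real.pi))⁻¹ * Real.exp (-u ^ 2 / 2)

theorem abs_exp_neg_sq_sub_le (u w : ℝ) :
    |Real.exp (-u ^ 2 / 2) - Real.exp (-w ^ 2 / 2)| ≤ |u - w| := by
  have hd (x : ℝ) : HasDerivAt (fun u : ℝ => Real.exp (-u ^ 2 / 2))
      (Real.exp (-x ^ 2 / 2) * (-x)) x := by
    have : HasDerivAt (fun u : ℝ => -u ^ 2 / 2) (-x) x := by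
      have := ((hasDerivAt_pow 2 x).neg).div_const 2
      refine this.congr_deriv ?_
      simp; ring
    exact this.exp
  have := Convex.norm_image_sub_le_of_norm_hasDerivWithin_le (C := 1) (s := Set.univ)
    (f := fun u : ℝ => Real.exp (-u ^ 2 / 2)) (fun x _ => (hd x).hasDerivWithinAt)
    (fun x _ => ?_) convex_univ (Set.mem_univ w) (Set.mem_univ u)
  · simpa using this
  · rw [norm_mul, Real.norm_eq_abs, Real.norm_eq_abs, abs_neg, Real.abs_exp, neg_div, Real.exp_neg,
      inv_mul_le_iff₀ (Real.exp_pos _), mul_one]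
    have := Real.add_one_le_exp (x ^ 2 / 2)
    nlinarith [sq_nonneg (|x| - 1), sq_abs x]

theorem one_le_sqrt_two_pi : 1 ≤ √(2 * Real.pi) :=
  Real.one_le_sqrt.2 (by linarith [Real.pi_gt_three])

theorem abs_gaussDensity_sub_le (u w : ℝ) : |gaussDensity u - gaussDensity w| ≤ |u - w| := by
  unfold gaussDensity
  rw [← mul_sub, abs_mul, abs_of_nonneg (by positivity), inv_mul_le_iff₀ (by positivity)]
  nlinarith [abs_exp_neg_sq_sub_le u w, one_le_sqrt_two_pi, abs_nonneg (u - w)]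

theorem gaussDensity_nonneg (u : ℝ) : 0 ≤ gaussDensity u := by unfold gaussDensity; positivity

theorem gaussDensity_le_one (u : ℝ) : gaussDensity u ≤ 1 := by
  unfold gaussDensity
  have h1 : Real.exp (-u ^ 2 / 2) ≤ 1 := Real.exp_le_one_iff.2 (by nlinarith [sq_nonneg u])
  rw [inv_mul_le_iff₀ (by positivity)]
  linarith [one_le_sqrt_two_pi]

/-- The Gaussian law of variance `n` gives a short interval its length times the density. -/
theorem abs_gaussianReal_Ioc_sub_le {n : ℕ} (hn : 1 ≤ n) (z b : ℝ) {l : ℝ} (hl : 0 ≤ l) :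
    |(gaussianReal 0 n).real (Set.Ioc z (z + l)) - l * (√n)⁻¹ * gaussDensity b| ≤
      l * (√n)⁻¹ * (|z * (√n)⁻¹ - b| + l * (√n)⁻¹) := by
  simp only [← div_eq_mul_inv]
  have hn0 : (0 : ℝ) < n := by exact_mod_cast hn
  have hs : 0 < √(n : ℝ) := Real.sqrt_pos.2 hn0
  have hpdf (x : ℝ) : gaussianPDFReal 0 (n : ℝ≥0) x = gaussDensity (x / √n) / √n := by
    rw [gaussianPDFReal, gaussDensity, div_pow, Real.sq_sqrt hn0.le, NNReal.coe_natCast,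
      Real.sqrt_mul (by positivity), sub_zero, mul_inv, show -x ^ 2 / (2 * (n : ℝ)) =
      -(x ^ 2 / n) / 2 by field_simp]
    ring
  have h1 : (gaussianReal 0 n).real (Set.Ioc z (z + l)) =
      ∫ x in z..(z + l), gaussianPDFReal 0 n x := by
    rw [intervalIntegral.integral_of_le (by linarith), Measure.real,
      gaussianReal_apply_eq_integral _ (by positivity), ENNReal.toReal_ofReal]
    exact integral_nonneg fun x => gaussianPDFReal_nonneg _ _ _
  have h2 : l / √n * gaussDensity b = ∫ x in z..(z + l), gaussDensity b / √n := by
    simp; ring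
  rw [h1, h2, ← intervalIntegral.integral_sub (integrable_gaussianPDFReal _ _).intervalIntegrable
    (by simp), ← Real.norm_eq_abs]
  refine (intervalIntegral.norm_integral_le_of_norm_le_const
    (C := (|z / √n - b| + l / √n) / √n) fun x hx => ?_).trans (le_of_eq ?_)
  · rw [Set.uIoc_of_le (by linarith)] at hx
    rw [hpdf, ← sub_div, norm_div, Real.norm_eq_abs, Real.norm_eq_abs, abs_of_pos hs]
    gcongr
    refine (abs_gaussDensity_sub_le _ _).trans ?_
    rw [show x / √n - b = (z / √n - b) + (x - z) / √n by ring]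
    refine (abs_add_le _ _).trans ?_
    gcongr
    rw [abs_of_nonneg (div_nonneg (by linarith [hx.1]) hs.le)]
    gcongr
    linarith [hx.2]
  · rw [add_sub_cancel_left, abs_of_nonneg hl]; ring

end Gaussian

/-! ### Survival of the unperturbed walk -/

section Survival

/-- Stretched exponentials decay faster than powers. -/
theorem exists_exp_neg_rpow_le {c δ : ℝ} (hc : 0 < c) (hδ : 0 < δ) (a : ℝ) :
    ∃ C : ℝ, 0 ≤ C ∧ ∀ x : ℝ, 1 ≤ x → Real.exp (-(c * x ^ δ)) ≤ C * x ^ (-a) := by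
  obtain ⟨k, hk⟩ := exists_nat_ge (a / δ)
  refine ⟨k.factorial / c ^ k, by positivity, fun x hx => ?_⟩
  have hx0 : 0 < x := by linarith
  have h1 := Real.pow_div_factorial_le_exp (c * x ^ δ) (by positivity) k
  have h2 : x ^ a ≤ (x ^ δ) ^ k := by
    rw [← Real.rpow_natCast, ← Real.rpow_mul hx0.le]
    refine Real.rpow_le_rpow_of_exponent_le hx ?_
    rw [div_le_iff₀ hδ] at hk
    linarith
  rw [Real.exp_neg, Real.rpow_neg hx0.le, ← div_eq_mul_inv, div_div, ← one_div]
  rw [div_le_div_iff₀ (Real.exp_pos _) (by positivity), one_mul]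
  calc c ^ k * x ^ a ≤ c ^ k * (x ^ δ) ^ k := by gcongr
    _ = (c * x ^ δ) ^ k := by rw [mul_pow]
    _ ≤ k.factorial * Real.exp (c * x ^ δ) := by
      rw [div_le_iff₀ (by positivity)] at h1
      linarith

/-- The probability that the walk issued from `y` stays above `-s` up to time `m` and is above `c`
at that time. -/
noncomputable def survProb {G X : Type*} [Group G] [MeasurableSpace G] (μ : Measure G)
    (σ : G → X → ℝ) (x : X) (m : ℕ) (y s c : ℝ) : ℝ :=
  (pathLaw μ).real {ω | (∀ j ≤ m, 0 ≤ y + s + walk σ x j ω) ∧ c < y + walk σ x m ω}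


variable {G X : Type*} [Group G] [MulAction G X] [MeasurableSpace G] [MeasurableMul₂ G]
  [MeasurableSpace X]

theorem measurableSet_survival {σ : G → X → ℝ} (hσ : Measurable (fun z : G × X => σ z.1 z.2))
    (x : X) (m : ℕ) (y s c : ℝ) :
    MeasurableSet {ω | (∀ j ≤ m, 0 ≤ y + s + walk σ x j ω) ∧ c < y + walk σ x m ω} := by
  have hw (j : ℕ) : Measurable fun ω : ℕ → G => walk σ x j ω :=
    (measurable_walk hσ j).comp (measurable_id.prodMk measurable_const)
  simp only [Set.ofPred_and, Set.ofPred_forall]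
  exact (MeasurableSet.iInter fun j => MeasurableSet.iInter fun _ =>
    measurableSet_le measurable_const ((hw j).const_add _)).inter
    (measurableSet_lt measurable_const ((hw m).const_add _))

/-- Strong approximation and the reflection principle enclose the survival probability of the walk
between Gaussian probabilities of intervals. -/
theorem exists_survProb_bounds (μ : Measure G) [IsProbabilityMeasure μ] {σ : G → X → ℝ}
    (hσ : Measurable (fun z : G × X => σ z.1 z.2)) {v : ℝ} (hv : 0 < v)
    (happ : StrongApproximation μ σ v) :
    ∃ c₀ : ℝ, 0 ≤ c₀ ∧ ∀ (x : X) (m : ℕ), 1 ≤ m → ∀ y s c a a' z z' η : ℝ,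
      η = (m : ℝ) ^ (13 / 50 : ℝ) →
      a = max ((y + s + η) / v + 1) 0 → z = max ((c - y - η) / v) (-a) →
      a' = max ((y + s - η) / v) 0 → z' = max ((c - y + η) / v) (-a') →
      survProb μ σ x m y s c ≤ (gaussianReal 0 m).real (Set.Ioc z (z + (2 * a + 2 * η))) +
          m * Real.exp (1 / 2 - η) + c₀ * (m : ℝ) ^ (-(6 / 25) : ℝ) ∧
        (gaussianReal 0 m).real (Set.Ioc z' (z' + 2 * a')) - c₀ * (m : ℝ) ^ (-(6 / 25) : ℝ) ≤
          survProb μ σ x m y s c := by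
  obtain ⟨c, hc⟩ := happ
  refine ⟨max (c (6 / 25)) 0, le_max_right _ _, ?_⟩
  rintro x m hm y s d a a' z z' η hη ha hz ha' hz'
  obtain ⟨Ω', _, P', π, B, hπ, hB, hS⟩ := hc x
  have hP' : IsProbabilityMeasure P' := hB.toIsPreBrownianReal.isGaussianProcess.isProbabilityMeasure
  have hm0 : (0 : ℝ) < m := by exact_mod_cast hm
  have hη0 : 0 ≤ η := by rw [hη]; positivity
  let W : ℝ≥0 → Ω' → ℝ := fun t => (hB.aemeasurable t).mk
  have hW : IsPreBrownianReal W P' :=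
    hB.toIsPreBrownianReal.congr fun t => (hB.aemeasurable t).ae_eq_mk
  have hWm (t) : Measurable (W t) := (hB.aemeasurable t).measurable_mk
  have hBW : ∀ᵐ ω' ∂P', ∀ j : ℕ, B j ω' = W j ω' :=
    ae_all_iff.2 fun j => (hB.aemeasurable j).ae_eq_mk
  set D : Set Ω' := {ω' | ∃ t : ℝ≥0, t ≤ 1 ∧
    (m : ℝ) ^ (1 / 2 - 6 / 25 : ℝ) < |walk σ x ⌊(m : ℝ≥0) * t⌋₊ (π ω') - v * B (m * t) ω'|} with hDdef
  have hD : P'.real D ≤ max (c (6 / 25)) 0 * (m : ℝ) ^ (-(6 / 25) : ℝ) :=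
    (hS (6 / 25) (by norm_num) (by norm_num) m hm).trans (by gcongr; exact le_max_left _ _)
  have hclose : ∀ᵐ ω' ∂P', ω' ∉ D → ∀ j ≤ m, |walk σ x j (π ω') - v * W j ω'| ≤ η := by
    filter_upwards [hBW] with ω' h1 h2 j hj
    by_contra! h3
    refine h2 ⟨(j : ℝ≥0) / m, div_le_one_of_le₀ (by exact_mod_cast hj) (by positivity), ?_⟩
    have e : (m : ℝ≥0) * ((j : ℝ≥0) / m) = j := by
      have : (m : ℝ≥0) ≠ 0 := by exact_mod_cast hm0.ne'
      field_simp
    rw [e, Nat.floor_natCast, h1 j]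
    rw [hη] at h3
    rwa [show (1 / 2 - 6 / 25 : ℝ) = 13 / 50 by norm_num]
  have hsurv : survProb μ σ x m y s d =
      P'.real {ω' | (∀ j ≤ m, 0 ≤ y + s + walk σ x j (π ω')) ∧ d < y + walk σ x m (π ω')} := by
    rw [survProb, ← hπ.map_eq, map_measureReal_apply hπ.measurable
      (measurableSet_survival hσ x m y s d)]
    rfl
  constructor
  · have h1 : survProb μ σ x m y s d ≤
        P'.real ({ω | (∀ j : ℕ, j ≤ m → 0 ≤ a + W j ω) ∧ z < W m ω} ∪ D) := by
      rw [hsurv]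
      refine ENNReal.toReal_mono (measure_ne_top _ _) (measure_mono_ae ?_)
      filter_upwards [hclose] with ω' h1 h2
      by_cases hω : ω' ∈ D
      · exact Or.inr hω
      · have h3 := h1 hω
        have key : ∀ j : ℕ, j ≤ m → 0 ≤ (y + s + η) / v + W j ω' := by
          intro j hj
          have := (abs_le.1 (h3 j hj)).2
          have h4 := h2.1 j hj
          rw [div_add' _ _ _ hv.ne']
          exact div_nonneg (by linarith) hv.le
        refine Or.inl ⟨fun j hj => ?_, ?_⟩
        · linarith [key j hj, le_max_left ((y + s + η) / v + 1) 0, ha]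
        · rw [hz]
          refine max_lt ?_ ?_
          · rw [div_lt_iff₀ hv]
            have := (abs_le.1 (h3 m le_rfl)).2
            linarith [h2.2]
          · linarith [key m le_rfl, le_max_left ((y + s + η) / v + 1) 0, ha]
    have h2 := measureReal_survival_le hW hWm m (a := a) (z := z) (η := η)
      (by rw [ha]; exact le_max_right _ _) hη0 (by rw [hz]; exact le_max_right _ _)
    have h3 := measureReal_exists_large_increment_le hW m η
    have h4 := measureReal_union_le (μ := P')
      {ω | (∀ j : ℕ, j ≤ m → 0 ≤ a + W j ω) ∧ z < W m ω} D
    rw [← add_assoc]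
    linarith
  · have h1 : P'.real {ω | (∀ j : ℕ, j ≤ m → 0 ≤ a' + W j ω) ∧ z' < W m ω} - P'.real D ≤
        survProb μ σ x m y s d ∨ a' = 0 := by
      rcases le_or_gt ((y + s - η) / v) 0 with h0 | h0
      · right; rw [ha', max_eq_right h0]
      left
      rw [max_eq_left h0.le] at ha'
      rw [hsurv, sub_le_iff_le_add]
      refine le_trans ?_ (measureReal_union_le _ _)
      refine ENNReal.toReal_mono (measure_ne_top _ _) (measure_mono_ae ?_)
      filter_upwards [hclose] with ω' h1 h2
      by_cases hω : ω' ∈ D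
      · exact Or.inr hω
      · have h3 := h1 hω
        refine Or.inl ⟨fun j hj => ?_, ?_⟩
        · have := (abs_le.1 (h3 j hj)).1
          have h4 := h2.1 j hj
          rw [ha', div_add' _ _ _ hv.ne'] at h4
          have h5 : 0 ≤ (y + s - η + W j ω' * v) / v * v := mul_nonneg h4 hv.le
          rw [div_mul_cancel₀ _ hv.ne'] at h5
          linarith
        · have h4 := (le_max_left ((d - y + η) / v) (-a')).trans_lt (hz' ▸ h2.2)
          rw [div_lt_iff₀ hv] at h4
          have := (abs_le.1 (h3 m le_rfl)).1
          linarith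
    have h2 := le_measureReal_survival hW hWm m (a := a') (by rw [ha']; exact le_max_right _ _) z'
    rcases h1 with h1 | h1
    · linarith
    · have h5 : 0 ≤ survProb μ σ x m y s d := measureReal_nonneg
      have h6 : 0 ≤ max (c (6 / 25)) 0 * (m : ℝ) ^ (-(6 / 25) : ℝ) := by positivity
      rw [h1]
      simp only [mul_zero, add_zero, Set.Ioc_self, measureReal_empty]
      linarith

/-- Replacing the interval in the Gaussian bounds by its leading part. -/
theorem gaussian_main_term_le {w K₁ b₀ y η r r₀ h a l z c' b g : ℝ} (hw : 0 ≤ w)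
    (hK₁ : 0 ≤ K₁) (hb₀ : 0 ≤ b₀) (hr₀ : 0 < r₀) (hr : r₀ ≤ r) (hr2 : r ≤ 2 * r₀)
    (hrr : r - r₀ ≤ 4 * r₀ * h) (hη : 0 ≤ η) (hh : η * r₀ = h) (hh1 : h ≤ 1)
    (ha : |a - w * max y 0| ≤ K₁ * η) (hl0 : 0 ≤ l) (hl : |l - 2 * a| ≤ 2 * η)
    (hb : b = c' * r₀) (hb0 : 0 ≤ b) (hbb : b ≤ b₀) (hz : |z - c'| ≤ w * (|y| + η) + a)
    (hg0 : 0 ≤ g) (hg1 : g ≤ 1) :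
    |l * r * g - 2 * w * max y 0 * r₀ * g| + l * r * (|z * r - b| + l * r) ≤
      (4 * K₁ + 4 + 4 * w + 2 * (4 * w + 4 * K₁ + 4) * ((4 * w + 4 * K₁ + 4) +
        (4 * w + 2 * K₁ + 4 * b₀))) * (h + y ^ 2 * r₀ ^ 2) := by
  have hh0 : 0 ≤ h := by rw [← hh]; positivity
  have hy0 : max y 0 ≤ |y| := max_le (le_abs_self y) (abs_nonneg y)
  have hy0' : 0 ≤ max y 0 := le_max_right _ _
  have hr0 : 0 ≤ r := hr₀.le.trans hr
  obtain ⟨ha1, ha2⟩ := abs_le.1 ha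
  obtain ⟨hl1, hl2⟩ := abs_le.1 hl
  have hwy : w * max y 0 ≤ w * |y| := by gcongr
  set q := |y| * r₀ + h with hq
  have hyr : 0 ≤ |y| * r₀ := by positivity
  have hq0 : 0 ≤ q := by positivity
  have hq2 : q ^ 2 ≤ 2 * (h + y ^ 2 * r₀ ^ 2) := by
    have : y ^ 2 * r₀ ^ 2 = (|y| * r₀) ^ 2 := by rw [mul_pow, sq_abs]
    rw [this, hq]
    have : h ^ 2 ≤ h := by nlinarith
    linarith [sq_nonneg (|y| * r₀ - h)]
  have hlr : l * r ≤ (4 * w + 4 * K₁ + 4) * q := by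
    calc l * r ≤ (2 * (w * |y|) + (2 * K₁ + 2) * η) * (2 * r₀) := by
          refine mul_le_mul (by linarith) hr2 hr0 (by positivity)
      _ = 4 * w * (|y| * r₀) + (4 * K₁ + 4) * h := by rw [← hh]; ring
      _ ≤ _ := by
          have : 0 ≤ 4 * w * h + (4 * K₁ + 4) * (|y| * r₀) := by positivity
          rw [hq]; linarith
  have hlr0 : 0 ≤ l * r := by positivity
  have hzr : |z * r - b| ≤ (4 * w + 2 * K₁ + 4 * b₀) * q := by
    have e : z * r - b = (z - c') * r + c' * (r - r₀) := by rw [hb]; ring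
    have hc' : 0 ≤ c' := by
      by_contra! hneg
      have := mul_neg_of_neg_of_pos hneg hr₀
      linarith
    rw [e]
    refine (abs_add_le _ _).trans ?_
    rw [abs_mul, abs_mul, abs_of_nonneg hr0, abs_of_nonneg hc', abs_of_nonneg (sub_nonneg.2 hr)]
    have h1 : |z - c'| * r ≤ (w * (|y| + η) + (w * |y| + K₁ * η)) * (2 * r₀) := by
      refine mul_le_mul (by linarith) hr2 hr0 (by positivity)
    have h2 : c' * (r - r₀) ≤ b₀ * (4 * h) := by
      calc c' * (r - r₀) ≤ c' * (4 * r₀ * h) := by gcongr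
        _ = b * (4 * h) := by rw [hb]; ring
        _ ≤ _ := by gcongr
    have h3 : (w * (|y| + η) + (w * |y| + K₁ * η)) * (2 * r₀) =
        4 * w * (|y| * r₀) + (2 * w + 2 * K₁) * h := by rw [← hh]; ring
    have h4 : 0 ≤ 2 * w * h + (2 * K₁ + 4 * b₀) * (|y| * r₀) := by positivity
    rw [hq]
    linarith
  have hfirst : |l * r * g - 2 * w * max y 0 * r₀ * g| ≤
      (4 * K₁ + 4 + 4 * w) * (h + y ^ 2 * r₀ ^ 2) := by
    rw [← sub_mul, abs_mul, abs_of_nonneg hg0]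
    have e : l * r - 2 * w * max y 0 * r₀ = (l - 2 * a) * r + 2 * (a - w * max y 0) * r +
      2 * w * max y 0 * (r - r₀) := by ring
    have h1 : |l * r - 2 * w * max y 0 * r₀| ≤ 2 * η * r + 2 * (K₁ * η) * r +
        2 * w * |y| * (4 * r₀ * h) := by
      rw [e]
      refine (abs_add_le _ _).trans (add_le_add ((abs_add_le _ _).trans (add_le_add ?_ ?_)) ?_)
      · rw [abs_mul, abs_of_nonneg hr0]; gcongr
      · rw [abs_mul, abs_mul, abs_of_nonneg hr0, abs_of_nonneg zero_le_two]; gcongr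
      · rw [abs_mul, abs_of_nonneg (sub_nonneg.2 hr), abs_of_nonneg (by positivity)]
        gcongr
    have h2 : 2 * η * r + 2 * (K₁ * η) * r ≤ (4 * K₁ + 4) * h := by
      calc 2 * η * r + 2 * (K₁ * η) * r = (2 * K₁ + 2) * η * r := by ring
        _ ≤ (2 * K₁ + 2) * η * (2 * r₀) := by gcongr
        _ = _ := by rw [← hh]; ring
    have h3 : 2 * w * |y| * (4 * r₀ * h) ≤ 4 * w * (h + y ^ 2 * r₀ ^ 2) := by
      have e3 : y ^ 2 * r₀ ^ 2 = (|y| * r₀) ^ 2 := by rw [mul_pow, sq_abs]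
      have : h ^ 2 ≤ h := by nlinarith
      have : 2 * (|y| * r₀) * h ≤ h + (|y| * r₀) ^ 2 := by
        linarith [sq_nonneg (|y| * r₀ - h)]
      rw [e3]
      calc 2 * w * |y| * (4 * r₀ * h) = 4 * w * (2 * (|y| * r₀) * h) := by ring
        _ ≤ _ := by gcongr
    have h4 : 0 ≤ K₁ * (y ^ 2 * r₀ ^ 2) := by positivity
    have h5 : 0 ≤ y ^ 2 * r₀ ^ 2 := by positivity
    calc _ ≤ |l * r - 2 * w * max y 0 * r₀| * 1 := by gcongr
      _ ≤ (4 * K₁ + 4) * h + 4 * w * (h + y ^ 2 * r₀ ^ 2) := by linarith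
      _ ≤ _ := by linarith
  have hsecond : l * r * (|z * r - b| + l * r) ≤ (4 * w + 4 * K₁ + 4) *
      ((4 * w + 4 * K₁ + 4) + (4 * w + 2 * K₁ + 4 * b₀)) * q ^ 2 := by
    calc l * r * (|z * r - b| + l * r) ≤ ((4 * w + 4 * K₁ + 4) * q) *
          ((4 * w + 2 * K₁ + 4 * b₀) * q + (4 * w + 4 * K₁ + 4) * q) := by gcongr
      _ = _ := by ring
  have hthird : (4 * w + 4 * K₁ + 4) *
      ((4 * w + 4 * K₁ + 4) + (4 * w + 2 * K₁ + 4 * b₀)) * q ^ 2 ≤ (4 * w + 4 * K₁ + 4) *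
      ((4 * w + 4 * K₁ + 4) + (4 * w + 2 * K₁ + 4 * b₀)) * (2 * (h + y ^ 2 * r₀ ^ 2)) := by
    gcongr
  linarith

set_option maxHeartbeats 1000000 in
/-- The probability that the walk issued from `y` stays above a negligible level and ends above
`b v √n` is, for `y` small with respect to `√n`, close to the harmonic function `2 y⁺ / (v √n)`
times the Gaussian density at `b⁺`, uniformly in the starting point. -/
theorem exists_survProb_estimate (μ : Measure G) [IsProbabilityMeasure μ] {σ : G → X → ℝ}
    (hσ : Measurable (fun z : G × X => σ z.1 z.2)) {v : ℝ} (hv : 0 < v)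
    (happ : StrongApproximation μ σ v) {b₀ : ℝ} (hb₀ : 0 ≤ b₀) {Cs : ℝ} (hCs : 0 ≤ Cs) :
    ∃ C : ℝ, 0 ≤ C ∧ ∀ n m : ℕ, 1 ≤ m → m ≤ n → n ≤ 2 * m →
      (n : ℝ) - m ≤ 2 * (n : ℝ) ^ (3 / 5 : ℝ) → ∀ (x : X) (y s b : ℝ),
      |s| ≤ Cs * (n : ℝ) ^ (13 / 50 : ℝ) → b ≤ b₀ →
      |survProb μ σ x m y s (b * v * √n) - 2 * v⁻¹ * max y 0 * (√n)⁻¹ * gaussDensity (max b 0)| ≤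
        C * ((n : ℝ) ^ (-(6 / 25) : ℝ) + y ^ 2 / n) := by
  obtain ⟨c₀, hc₀, hbd⟩ := exists_survProb_bounds μ hσ hv happ
  obtain ⟨C₁, hC₁, hexp⟩ := exists_exp_neg_rpow_le (c := 1) (δ := 13 / 50) one_pos (by norm_num) 2
  set w := v⁻¹ with hwdef
  have hw : 0 ≤ w := by positivity
  set K₁ := (Cs + 1) * w + 1 with hK₁def
  have hK₁ : 0 ≤ K₁ := by positivity
  set A := 4 * K₁ + 4 + 4 * w + 2 * (4 * w + 4 * K₁ + 4) * ((4 * w + 4 * K₁ + 4) +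
        (4 * w + 2 * K₁ + 4 * b₀)) with hA
  have hA0 : 0 ≤ A := by positivity
  refine ⟨A + 2 * (Real.exp (1 / 2) * C₁) + 2 * c₀, by positivity, ?_⟩
  intro n m hm hmn hnm hnm' x y s b hs hb
  have hn : 1 ≤ n := hm.trans hmn
  have hn0 : (0 : ℝ) < n := by exact_mod_cast hn
  have hm0 : (0 : ℝ) < m := by exact_mod_cast hm
  have hn1 : (1 : ℝ) ≤ n := by exact_mod_cast hn
  have hm1 : (1 : ℝ) ≤ m := by exact_mod_cast hm
  have hmn' : (m : ℝ) ≤ n := by exact_mod_cast hmn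
  have hnm2 : (n : ℝ) ≤ 2 * m := by exact_mod_cast hnm
  have hsn : 0 < √(n : ℝ) := Real.sqrt_pos.2 hn0
  have hsm : 0 < √(m : ℝ) := Real.sqrt_pos.2 hm0
  set η := (m : ℝ) ^ (13 / 50 : ℝ) with hηdef
  set η' := (n : ℝ) ^ (13 / 50 : ℝ) with hη'def
  set h := (n : ℝ) ^ (-(6 / 25) : ℝ) with hhdef
  have hη0 : 0 ≤ η := by positivity
  have hηη' : η ≤ η' := Real.rpow_le_rpow hm0.le hmn' (by norm_num)
  have hη'1 : 1 ≤ η' := Real.one_le_rpow hn1 (by norm_num)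
  have hh0 : 0 ≤ h := by positivity
  have hh1 : h ≤ 1 := Real.rpow_le_one_of_one_le_of_nonpos hn1 (by norm_num)
  have hηh : η' * (√n)⁻¹ = h := by
    rw [Real.sqrt_eq_rpow, ← Real.rpow_neg hn0.le, hη'def, ← Real.rpow_add hn0]
    norm_num [hhdef]
  have hr : (√(n : ℝ))⁻¹ ≤ (√(m : ℝ))⁻¹ := by gcongr
  have hr2 : (√(m : ℝ))⁻¹ ≤ 2 * (√(n : ℝ))⁻¹ := by
    rw [inv_le_comm₀ hsm (by positivity), mul_inv, inv_inv, inv_mul_le_iff₀ two_pos]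
    refine Real.sqrt_le_iff.2 ⟨by positivity, ?_⟩
    rw [mul_pow, Real.sq_sqrt hm0.le]
    linarith
  have hrr : (√(m : ℝ))⁻¹ - (√(n : ℝ))⁻¹ ≤ 4 * (√(n : ℝ))⁻¹ * h := by
    have e1 : ((n : ℝ) - m) / n ≤ 2 * h := by
      rw [div_le_iff₀ hn0]
      refine hnm'.trans ?_
      rw [mul_assoc]
      gcongr
      rw [hhdef]
      nth_rw 3 [← Real.rpow_one (n : ℝ)]
      rw [← Real.rpow_add hn0]
      exact Real.rpow_le_rpow_of_exponent_le hn1 (by norm_num)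
    have e2 : (√(m : ℝ))⁻¹ - (√(n : ℝ))⁻¹ ≤ (√(m : ℝ))⁻¹ * (((n : ℝ) - m) / n) := by
      have hmn3 : √(m : ℝ) ≤ √n := Real.sqrt_le_sqrt hmn'
      have e3 : ((n : ℝ) - m) / n = 1 - √m ^ 2 / √n ^ 2 := by
        rw [Real.sq_sqrt hm0.le, Real.sq_sqrt hn0.le]; field_simp
      have e4 : (√(n : ℝ))⁻¹ = (√(m : ℝ))⁻¹ * (√m / √n) := by field_simp
      rw [e3, e4, ← div_pow]
      have e5 : √(m : ℝ) / √n ≤ 1 := div_le_one_of_le₀ hmn3 hsn.le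
      have e6 : 0 ≤ √(m : ℝ) / √n := by positivity
      have e7 : (√(m : ℝ) / √n) ^ 2 ≤ √(m : ℝ) / √n := by nlinarith
      have e8 : 0 ≤ (√(m : ℝ))⁻¹ := by positivity
      nlinarith
    calc _ ≤ (√(m : ℝ))⁻¹ * (((n : ℝ) - m) / n) := e2
      _ ≤ (2 * (√(n : ℝ))⁻¹) * (2 * h) := by
        refine mul_le_mul hr2 e1 (div_nonneg (by linarith) hn0.le) (by positivity)
      _ = _ := by ring
  have hsq : y ^ 2 * (√(n : ℝ))⁻¹ ^ 2 = y ^ 2 / n := by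
    rw [inv_pow, Real.sq_sqrt hn0.le, div_eq_mul_inv]
  set c' := max b 0 * √n with hc'def
  have hbc : max b 0 = c' * (√n)⁻¹ := by rw [hc'def]; field_simp
  have hc'max : c' = max (b * √n) 0 := by rw [hc'def, max_mul_of_nonneg _ _ hsn.le, zero_mul]
  have hwmax : w * max y 0 = max (y / v) 0 := by
    rw [mul_max_of_nonneg _ _ hw, mul_zero, hwdef, div_eq_inv_mul]
  have hbnn : 0 ≤ max b 0 := le_max_right _ _
  have hbb : max b 0 ≤ b₀ := max_le hb hb₀
  have hm_h : (m : ℝ) ^ (-(6 / 25) : ℝ) ≤ 2 * h := by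
    rw [hhdef, Real.rpow_neg hm0.le, Real.rpow_neg hn0.le,
      inv_le_comm₀ (by positivity) (by positivity), mul_inv, inv_inv, inv_mul_le_iff₀ two_pos]
    calc (n : ℝ) ^ (6 / 25 : ℝ) ≤ (2 * m : ℝ) ^ (6 / 25 : ℝ) :=
          Real.rpow_le_rpow hn0.le hnm2 (by norm_num)
      _ = (2 : ℝ) ^ (6 / 25 : ℝ) * (m : ℝ) ^ (6 / 25 : ℝ) := Real.mul_rpow (by norm_num) hm0.le
      _ ≤ (2 : ℝ) ^ (1 : ℝ) * (m : ℝ) ^ (6 / 25 : ℝ) := by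
          gcongr <;> norm_num
      _ = _ := by rw [Real.rpow_one]
  have htiny : m * Real.exp (1 / 2 - η) ≤ 2 * (Real.exp (1 / 2) * C₁) * h := by
    have h1 := hexp m hm1
    rw [one_mul, ← hηdef] at h1
    have h2 : (m : ℝ) * (m : ℝ) ^ (-2 : ℝ) ≤ (m : ℝ) ^ (-(6 / 25) : ℝ) := by
      nth_rw 1 [← Real.rpow_one (m : ℝ)]
      rw [← Real.rpow_add hm0]
      exact Real.rpow_le_rpow_of_exponent_le hm1 (by norm_num)
    calc m * Real.exp (1 / 2 - η) = Real.exp (1 / 2) * (m * Real.exp (-η)) := by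
          rw [sub_eq_add_neg, Real.exp_add]; ring
      _ ≤ Real.exp (1 / 2) * (m * (C₁ * (m : ℝ) ^ (-2 : ℝ))) := by gcongr
      _ = Real.exp (1 / 2) * C₁ * (m * (m : ℝ) ^ (-2 : ℝ)) := by ring
      _ ≤ Real.exp (1 / 2) * C₁ * (2 * h) :=
          mul_le_mul_of_nonneg_left (h2.trans hm_h) (by positivity)
      _ = _ := by ring
  obtain ⟨hU, hL⟩ := hbd x m hm y s (b * v * √n) _ _ _ _ η hηdef rfl rfl rfl rfl
  set a := max ((y + s + η) / v + 1) 0 with hadef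
  set a' := max ((y + s - η) / v) 0 with ha'def
  set z := max ((b * v * √n - y - η) / v) (-a) with hzdef
  set z' := max ((b * v * √n - y + η) / v) (-a') with hz'def
  have ha0 : 0 ≤ a := le_max_right _ _
  have ha'0 : 0 ≤ a' := le_max_right _ _
  have hη'w : w * η ≤ w * η' := by gcongr
  obtain ⟨hs1, hs2⟩ := abs_le.1 hs
  have hsw1 : -(w * (Cs * η')) ≤ w * s := by
    rw [← mul_neg]; exact mul_le_mul_of_nonneg_left hs1 hw
  have hsw2 : w * s ≤ w * (Cs * η') := mul_le_mul_of_nonneg_left hs2 hw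
  have hwη0 : 0 ≤ w * η := by positivity
  have haa : |a - w * max y 0| ≤ K₁ * η' := by
    rw [hwmax]
    refine (abs_max_sub_max_le_abs _ _ _).trans ?_
    rw [show (y + s + η) / v + 1 - y / v = w * s + w * η + 1 by rw [hwdef]; ring, abs_le,
      hK₁def]
    constructor <;> linarith
  have haa' : |a' - w * max y 0| ≤ K₁ * η' := by
    rw [hwmax]
    refine (abs_max_sub_max_le_abs _ _ _).trans ?_
    rw [show (y + s - η) / v - y / v = w * s - w * η by rw [hwdef]; ring, abs_le, hK₁def]
    constructor <;> linarith
  have hzz : |z - c'| ≤ w * (|y| + η') + a := by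
    rw [hc'max]
    refine (abs_max_sub_max_le_max _ _ _ _).trans (max_le ?_ ?_)
    · rw [show (b * v * √n - y - η) / v - b * √n = -(w * (y + η)) by rw [hwdef]; field_simp; ring,
        abs_neg, abs_mul, abs_of_nonneg hw]
      have : |y + η| ≤ |y| + η' := (abs_add_le _ _).trans (by rw [abs_of_nonneg hη0]; linarith)
      have := mul_le_mul_of_nonneg_left this hw
      linarith
    · rw [sub_zero, abs_neg, abs_of_nonneg ha0]
      have : 0 ≤ w * (|y| + η') := by positivity
      linarith
  have hzz' : |z' - c'| ≤ w * (|y| + η') + a' := by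
    rw [hc'max]
    refine (abs_max_sub_max_le_max _ _ _ _).trans (max_le ?_ ?_)
    · rw [show (b * v * √n - y + η) / v - b * √n = -(w * (y - η)) by rw [hwdef]; field_simp; ring,
        abs_neg, abs_mul, abs_of_nonneg hw]
      have : |y - η| ≤ |y| + η' := (abs_sub _ _).trans (by rw [abs_of_nonneg hη0]; linarith)
      have := mul_le_mul_of_nonneg_left this hw
      linarith
    · rw [sub_zero, abs_neg, abs_of_nonneg ha'0]
      have : 0 ≤ w * (|y| + η') := by positivity
      linarith
  have hr₀ : 0 < (√(n : ℝ))⁻¹ := by positivity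
  have mU := gaussian_main_term_le (l := 2 * a + 2 * η) (z := z) (g := gaussDensity (max b 0))
    hw hK₁ hb₀ hr₀ hr hr2 hrr (by positivity) hηh hh1 haa (by positivity)
    (by rw [add_sub_cancel_left, abs_of_nonneg (by positivity)]; gcongr) hbc hbnn hbb hzz
    (gaussDensity_nonneg _) (gaussDensity_le_one _)
  have mL := gaussian_main_term_le (l := 2 * a') (z := z') (g := gaussDensity (max b 0))
    hw hK₁ hb₀ hr₀ hr hr2 hrr (by positivity) hηh hh1 haa' (by positivity)
    (by rw [sub_self, abs_zero]; positivity) hbc hbnn hbb hzz'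
    (gaussDensity_nonneg _) (gaussDensity_le_one _)
  have gU := abs_gaussianReal_Ioc_sub_le hm z (max b 0) (l := 2 * a + 2 * η) (by positivity)
  have gL := abs_gaussianReal_Ioc_sub_le hm z' (max b 0) (l := 2 * a') (by positivity)
  rw [hsq, ← hA] at mU mL
  have hc : c₀ * (m : ℝ) ^ (-(6 / 25) : ℝ) ≤ 2 * c₀ * h := by
    calc _ ≤ c₀ * (2 * h) := by gcongr
      _ = _ := by ring
  have hyn : 0 ≤ y ^ 2 / n := by positivity
  have hfin : 0 ≤ (2 * (Real.exp (1 / 2) * C₁) + 2 * c₀) * (y ^ 2 / n) := by positivity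
  have hfin' : 0 ≤ 2 * (Real.exp (1 / 2) * C₁) * h := by positivity
  rw [abs_le]
  constructor
  · have := (abs_le.1 gL).1
    have h1 := neg_abs_le (2 * a' * (√(m : ℝ))⁻¹ * gaussDensity (max b 0) -
      2 * w * max y 0 * (√n)⁻¹ * gaussDensity (max b 0))
    linarith
  · have := (abs_le.1 gU).2
    have h1 := le_abs_self ((2 * a + 2 * η) * (√(m : ℝ))⁻¹ * gaussDensity (max b 0) -
      2 * w * max y 0 * (√n)⁻¹ * gaussDensity (max b 0))
    linarith

end Survival

/-! ### Moments of the walk -/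

section Moments

theorem integrable_and_integral_le_of_lintegral_le {α : Type*} [MeasurableSpace α] {m : Measure α}
    {h : α → ℝ} (hm : Measurable h) (h0 : ∀ a, 0 ≤ h a) {C : ℝ} (hC : 0 ≤ C)
    (hle : ∫⁻ a, ENNReal.ofReal (h a) ∂m ≤ ENNReal.ofReal C) :
    Integrable h m ∧ ∫ a, h a ∂m ≤ C := by
  constructor
  · refine ⟨hm.aestronglyMeasurable, ?_⟩
    rw [hasFiniteIntegral_iff_ofReal (Eventually.of_forall h0)]
    exact hle.trans_lt ENNReal.ofReal_lt_top
  · rw [integral_eq_lintegral_of_nonneg_ae (Eventually.of_forall h0) hm.aestronglyMeasurable]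
    exact ENNReal.toReal_le_of_le_ofReal hC hle

variable {G X : Type*} [Group G] [MulAction G X] [MeasurableSpace G] [MeasurableMul₂ G]
  [MeasurableSpace X] [MeasurableSMul₂ G X]

/-- Standing assumptions on the cocycle: measurability, the cocycle relation, stationarity of `ν`,
strong centering, and an exponential moment of order `a` bounded by `A`, uniformly in the starting
point. -/
structure WalkHyp (μ : Measure G) (ν : Measure X) (σ : G → X → ℝ) (a A : ℝ) : Prop where
  measurable : Measurable (fun z : G × X => σ z.1 z.2)
  cocycle : IsCocycle σ
  stationary : IsStationary μ ν
  centered : IsCentered μ σ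
  a_pos : 0 < a
  one_le_A : 1 ≤ A
  exp_le : ∀ x, ∫⁻ g, ENNReal.ofReal (Real.exp (a * |σ g x|)) ∂μ ≤ ENNReal.ofReal A

variable {μ : Measure G} [IsProbabilityMeasure μ] {ν : Measure X} [IsProbabilityMeasure ν]
  {σ : G → X → ℝ} {a A : ℝ}

theorem exp_le_one_add_add_sq_mul_exp (u : ℝ) : Real.exp u ≤ 1 + u + u ^ 2 * Real.exp |u| := by
  have h1 : 1 ≤ Real.exp |u| := Real.one_le_exp (abs_nonneg u)
  rcases le_total |u| 1 with h | h
  · have := (abs_le.1 (Real.abs_exp_sub_one_sub_id_le h)).2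
    nlinarith [sq_nonneg u]
  · have hu : 1 ≤ u ^ 2 := by rw [← sq_abs]; nlinarith
    rcases le_total 0 u with h0 | h0
    · rw [abs_of_nonneg h0] at h1 ⊢
      nlinarith
    · have h2 : Real.exp u ≤ 1 := Real.exp_le_one_iff.2 h0
      rw [abs_of_nonpos h0] at h h1 ⊢
      nlinarith

namespace WalkHyp

variable (hW : WalkHyp μ ν σ a A)
include hW

theorem measurable_right (x : X) : Measurable (fun g => σ g x) :=
  hW.measurable.comp (measurable_id.prodMk measurable_const)

theorem exp_integrable (x : X) : Integrable (fun g => Real.exp (a * |σ g x|)) μ ∧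
    ∫ g, Real.exp (a * |σ g x|) ∂μ ≤ A :=
  integrable_and_integral_le_of_lintegral_le
    (((hW.measurable_right x).norm.const_mul a).exp) (fun _ => (Real.exp_pos _).le)
    (zero_le_one.trans hW.one_le_A) (hW.exp_le x)

theorem integrable_right (x : X) : Integrable (fun g => σ g x) μ := by
  refine ((hW.exp_integrable x).1.const_mul a⁻¹).mono' (hW.measurable_right x).aestronglyMeasurable
    (Eventually.of_forall fun g => ?_)
  rw [Real.norm_eq_abs, ← div_eq_inv_mul, le_div_iff₀ hW.a_pos]
  linarith [Real.add_one_le_exp (a * |σ g x|)]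

/-- One step of the exponential martingale bound. -/
theorem lintegral_exp_mul_le (x : X) {l : ℝ} (hl : |l| ≤ a / 2) :
    ∫⁻ g, ENNReal.ofReal (Real.exp (l * σ g x)) ∂μ ≤
      ENNReal.ofReal (Real.exp (8 * A / a ^ 2 * l ^ 2)) := by
  have ha := hW.a_pos
  have hb (g : G) : Real.exp (l * σ g x) ≤
      1 + l * σ g x + 8 / a ^ 2 * l ^ 2 * Real.exp (a * |σ g x|) := by
    refine (exp_le_one_add_add_sq_mul_exp _).trans ?_
    have h1 : |l * σ g x| ≤ a / 2 * |σ g x| := by rw [abs_mul]; gcongr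
    have h2 : Real.exp |l * σ g x| ≤ Real.exp (a / 2 * |σ g x|) := Real.exp_le_exp.2 h1
    have h3 := Real.pow_div_factorial_le_exp (a / 2 * |σ g x|) (by positivity) 2
    have h4 : σ g x ^ 2 ≤ 8 / a ^ 2 * Real.exp (a / 2 * |σ g x|) := by
      rw [mul_pow, sq_abs] at h3
      rw [div_mul_eq_mul_div, le_div_iff₀ (by positivity)]
      simp only [Nat.factorial, Nat.cast_ofNat, Nat.succ_eq_add_one, Nat.reduceAdd, Nat.reduceMul] at h3
      nlinarith
    have h5 : Real.exp (a * |σ g x|) =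
        Real.exp (a / 2 * |σ g x|) * Real.exp (a / 2 * |σ g x|) := by
      rw [← Real.exp_add]; congr 1; ring
    have : (l * σ g x) ^ 2 * Real.exp |l * σ g x| ≤
        8 / a ^ 2 * l ^ 2 * Real.exp (a * |σ g x|) := by
      calc (l * σ g x) ^ 2 * Real.exp |l * σ g x|
          = l ^ 2 * (σ g x ^ 2 * Real.exp |l * σ g x|) := by ring
        _ ≤ l ^ 2 * ((8 / a ^ 2 * Real.exp (a / 2 * |σ g x|)) * Real.exp (a / 2 * |σ g x|)) := by
          gcongr
        _ = _ := by rw [h5]; ring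
    linarith
  have hi := hW.exp_integrable x
  have hint : Integrable (fun g => 1 + l * σ g x + 8 / a ^ 2 * l ^ 2 * Real.exp (a * |σ g x|)) μ :=
    ((integrable_const 1).add ((hW.integrable_right x).const_mul l)).add (hi.1.const_mul _)
  calc ∫⁻ g, ENNReal.ofReal (Real.exp (l * σ g x)) ∂μ
      ≤ ∫⁻ g, ENNReal.ofReal (1 + l * σ g x + 8 / a ^ 2 * l ^ 2 * Real.exp (a * |σ g x|)) ∂μ :=
        lintegral_mono fun g => ENNReal.ofReal_le_ofReal (hb g)
    _ = ENNReal.ofReal (∫ g, (1 + l * σ g x + 8 / a ^ 2 * l ^ 2 * Real.exp (a * |σ g x|)) ∂μ) :=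
        (ofReal_integral_eq_lintegral_ofReal hint
          (Eventually.of_forall fun g => (Real.exp_pos _).le.trans (hb g))).symm
    _ ≤ _ := by
        refine ENNReal.ofReal_le_ofReal ?_
        have e : ∫ g, (1 + l * σ g x + 8 / a ^ 2 * l ^ 2 * Real.exp (a * |σ g x|)) ∂μ =
            1 + 8 / a ^ 2 * l ^ 2 * ∫ g, Real.exp (a * |σ g x|) ∂μ := by
          rw [integral_add (f := fun g => 1 + l * σ g x)
            ((integrable_const 1).add ((hW.integrable_right x).const_mul l)) (hi.1.const_mul _),
            integral_add (integrable_const 1) ((hW.integrable_right x).const_mul l),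
            integral_const_mul, integral_const_mul, hW.centered x]
          simp
        rw [e]
        have h1 : 8 / a ^ 2 * l ^ 2 * ∫ g, Real.exp (a * |σ g x|) ∂μ ≤ 8 / a ^ 2 * l ^ 2 * A := by
          gcongr
          exact hi.2
        have h2 := Real.add_one_le_exp (8 * A / a ^ 2 * l ^ 2)
        calc _ ≤ 1 + 8 / a ^ 2 * l ^ 2 * A := by linarith
          _ = 8 * A / a ^ 2 * l ^ 2 + 1 := by ring
          _ ≤ _ := h2

theorem measurable_walk_right (x : X) (k : ℕ) : Measurable (fun ω : ℕ → G => walk σ x k ω) :=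
  (measurable_walk hW.measurable k).comp (measurable_id.prodMk measurable_const)

/-- Sub-Gaussian bound for small `l`: centering makes every step contribute a factor
`1 + O(l ^ 2)`. -/
theorem lintegral_exp_walk_le (x : X) (q : ℕ) {l : ℝ} (hl : |l| ≤ a / 2) :
    ∫⁻ ω, ENNReal.ofReal (Real.exp (l * walk σ x q ω)) ∂(pathLaw μ) ≤
      ENNReal.ofReal (Real.exp (8 * A / a ^ 2 * l ^ 2 * q)) := by
  induction q with
  | zero => simp [walk_zero hW.cocycle]
  | succ q ih =>
    have hm : Measurable fun ω : ℕ → G => ENNReal.ofReal (Real.exp (l * walk σ x (q + 1) ω)) :=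
      (((hW.measurable_walk_right x (q + 1)).const_mul l).exp).ennreal_ofReal
    rw [lintegral_concat μ q hm]
    have hin (ω : ℕ → G) : ∫⁻ ω', ENNReal.ofReal
        (Real.exp (l * walk σ x (q + 1) (concat q ω ω'))) ∂(pathLaw μ) ≤
        ENNReal.ofReal (Real.exp (l * walk σ x q ω)) *
          ENNReal.ofReal (Real.exp (8 * A / a ^ 2 * l ^ 2)) := by
      have e (ω' : ℕ → G) : ENNReal.ofReal
          (Real.exp (l * walk σ x (q + 1) (concat q ω ω'))) =
          ENNReal.ofReal (Real.exp (l * walk σ x q ω)) *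
          ENNReal.ofReal (Real.exp (l * σ (ω' 0) (leftProd ω q • x))) := by
        rw [walk_concat_add hW.cocycle, mul_add, Real.exp_add,
          ENNReal.ofReal_mul (Real.exp_pos _).le]
        simp [walk, leftProd]
      simp_rw [e]
      have hm2 : Measurable fun g => ENNReal.ofReal (Real.exp (l * σ g (leftProd ω q • x))) :=
        (((hW.measurable_right _).const_mul l).exp).ennreal_ofReal
      have hm3 : Measurable fun ω' : ℕ → G =>
          ENNReal.ofReal (Real.exp (l * σ (ω' 0) (leftProd ω q • x))) :=
        hm2.comp (measurable_pi_apply (X := fun _ : ℕ => G) 0)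
      rw [lintegral_const_mul _ hm3]
      gcongr
      refine le_trans (le_of_eq ?_) (hW.lintegral_exp_mul_le (leftProd ω q • x) hl)
      exact (measurePreserving_coord μ 0).lintegral_comp hm2
    refine (lintegral_mono hin).trans ?_
    rw [lintegral_mul_const _ ((((hW.measurable_walk_right x q).const_mul l).exp).ennreal_ofReal)]
    refine (mul_le_mul_left ih _).trans ?_
    rw [← ENNReal.ofReal_mul (Real.exp_pos _).le, ← Real.exp_add]
    refine ENNReal.ofReal_le_ofReal (Real.exp_le_exp.2 (le_of_eq ?_))
    push_cast; ring

/-- The fourth moment of the walk, uniformly in the starting point. -/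
theorem lintegral_walk_pow_four_le (x : X) (q : ℕ) :
    ∫⁻ ω, ENNReal.ofReal (walk σ x q ω ^ 4) ∂(pathLaw μ) ≤
      ENNReal.ofReal (768 / a ^ 4 * Real.exp (2 * A) * q ^ 2) := by
  rcases Nat.eq_zero_or_pos q with rfl | hq
  · simp [walk_zero hW.cocycle]
  have ha := hW.a_pos
  have hq0 : (0 : ℝ) < q := by exact_mod_cast hq
  have hq1 : (1 : ℝ) ≤ q := by exact_mod_cast hq
  set l := a / 2 / √q with hldef
  have hsq : 1 ≤ √(q : ℝ) := Real.one_le_sqrt.2 hq1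
  have hl0 : 0 < l := by positivity
  have hl : |l| ≤ a / 2 := by
    rw [abs_of_pos hl0]; exact div_le_self (by positivity) hsq
  have hl' : |-l| ≤ a / 2 := by rwa [abs_neg]
  have hl2 : l ^ 2 = a ^ 2 / (4 * q) := by
    rw [hldef, div_pow, Real.sq_sqrt hq0.le]; field_simp; norm_num
  have hl4 : l ^ 4 = a ^ 4 / (16 * q ^ 2) := by
    rw [show l ^ 4 = (l ^ 2) ^ 2 by ring, hl2]; field_simp; norm_num
  have hb (u : ℝ) : u ^ 4 ≤ 384 / a ^ 4 * q ^ 2 * (Real.exp (l * u) + Real.exp (-l * u)) := by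
    have h1 := Real.pow_div_factorial_le_exp |l * u| (abs_nonneg _) 4
    have h2 : Real.exp |l * u| ≤ Real.exp (l * u) + Real.exp (-l * u) := by
      rcases abs_cases (l * u) with h | h <;> rw [h.1]
      · linarith [Real.exp_pos (-l * u)]
      · rw [neg_mul]; linarith [Real.exp_pos (l * u)]
    rw [show |l * u| ^ 4 = l ^ 4 * u ^ 4 by
      rw [show (4 : ℕ) = 2 * 2 by norm_num, pow_mul, sq_abs]; ring, hl4] at h1
    simp only [Nat.factorial, Nat.cast_ofNat, Nat.succ_eq_add_one, Nat.reduceAdd, Nat.reduceMul] at h1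
    have h3 : u ^ 4 = 384 / a ^ 4 * q ^ 2 * (a ^ 4 / (16 * q ^ 2) * u ^ 4 / 24) := by
      field_simp; ring
    rw [h3]
    gcongr
    exact h1.trans h2
  have hE (l' : ℝ) (h : |l'| ≤ a / 2) (h2 : l' ^ 2 = l ^ 2) :
      ∫⁻ ω, ENNReal.ofReal (Real.exp (l' * walk σ x q ω)) ∂(pathLaw μ) ≤
        ENNReal.ofReal (Real.exp (2 * A)) := by
    refine (hW.lintegral_exp_walk_le x q h).trans (ENNReal.ofReal_le_ofReal ?_)
    rw [h2, hl2]
    refine Real.exp_le_exp.2 (le_of_eq ?_)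
    field_simp; ring
  have hmw := hW.measurable_walk_right x q
  calc ∫⁻ ω, ENNReal.ofReal (walk σ x q ω ^ 4) ∂(pathLaw μ)
      ≤ ∫⁻ ω, ENNReal.ofReal (384 / a ^ 4 * q ^ 2) *
          (ENNReal.ofReal (Real.exp (l * walk σ x q ω)) +
            ENNReal.ofReal (Real.exp (-l * walk σ x q ω))) ∂(pathLaw μ) := by
        refine lintegral_mono fun ω => ?_
        rw [← ENNReal.ofReal_add (Real.exp_pos _).le (Real.exp_pos _).le,
          ← ENNReal.ofReal_mul (by positivity)]
        exact ENNReal.ofReal_le_ofReal (hb _)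
    _ = ENNReal.ofReal (384 / a ^ 4 * q ^ 2) *
          (∫⁻ ω, ENNReal.ofReal (Real.exp (l * walk σ x q ω)) ∂(pathLaw μ) +
            ∫⁻ ω, ENNReal.ofReal (Real.exp (-l * walk σ x q ω)) ∂(pathLaw μ)) := by
        rw [lintegral_const_mul, lintegral_add_left]
        · exact ((hmw.const_mul l).exp).ennreal_ofReal
        · exact (((hmw.const_mul l).exp).ennreal_ofReal).add
            ((hmw.const_mul (-l)).exp).ennreal_ofReal
    _ ≤ ENNReal.ofReal (384 / a ^ 4 * q ^ 2) *
          (ENNReal.ofReal (Real.exp (2 * A)) + ENNReal.ofReal (Real.exp (2 * A))) := by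
        gcongr
        · exact hE l hl rfl
        · exact hE (-l) hl' (by ring)
    _ = _ := by
        rw [← ENNReal.ofReal_add (Real.exp_pos _).le (Real.exp_pos _).le,
          ← ENNReal.ofReal_mul (by positivity)]
        congr 1; ring

theorem lintegral_exp_incr_le (x : X) (k : ℕ) :
    ∫⁻ ω, ENNReal.ofReal (Real.exp (a * |incr σ x k ω|)) ∂(pathLaw μ) ≤ ENNReal.ofReal A := by
  have hm : Measurable fun ω : ℕ → G => ENNReal.ofReal (Real.exp (a * |incr σ x k ω|)) :=
    ((((measurable_incr hW.measurable k).comp (measurable_id.prodMk measurable_const)).norm.const_mul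
      a).exp).ennreal_ofReal
  rw [lintegral_concat μ k hm]
  refine (lintegral_mono (g := fun _ => ENNReal.ofReal A) fun ω => ?_).trans (by simp)
  refine le_trans (le_of_eq ?_) (hW.exp_le (leftProd ω k • x))
  have hm2 : Measurable fun g => ENNReal.ofReal (Real.exp (a * |σ g (leftProd ω k • x)|)) :=
    (((hW.measurable_right _).norm.const_mul a).exp).ennreal_ofReal
  rw [← (measurePreserving_coord μ 0).lintegral_comp hm2]
  refine lintegral_congr fun ω' => ?_
  rw [incr, leftProd_concat]
  have := concat_add k 0 ω ω'
  rw [zero_add] at this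
  rw [this]

end WalkHyp

/-- A bound on the integral over the paths, uniform in the starting point, bounds the integral over
paths and starting points. -/
theorem integrable_prod_and_integral_le {h : (ℕ → G) × X → ℝ} (hm : Measurable h) (h0 : ∀ z, 0 ≤ h z)
    {C : ℝ} (hC : 0 ≤ C)
    (hle : ∀ x, ∫⁻ ω, ENNReal.ofReal (h (ω, x)) ∂(pathLaw μ) ≤ ENNReal.ofReal C) :
    Integrable h ((pathLaw μ).prod ν) ∧ ∫ z, h z ∂((pathLaw μ).prod ν) ≤ C := by
  refine integrable_and_integral_le_of_lintegral_le hm h0 hC ?_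
  rw [lintegral_prod_symm' _ hm.ennreal_ofReal]
  exact (lintegral_mono hle).trans (by simp)

end Moments

/-! ### Perturbations of finite range -/

section Perturbation

variable {G X : Type*} [Group G] [MulAction G X] [MeasurableSpace G] [MeasurableMul₂ G]
  [MeasurableSpace X] [MeasurableSMul₂ G X]

/-- The perturbations averaged over all increments but the first `p`. -/
noncomputable def truncSeq (μ : Measure G) (p : ℕ) (f : ℕ → (ℕ → G) × X → ℝ) :
    ℕ → (ℕ → G) × X → ℝ :=
  fun k z => trunc μ p (fun ω => f k (ω, z.2)) z.1

/-- Measurable perturbations with exponential moments of order `a` and with an exponential rate of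
approximation, in mean square, by functions of finitely many increments. -/
structure PertHyp (μ : Measure G) (ν : Measure X) (a β A : ℝ) (f : ℕ → (ℕ → G) × X → ℝ) :
    Prop where
  measurable : ∀ n, Measurable (f n)
  exp_le : ∀ n, ∫⁻ z, ENNReal.ofReal (Real.exp (a * |f n z|)) ∂((pathLaw μ).prod ν) ≤
    ENNReal.ofReal A
  sq_le : ∀ n p : ℕ, ∫⁻ z, ENNReal.ofReal ((f n z - truncSeq μ p f n z) ^ 2)
    ∂((pathLaw μ).prod ν) ≤ ENNReal.ofReal (A * Real.exp (-(β * p)))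

/-- Twists with values in `[0, A]` and with an exponential rate of approximation, in mean square,
by functions of finitely many increments. -/
structure TwistHyp (μ : Measure G) (β A : ℝ) (θ : (ℕ → G) → ℝ) : Prop where
  measurable : Measurable θ
  nonneg : ∀ ω, 0 ≤ θ ω
  le : ∀ ω, θ ω ≤ A
  sq_le : ∀ p : ℕ, ∫⁻ ω, ENNReal.ofReal ((θ ω - trunc μ p θ ω) ^ 2) ∂(pathLaw μ) ≤
    ENNReal.ofReal (A * Real.exp (-(β * p)))

/-- A measure on `ℝ`, carried by `[-K, K]`, whose density is at most `c`. -/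
structure TestMeasure (l : Measure ℝ) (K c : ℝ) : Prop where
  le : ∀ s, l s ≤ ENNReal.ofReal c * volume s
  supp : ∀ᵐ t ∂l, |t| ≤ K
  K_nonneg : 0 ≤ K
  c_nonneg : 0 ≤ c

/-- The displacement of the perturbed walk. -/
def disp (σ : G → X → ℝ) (f : ℕ → (ℕ → G) × X → ℝ) (k : ℕ) (z : (ℕ → G) × X) : ℝ :=
  walk σ z.2 k z.1 + f k (shift^[k] z) - f 0 z

/-- The paths, starting points and starting levels for which the perturbed walk is non-negative at
the times `1, …, n`. -/
def alive (σ : G → X → ℝ) (f : ℕ → (ℕ → G) × X → ℝ) (n : ℕ) : Set (((ℕ → G) × X) × ℝ) :=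
  {w | ∀ k, 1 ≤ k → k ≤ n → 0 ≤ w.2 + disp σ f k w.1}

/-- The indicator of `alive`. -/
noncomputable def aliveInd (σ : G → X → ℝ) (f : ℕ → (ℕ → G) × X → ℝ) (n : ℕ) :
    ((ℕ → G) × X) × ℝ → ℝ := (alive σ f n).indicator 1

/-- The sum of the exponential excesses over `L` of the perturbations and the increments up to time
`N`. It bounds at once all of them and the indicator that one of them exceeds `L`. -/
noncomputable def excess (σ : G → X → ℝ) (f : ℕ → (ℕ → G) × X → ℝ) (a L : ℝ) (N : ℕ)
    (z : (ℕ → G) × X) : ℝ :=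
  ∑ k ∈ Finset.range (N + 1), (Real.exp (a * (|f k (shift^[k] z)| - L)) +
    Real.exp (a * (|incr σ z.2 k z.1| - L)))

theorem pertWalk_eq (σ : G → X → ℝ) (f : ℕ → (ℕ → G) × X → ℝ) (x : X) (t : ℝ) (n : ℕ)
    (ω : ℕ → G) : pertWalk σ f x t n ω = t + disp σ f n (ω, x) := by
  simp only [pertWalk, disp]; ring

theorem lt_exitTime_iff {σ : G → X → ℝ} {f : ℕ → (ℕ → G) × X → ℝ} {x : X} {t : ℝ} {n : ℕ}
    {ω : ℕ → G} : (n : ℕ∞) < exitTime σ f x t ω ↔ ((ω, x), t) ∈ alive σ f n := by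
  simp only [alive, Set.mem_ofPred_eq, exitTime, ← pertWalk_eq]
  constructor
  · intro h k hk hkn
    by_contra! hneg
    exact (h.trans_le (sInf_le ⟨k, hk, hneg, rfl⟩)).not_ge (by exact_mod_cast hkn)
  · intro h
    refine lt_of_lt_of_le (b := ((n + 1 : ℕ) : ℕ∞)) (by exact_mod_cast n.lt_succ_self)
      (le_sInf ?_)
    rintro _ ⟨k, hk, hneg, rfl⟩
    by_contra! hlt
    exact hneg.not_ge (h k hk (Nat.lt_succ_iff.1 (by exact_mod_cast hlt)))

theorem aliveInd_nonneg (σ : G → X → ℝ) (f : ℕ → (ℕ → G) × X → ℝ) (n : ℕ) (w) :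
    0 ≤ aliveInd σ f n w := Set.indicator_nonneg (fun _ _ => zero_le_one) _

theorem aliveInd_le_one (σ : G → X → ℝ) (f : ℕ → (ℕ → G) × X → ℝ) (n : ℕ) (w) :
    aliveInd σ f n w ≤ 1 := Set.indicator_le_self' (fun _ _ => zero_le_one) w

theorem aliveInd_of_mem {σ : G → X → ℝ} {f : ℕ → (ℕ → G) × X → ℝ} {n : ℕ} {w}
    (h : w ∈ alive σ f n) : aliveInd σ f n w = 1 := Set.indicator_of_mem h _

theorem aliveInd_of_notMem {σ : G → X → ℝ} {f : ℕ → (ℕ → G) × X → ℝ} {n : ℕ} {w}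
    (h : w ∉ alive σ f n) : aliveInd σ f n w = 0 := Set.indicator_of_notMem h _

theorem alive_antitone (σ : G → X → ℝ) (f : ℕ → (ℕ → G) × X → ℝ) : Antitone (alive σ f) :=
  fun _ _ hmn _ h k hk hkm => h k hk (hkm.trans hmn)

theorem aliveInd_antitone (σ : G → X → ℝ) (f : ℕ → (ℕ → G) × X → ℝ) (w) :
    Antitone fun n => aliveInd σ f n w :=
  fun _ _ hmn => Set.indicator_le_indicator_of_subset (alive_antitone σ f hmn)
    (fun _ => zero_le_one) w

variable {μ : Measure G} [IsProbabilityMeasure μ] {ν : Measure X} [IsProbabilityMeasure ν]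
  {σ : G → X → ℝ} {a β A : ℝ} {f : ℕ → (ℕ → G) × X → ℝ} {θ : (ℕ → G) → ℝ}
  {l : Measure ℝ} {K c : ℝ}

theorem measurable_shift_iterate (k : ℕ) :
    Measurable (shift^[k] : (ℕ → G) × X → (ℕ → G) × X) := measurable_shift.iterate k

theorem measurable_disp (hσ : Measurable (fun z : G × X => σ z.1 z.2)) (hf : ∀ n, Measurable (f n))
    (k : ℕ) : Measurable (disp σ f k) :=
  ((measurable_walk hσ k).add ((hf k).comp (measurable_shift_iterate k))).sub (hf 0)

theorem measurableSet_alive (hσ : Measurable (fun z : G × X => σ z.1 z.2))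
    (hf : ∀ n, Measurable (f n)) (n : ℕ) : MeasurableSet (alive σ f n) := by
  simp only [alive, Set.ofPred_forall]
  exact MeasurableSet.iInter fun k => MeasurableSet.iInter fun _ => MeasurableSet.iInter fun _ =>
    measurableSet_le measurable_const
      (measurable_snd.add ((measurable_disp hσ hf k).comp measurable_fst))

theorem measurable_aliveInd (hσ : Measurable (fun z : G × X => σ z.1 z.2))
    (hf : ∀ n, Measurable (f n)) (n : ℕ) : Measurable (aliveInd σ f n) :=
  measurable_one.indicator (measurableSet_alive hσ hf n)

theorem measurable_truncSeq (hf : ∀ n, Measurable (f n)) (p n : ℕ) :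
    Measurable (truncSeq μ p f n) := measurable_trunc μ p (hf n)

theorem excess_nonneg (L : ℝ) (N : ℕ) (z) : 0 ≤ excess σ f a L N z := by
  unfold excess; positivity

theorem exp_pert_le_excess (L : ℝ) {N k : ℕ} (hk : k ≤ N) (z) :
    Real.exp (a * (|f k (shift^[k] z)| - L)) ≤ excess σ f a L N z :=
  (le_add_of_nonneg_right (Real.exp_pos _).le).trans <|
    Finset.single_le_sum (f := fun k => Real.exp (a * (|f k (shift^[k] z)| - L)) +
      Real.exp (a * (|incr σ z.2 k z.1| - L))) (fun _ _ => by positivity)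
      (Finset.mem_range.2 (Nat.lt_succ_of_le hk))

theorem exp_incr_le_excess (L : ℝ) {N k : ℕ} (hk : k ≤ N) (z) :
    Real.exp (a * (|incr σ z.2 k z.1| - L)) ≤ excess σ f a L N z :=
  (le_add_of_nonneg_left (Real.exp_pos _).le).trans <|
    Finset.single_le_sum (f := fun k => Real.exp (a * (|f k (shift^[k] z)| - L)) +
      Real.exp (a * (|incr σ z.2 k z.1| - L))) (fun _ _ => by positivity)
      (Finset.mem_range.2 (Nat.lt_succ_of_le hk))

theorem le_add_exp_div (ha : 0 < a) (u L : ℝ) : u ≤ L + Real.exp (a * (u - L)) / a := by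
  have := Real.add_one_le_exp (a * (u - L))
  have h2 : u - L ≤ Real.exp (a * (u - L)) / a := by
    rw [le_div_iff₀ ha]; linarith
  linarith

theorem abs_pert_le (ha : 0 < a) (L : ℝ) {N k : ℕ} (hk : k ≤ N) (z) :
    |f k (shift^[k] z)| ≤ L + excess σ f a L N z / a :=
  (le_add_exp_div ha _ L).trans (by gcongr; exact exp_pert_le_excess L hk z)

theorem abs_incr_le (ha : 0 < a) (L : ℝ) {N k : ℕ} (hk : k ≤ N) (z) :
    |incr σ z.2 k z.1| ≤ L + excess σ f a L N z / a :=
  (le_add_exp_div ha _ L).trans (by gcongr; exact exp_incr_le_excess L hk z)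

theorem abs_pert_le_of_excess_lt_one (ha : 0 < a) {L : ℝ} {N k : ℕ} {z}
    (h : excess σ f a L N z < 1) (hk : k ≤ N) : |f k (shift^[k] z)| ≤ L := by
  have := Real.exp_lt_one_iff.1 ((exp_pert_le_excess L hk z).trans_lt h)
  have := neg_of_mul_neg_right this ha.le
  linarith

theorem abs_incr_le_of_excess_lt_one (ha : 0 < a) {L : ℝ} {N k : ℕ} {z}
    (h : excess σ f a L N z < 1) (hk : k ≤ N) : |incr σ z.2 k z.1| ≤ L := by
  have := Real.exp_lt_one_iff.1 ((exp_incr_le_excess L hk z).trans_lt h)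
  have := neg_of_mul_neg_right this ha.le
  linarith

namespace PertHyp

variable (hf : PertHyp μ ν a β A f) (hW : WalkHyp μ ν σ a A)
include hf hW

theorem exp_shift (n k : ℕ) :
    Integrable (fun z => Real.exp (a * |f n (shift^[k] z)|)) ((pathLaw μ).prod ν) ∧
      ∫ z, Real.exp (a * |f n (shift^[k] z)|) ∂((pathLaw μ).prod ν) ≤ A := by
  have hm : Measurable fun z => Real.exp (a * |f n z|) := ((hf.measurable n).norm.const_mul a).exp
  refine integrable_and_integral_le_of_lintegral_le (hm.comp (measurable_shift_iterate k))
    (fun _ => (Real.exp_pos _).le) (zero_le_one.trans hW.one_le_A) ?_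
  refine le_trans (le_of_eq ?_) (hf.exp_le n)
  exact (measurePreserving_shift_iterate hW.stationary k).lintegral_comp hm.ennreal_ofReal

theorem sq_shift (n k p : ℕ) :
    Integrable (fun z => (f n (shift^[k] z) - truncSeq μ p f n (shift^[k] z)) ^ 2)
      ((pathLaw μ).prod ν) ∧
      ∫ z, (f n (shift^[k] z) - truncSeq μ p f n (shift^[k] z)) ^ 2 ∂((pathLaw μ).prod ν) ≤
        A * Real.exp (-(β * p)) := by
  have hm : Measurable fun z => (f n z - truncSeq μ p f n z) ^ 2 :=
    ((hf.measurable n).sub (measurable_truncSeq hf.measurable p n)).pow_const 2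
  have hA := zero_le_one.trans hW.one_le_A
  refine integrable_and_integral_le_of_lintegral_le (hm.comp (measurable_shift_iterate k))
    (fun _ => sq_nonneg _) (by positivity) ?_
  refine le_trans (le_of_eq ?_) (hf.sq_le n p)
  exact (measurePreserving_shift_iterate hW.stationary k).lintegral_comp hm.ennreal_ofReal

omit hf in
theorem _root_.PerturbedWalk.WalkHyp.exp_incr (k : ℕ) :
    Integrable (fun z : (ℕ → G) × X => Real.exp (a * |incr σ z.2 k z.1|)) ((pathLaw μ).prod ν) ∧
      ∫ z : (ℕ → G) × X, Real.exp (a * |incr σ z.2 k z.1|) ∂((pathLaw μ).prod ν) ≤ A :=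
  integrable_prod_and_integral_le ((measurable_incr hW.measurable k).norm.const_mul a).exp
    (fun _ => (Real.exp_pos _).le) (zero_le_one.trans hW.one_le_A)
    fun x => hW.lintegral_exp_incr_le x k

theorem integrable_excess (L : ℝ) (N : ℕ) :
    Integrable (excess σ f a L N) ((pathLaw μ).prod ν) ∧
      ∫ z, excess σ f a L N z ∂((pathLaw μ).prod ν) ≤ 2 * (N + 1) * (A * Real.exp (-(a * L))) := by
  have e (u : ℝ) : Real.exp (a * (u - L)) = Real.exp (a * u) * Real.exp (-(a * L)) := by
    rw [← Real.exp_add]; congr 1; ring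
  have h1 (k : ℕ) : Integrable (fun z => Real.exp (a * (|f k (shift^[k] z)| - L)))
      ((pathLaw μ).prod ν) := by
    simp_rw [e]; exact (hf.exp_shift hW k k).1.mul_const _
  have h2 (k : ℕ) : Integrable (fun z : (ℕ → G) × X => Real.exp (a * (|incr σ z.2 k z.1| - L)))
      ((pathLaw μ).prod ν) := by
    simp_rw [e]; exact (hW.exp_incr k).1.mul_const _
  refine ⟨integrable_finsetSum _ fun k _ => (h1 k).add (h2 k), ?_⟩
  unfold excess
  have hsum (k : ℕ) := (h1 k).add (h2 k)
  simp only [Pi.add_def] at hsum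
  rw [integral_finsetSum _ fun k _ => hsum k]
  calc _ ≤ ∑ k ∈ Finset.range (N + 1), 2 * (A * Real.exp (-(a * L))) := by
        refine Finset.sum_le_sum fun k _ => ?_
        rw [integral_add (h1 k) (h2 k)]
        simp_rw [e]
        rw [integral_mul_const, integral_mul_const]
        have := mul_le_mul_of_nonneg_right (hf.exp_shift hW k k).2 (Real.exp_pos (-(a * L))).le
        have := mul_le_mul_of_nonneg_right (hW.exp_incr k).2 (Real.exp_pos (-(a * L))).le
        linarith
    _ = _ := by simp; ring

end PertHyp

theorem TwistHyp.sq (hθ : TwistHyp μ β A θ) (hA : 0 ≤ A) (p : ℕ) :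
    Integrable (fun z : (ℕ → G) × X => (θ z.1 - trunc μ p θ z.1) ^ 2) ((pathLaw μ).prod ν) ∧
      ∫ z : (ℕ → G) × X, (θ z.1 - trunc μ p θ z.1) ^ 2 ∂((pathLaw μ).prod ν) ≤
        A * Real.exp (-(β * p)) := by
  have hm : Measurable fun ω => (θ ω - trunc μ p θ ω) ^ 2 :=
    (hθ.measurable.sub (measurable_trunc' μ p hθ.measurable)).pow_const 2
  refine integrable_and_integral_le_of_lintegral_le (hm.comp measurable_fst)
    (fun _ => sq_nonneg _) (by positivity) (le_trans (le_of_eq ?_) (hθ.sq_le p))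
  exact (measurePreserving_fst (μ := pathLaw μ) (ν := ν)).lintegral_comp hm.ennreal_ofReal

theorem TwistHyp.trunc_nonneg (hθ : TwistHyp μ β A θ) (p : ℕ) (ω) : 0 ≤ trunc μ p θ ω :=
  integral_nonneg fun _ => hθ.nonneg _

theorem TwistHyp.trunc_le (hθ : TwistHyp μ β A θ) (p : ℕ) (ω) : trunc μ p θ ω ≤ A := by
  have h := norm_integral_le_of_norm_le_const (μ := pathLaw μ) (C := A)
    (f := fun ω' => θ (concat p ω ω'))
    (Eventually.of_forall fun ω' => by
      rw [Real.norm_eq_abs, abs_of_nonneg (hθ.nonneg _)]; exact hθ.le _)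
  rw [probReal_univ, mul_one] at h
  exact (le_abs_self _).trans h

theorem TwistHyp.one (hA : 1 ≤ A) : TwistHyp μ β A (fun _ => 1) where
  measurable := measurable_const
  nonneg _ := zero_le_one
  le _ := hA
  sq_le p := by simp [trunc]

/-! ### Dependence on finitely many increments -/

/-- The function depends on the path through its first `k` increments only. -/
def DependsOnFirst (k : ℕ) (h : ((ℕ → G) × X) × ℝ → ℝ) : Prop :=
  ∀ (ω₁ ω₂ : ℕ → G) (x : X) (t : ℝ), (∀ i < k, ω₁ i = ω₂ i) → h ((ω₁, x), t) = h ((ω₂, x), t)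

theorem disp_truncSeq_congr (p k : ℕ) {ω₁ ω₂ : ℕ → G} (x : X) (h : ∀ i < k + p, ω₁ i = ω₂ i) :
    disp σ (truncSeq μ p f) k (ω₁, x) = disp σ (truncSeq μ p f) k (ω₂, x) := by
  have hk : ∀ i < k, ω₁ i = ω₂ i := fun i hi => h i (by omega)
  simp only [disp, truncSeq, shift_iterate]
  rw [walk_congr σ x hk, leftProd_congr hk,
    trunc_congr μ (p := p) (fun ω => f 0 (ω, x)) fun i hi => h i (by omega),
    trunc_congr μ (p := p) (ω₁ := fun i => ω₁ (i + k)) (ω₂ := fun i => ω₂ (i + k)) _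
      fun i hi => h (i + k) (by omega)]

theorem dependsOnFirst_aliveInd (p m : ℕ) :
    DependsOnFirst (m + p) (aliveInd σ (truncSeq μ p f) m) := by
  intro ω₁ ω₂ x t h
  have : ((ω₁, x), t) ∈ alive σ (truncSeq μ p f) m ↔ ((ω₂, x), t) ∈ alive σ (truncSeq μ p f) m := by
    simp only [alive, Set.mem_ofPred_eq]
    refine forall_congr' fun k => forall_congr' fun _ => forall_congr' fun hk => ?_
    rw [disp_truncSeq_congr p k x fun i hi => h i (by omega)]
  by_cases h1 : ((ω₁, x), t) ∈ alive σ (truncSeq μ p f) m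
  · rw [aliveInd_of_mem h1, aliveInd_of_mem (this.1 h1)]
  · rw [aliveInd_of_notMem h1, aliveInd_of_notMem fun h2 => h1 (this.2 h2)]

variable [IsFiniteMeasure l]

/-- Two integrals over paths, starting points and levels agree if their integrals over the paths
do. -/
theorem integral_eq_of_slices {F₁ F₂ : ((ℕ → G) × X) × ℝ → ℝ}
    (h1 : Integrable F₁ (((pathLaw μ).prod ν).prod l))
    (h2 : Integrable F₂ (((pathLaw μ).prod ν).prod l))
    (h : ∀ x t, Integrable (fun ω => F₁ ((ω, x), t)) (pathLaw μ) →
      ∫ ω, F₁ ((ω, x), t) ∂(pathLaw μ) = ∫ ω, F₂ ((ω, x), t) ∂(pathLaw μ)) :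
    ∫ w, F₁ w ∂(((pathLaw μ).prod ν).prod l) = ∫ w, F₂ w ∂(((pathLaw μ).prod ν).prod l) := by
  rw [integral_prod_symm _ h1, integral_prod_symm _ h2]
  refine integral_congr_ae ?_
  filter_upwards [h1.prod_left_ae, h2.prod_left_ae] with t ht1 ht2
  rw [integral_prod_symm _ ht1, integral_prod_symm _ ht2]
  refine integral_congr_ae ?_
  filter_upwards [ht1.prod_left_ae] with x hx
  exact h x t hx

/-- By the centering, the increments are orthogonal to the bounded functions of the past. -/
theorem WalkHyp.integral_mul_incr_eq_zero (hW : WalkHyp μ ν σ a A) {k : ℕ}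
    {h : ((ℕ → G) × X) × ℝ → ℝ} (hdep : DependsOnFirst k h)
    (hint : Integrable (fun w => h w * incr σ w.1.2 k w.1.1) (((pathLaw μ).prod ν).prod l)) :
    ∫ w, h w * incr σ w.1.2 k w.1.1 ∂(((pathLaw μ).prod ν).prod l) = 0 := by
  rw [integral_eq_of_slices (F₂ := fun _ => 0) hint (integrable_zero _ _ _), integral_zero]
  intro x t hxt
  rw [integral_concat μ k hxt, integral_zero]
  refine integral_eq_zero_of_ae (Eventually.of_forall fun ω => ?_)
  have e (ω' : ℕ → G) : h ((concat k ω ω', x), t) * incr σ x k (concat k ω ω') =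
      h ((ω, x), t) * σ (ω' 0) (leftProd ω k • x) := by
    rw [hdep (concat k ω ω') ω x t fun i hi => concat_apply_of_lt hi _ _, incr, leftProd_concat]
    have := concat_add k 0 ω ω'
    rw [zero_add] at this
    rw [this]
  simp only [e, Pi.zero_apply]
  rw [integral_const_mul, integral_comp_measurePreserving (measurePreserving_coord μ 0)
    (g := fun g => σ g (leftProd ω k • x)) (hW.measurable_right _).aestronglyMeasurable,
    hW.centered, mul_zero]

theorem measurable_survProb (hσ : Measurable (fun z : G × X => σ z.1 z.2)) (m : ℕ) (s c : ℝ) :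
    Measurable (fun u : X × ℝ => survProb μ σ u.1 m u.2 s c) := by
  have hw (j : ℕ) : Measurable fun v : (X × ℝ) × (ℕ → G) => walk σ v.1.1 j v.2 :=
    (measurable_walk hσ j).comp (measurable_snd.prodMk (measurable_fst.comp measurable_fst))
  have hs : MeasurableSet {v : (X × ℝ) × (ℕ → G) |
      (∀ j ≤ m, 0 ≤ v.1.2 + s + walk σ v.1.1 j v.2) ∧ c < v.1.2 + walk σ v.1.1 m v.2} := by
    simp only [Set.ofPred_and, Set.ofPred_forall]
    refine (MeasurableSet.iInter fun j => MeasurableSet.iInter fun _ =>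
      measurableSet_le measurable_const (Measurable.add (by fun_prop) (hw j))).inter
      (measurableSet_lt measurable_const (Measurable.add (by fun_prop) (hw m)))
  exact (measurable_measure_prodMk_left hs).ennreal_toReal

/-- The event that the walk issued from the level `t` stays above `-s` at the times `q, …, q + m`
and is above `c` at the last one. -/
def survEvent (σ : G → X → ℝ) (q m : ℕ) (s c : ℝ) : Set (((ℕ → G) × X) × ℝ) :=
  {w | (∀ j ≤ m, 0 ≤ w.2 + s + walk σ w.1.2 (q + j) w.1.1) ∧ c < w.2 + walk σ w.1.2 (q + m) w.1.1}

theorem measurableSet_survEvent (hσ : Measurable (fun z : G × X => σ z.1 z.2)) (q m : ℕ)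
    (s c : ℝ) : MeasurableSet (survEvent σ q m s c) := by
  have hw (j : ℕ) : Measurable fun w : ((ℕ → G) × X) × ℝ => walk σ w.1.2 j w.1.1 :=
    (measurable_walk hσ j).comp measurable_fst
  simp only [survEvent, Set.ofPred_and, Set.ofPred_forall]
  exact (MeasurableSet.iInter fun j => MeasurableSet.iInter fun _ =>
    measurableSet_le measurable_const (Measurable.add (by fun_prop) (hw _))).inter
    (measurableSet_lt measurable_const (Measurable.add (by fun_prop) (hw _)))

/-- Markov property at time `q`. -/
theorem WalkHyp.integral_mul_survEvent (hW : WalkHyp μ ν σ a A) {q : ℕ} (m : ℕ) (s c : ℝ)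
    {h : ((ℕ → G) × X) × ℝ → ℝ} (hm : Measurable h) {C : ℝ} (hC : ∀ w, |h w| ≤ C)
    (hdep : DependsOnFirst q h) :
    ∫ w, h w * (survEvent σ q m s c).indicator 1 w ∂(((pathLaw μ).prod ν).prod l) =
      ∫ w, h w * survProb μ σ (leftProd w.1.1 q • w.1.2) m (w.2 + walk σ w.1.2 q w.1.1) s c
        ∂(((pathLaw μ).prod ν).prod l) := by
  have hS := measurableSet_survEvent (X := X) hW.measurable q m s c
  have hbd {g : ((ℕ → G) × X) × ℝ → ℝ} (hg : Measurable g) (hg1 : ∀ w, |g w| ≤ 1) :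
      Integrable (fun w => h w * g w) (((pathLaw μ).prod ν).prod l) := by
    refine Integrable.of_bound (hm.mul hg).aestronglyMeasurable C (Eventually.of_forall fun w => ?_)
    rw [norm_mul, Real.norm_eq_abs, Real.norm_eq_abs]
    calc |h w| * |g w| ≤ |h w| * 1 := by gcongr; exact hg1 w
      _ ≤ C := by rw [mul_one]; exact hC w
  refine integral_eq_of_slices (hbd (measurable_one.indicator hS) fun w => ?_) (hbd ?_ fun w => ?_) ?_
  · by_cases hw : w ∈ survEvent σ q m s c <;> simp [hw]
  · refine (measurable_survProb hW.measurable m s c).comp (Measurable.prodMk ?_ ?_)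
    · exact ((measurable_leftProd q).comp (measurable_fst.comp measurable_fst)).smul
        (measurable_snd.comp measurable_fst)
    · exact measurable_snd.add ((measurable_walk hW.measurable q).comp measurable_fst)
  · rw [survProb, abs_of_nonneg measureReal_nonneg]
    exact measureReal_le_one
  · intro x t hi
    rw [integral_concat μ q hi]
    refine integral_congr_ae (Eventually.of_forall fun ω => ?_)
    have e (ω' : ℕ → G) : h ((concat q ω ω', x), t) *
        (survEvent σ q m s c).indicator 1 ((concat q ω ω', x), t) = h ((ω, x), t) *
        {ω' | (∀ j ≤ m, 0 ≤ t + walk σ x q ω + s + walk σ (leftProd ω q • x) j ω') ∧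
          c < t + walk σ x q ω + walk σ (leftProd ω q • x) m ω'}.indicator 1 ω' := by
      rw [hdep (concat q ω ω') ω x t fun i hi => concat_apply_of_lt hi _ _]
      congr 1
      have hiff : ((concat q ω ω', x), t) ∈ survEvent σ q m s c ↔
          ω' ∈ {ω' | (∀ j ≤ m, 0 ≤ t + walk σ x q ω + s + walk σ (leftProd ω q • x) j ω') ∧
            c < t + walk σ x q ω + walk σ (leftProd ω q • x) m ω'} := by
        simp only [survEvent, Set.mem_ofPred_eq, walk_concat_add hW.cocycle, ← add_assoc]
        constructor <;> rintro ⟨h1, h2⟩ <;> exact ⟨fun j hj => by linarith [h1 j hj], h2⟩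
      by_cases hω : ((concat q ω ω', x), t) ∈ survEvent σ q m s c
      · rw [Set.indicator_of_mem hω, Set.indicator_of_mem (hiff.1 hω)]; rfl
      · rw [Set.indicator_of_notMem hω, Set.indicator_of_notMem fun h => hω (hiff.2 h)]
    simp only [e]
    rw [integral_const_mul, integral_indicator_one
      (measurableSet_survival hW.measurable _ m _ s c)]
    rfl

end Perturbation

/-! ### Replacing the perturbations by perturbations of finite range -/

section Transfer

variable {G X : Type*} [Group G] [MulAction G X] [MeasurableSpace G] [MeasurableMul₂ G]
  [MeasurableSpace X] [MeasurableSMul₂ G X]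

/-- The law of path, starting point and starting level. -/
noncomputable abbrev fullLaw (μ : Measure G) (ν : Measure X) (l : Measure ℝ) :
    Measure (((ℕ → G) × X) × ℝ) := ((pathLaw μ).prod ν).prod l

variable {μ : Measure G} [IsProbabilityMeasure μ] {ν : Measure X} [IsProbabilityMeasure ν]
  {σ : G → X → ℝ} {a β A : ℝ} {f : ℕ → (ℕ → G) × X → ℝ} {θ : (ℕ → G) → ℝ}
  {l : Measure ℝ} {K c : ℝ}

theorem TestMeasure.ae_abs_le (hl : TestMeasure l K c) [IsFiniteMeasure l] :
    ∀ᵐ w ∂(fullLaw μ ν l), |w.2| ≤ K :=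
  Measure.quasiMeasurePreserving_snd.ae hl.supp

theorem mul_abs_le_of_pos {e : ℝ} (he : 0 < e) (u w : ℝ) :
    u * |w| ≤ (e * u ^ 2 + w ^ 2 / e) / 2 := by
  have h : (e * u ^ 2 + w ^ 2 / e) / 2 - u * |w| = (e * u - |w|) ^ 2 / (2 * e) := by
    rw [← sq_abs w]; field_simp; ring
  have : 0 ≤ (e * u - |w|) ^ 2 / (2 * e) := by positivity
  linarith

/-- The starting levels for which the survival of two perturbed walks differs. -/
theorem abs_aliveInd_sub_le (σ : G → X → ℝ) (f f' : ℕ → (ℕ → G) × X → ℝ) (m : ℕ)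
    (z : (ℕ → G) × X) (t : ℝ) :
    |aliveInd σ f m (z, t) - aliveInd σ f' m (z, t)| ≤ ∑ k ∈ Finset.Icc 1 m,
      (Set.uIcc (-disp σ f k z) (-disp σ f' k z)).indicator 1 t := by
  have key (f f' : ℕ → (ℕ → G) × X → ℝ) (h : (z, t) ∈ alive σ f m) (h' : (z, t) ∉ alive σ f' m) :
      (1 : ℝ) ≤ ∑ k ∈ Finset.Icc 1 m,
        (Set.uIcc (-disp σ f k z) (-disp σ f' k z)).indicator 1 t := by
    simp only [alive, Set.mem_ofPred_eq, not_forall] at h h'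
    obtain ⟨k, hk1, hkm, hneg⟩ := h'
    have hmem : t ∈ Set.uIcc (-disp σ f k z) (-disp σ f' k z) := by
      have := h k hk1 hkm
      rw [Set.mem_uIcc]
      left; constructor <;> linarith
    refine le_trans ?_ (Finset.single_le_sum (f := fun k =>
      (Set.uIcc (-disp σ f k z) (-disp σ f' k z)).indicator (1 : ℝ → ℝ) t)
      (fun i _ => Set.indicator_nonneg (fun _ _ => zero_le_one) _) (Finset.mem_Icc.2 ⟨hk1, hkm⟩))
    simp only [Set.indicator_of_mem hmem, Pi.one_apply, le_refl]
  have hnn : (0 : ℝ) ≤ ∑ k ∈ Finset.Icc 1 m,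
      (Set.uIcc (-disp σ f k z) (-disp σ f' k z)).indicator 1 t :=
    Finset.sum_nonneg fun i _ => Set.indicator_nonneg (fun _ _ => zero_le_one) _
  by_cases h : (z, t) ∈ alive σ f m <;> by_cases h' : (z, t) ∈ alive σ f' m
  · rwa [aliveInd_of_mem h, aliveInd_of_mem h', sub_self, abs_zero]
  · rw [aliveInd_of_mem h, aliveInd_of_notMem h', sub_zero, abs_one]
    exact key f f' h h'
  · rw [aliveInd_of_notMem h, aliveInd_of_mem h', zero_sub, abs_neg, abs_one]
    simpa only [Set.uIcc_comm] using key f' f h' h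
  · rwa [aliveInd_of_notMem h, aliveInd_of_notMem h', sub_self, abs_zero]

theorem TestMeasure.real_uIcc_le (hl : TestMeasure l K c) (u w : ℝ) :
    l.real (Set.uIcc u w) ≤ c * |w - u| := by
  refine ENNReal.toReal_le_of_le_ofReal (mul_nonneg hl.c_nonneg (abs_nonneg _)) ?_
  refine (hl.le _).trans (le_of_eq ?_)
  rw [Real.volume_interval, ENNReal.ofReal_mul hl.c_nonneg]

/-- Averaging over the starting level makes the survival indicator a Lipschitz function of the
perturbations. -/
theorem TestMeasure.integral_abs_aliveInd_sub_le (hl : TestMeasure l K c) [IsFiniteMeasure l]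
    (σ : G → X → ℝ) (f f' : ℕ → (ℕ → G) × X → ℝ) (m : ℕ) (z : (ℕ → G) × X) :
    ∫ t, |aliveInd σ f m (z, t) - aliveInd σ f' m (z, t)| ∂l ≤
      c * ∑ k ∈ Finset.Icc 1 m, |disp σ f k z - disp σ f' k z| := by
  have hi (k : ℕ) : Integrable ((Set.uIcc (-disp σ f k z) (-disp σ f' k z)).indicator
      (1 : ℝ → ℝ)) l := (integrable_const (1 : ℝ)).indicator measurableSet_uIcc
  refine (integral_mono_of_nonneg (Eventually.of_forall fun _ => abs_nonneg _)
    (integrable_finsetSum (Finset.Icc 1 m) fun k _ => hi k) (Eventually.of_forall fun t =>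
      abs_aliveInd_sub_le σ f f' m z t)).trans ?_
  rw [integral_finsetSum _ fun k _ => hi k, Finset.mul_sum]
  refine Finset.sum_le_sum fun k _ => ?_
  rw [integral_indicator_one measurableSet_uIcc]
  refine (hl.real_uIcc_le _ _).trans (le_of_eq ?_)
  rw [show -disp σ f' k z - -disp σ f k z = disp σ f k z - disp σ f' k z by ring]

variable [IsFiniteMeasure l]

/-- The cost of averaging the perturbations and the twist over all increments but the first `p` is
exponentially small in `p`. -/
theorem abs_integral_sub_integral_truncSeq_le (hW : WalkHyp μ ν σ a A) (hf : PertHyp μ ν a β A f)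
    (hθ : TwistHyp μ β A θ) (hl : TestMeasure l K c) {w : ((ℕ → G) × X) × ℝ → ℝ}
    (hw : Measurable w) {W : (ℕ → G) × X → ℝ} (hWm : Measurable W) (hW0 : ∀ z, 0 ≤ W z)
    (hwW : ∀ z t, |t| ≤ K → |w (z, t)| ≤ W z) {V : ℝ}
    (hWi : Integrable (fun z => W z ^ 2) ((pathLaw μ).prod ν))
    (hWV : ∫ z, W z ^ 2 ∂((pathLaw μ).prod ν) ≤ V) (p m : ℕ) :
    |∫ x, θ x.1.1 * w x * aliveInd σ f m x ∂(fullLaw μ ν l) -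
      ∫ x, trunc μ p θ x.1.1 * w x * aliveInd σ (truncSeq μ p f) m x ∂(fullLaw μ ν l)| ≤
      Real.exp (-(β * p / 2)) * (V + A) * (l.real Set.univ + A * c * m) := by
  have hA := zero_le_one.trans hW.one_le_A
  set f' := truncSeq μ p f with hf'
  set θ' := trunc μ p θ with hθ'
  set e := Real.exp (-(β * p / 2)) with hedef
  have he : 0 < e := Real.exp_pos _
  have hee : Real.exp (-(β * p)) = e * e := by rw [hedef, ← Real.exp_add]; congr 1; ring
  have hθ'm : Measurable θ' := measurable_trunc' μ p hθ.measurable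
  have hf'm : ∀ n, Measurable (f' n) := measurable_truncSeq hf.measurable p
  have hW1 : Integrable W ((pathLaw μ).prod ν) := by
    refine (hWi.add (integrable_const 1)).mono' hWm.aestronglyMeasurable
      (Eventually.of_forall fun z => ?_)
    simp only [Pi.add_apply]
    rw [Real.norm_eq_abs, abs_of_nonneg (hW0 z)]
    nlinarith [sq_nonneg (W z - 1)]
  -- the contribution of the twist
  have hTi : Integrable (fun z => W z * |θ z.1 - θ' z.1|) ((pathLaw μ).prod ν) ∧
      ∫ z, W z * |θ z.1 - θ' z.1| ∂((pathLaw μ).prod ν) ≤ e * (V + A) := by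
    have hsq := hθ.sq (ν := ν) hA p
    have hi := ((hWi.const_mul e).add (hsq.1.div_const e)).div_const 2
    refine ⟨hi.mono' ?_ (Eventually.of_forall fun z => ?_), ?_⟩
    · exact (hWm.mul ((hθ.measurable.comp measurable_fst).sub
        (hθ'm.comp measurable_fst)).norm).aestronglyMeasurable
    · rw [Real.norm_eq_abs, abs_of_nonneg (mul_nonneg (hW0 z) (abs_nonneg _))]
      exact mul_abs_le_of_pos he _ _
    · refine (integral_mono_of_nonneg (Eventually.of_forall fun z =>
        mul_nonneg (hW0 z) (abs_nonneg _)) hi (Eventually.of_forall fun z =>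
        mul_abs_le_of_pos he _ _)).trans ?_
      have hadd : ∫ z, (e * W z ^ 2 + (θ z.1 - θ' z.1) ^ 2 / e) / 2 ∂((pathLaw μ).prod ν) =
          (e * ∫ z, W z ^ 2 ∂((pathLaw μ).prod ν) +
            (∫ z, (θ z.1 - θ' z.1) ^ 2 ∂((pathLaw μ).prod ν)) / e) / 2 := by
        rw [integral_div, integral_add (hWi.const_mul e) (hsq.1.div_const e), integral_const_mul,
          integral_div]
      refine hadd.trans_le ?_
      have h1 := mul_le_mul_of_nonneg_left hWV he.le
      have h2 : (∫ z : (ℕ → G) × X, (θ z.1 - θ' z.1) ^ 2 ∂((pathLaw μ).prod ν)) / e ≤ A * e := by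
        rw [div_le_iff₀ he, mul_assoc, ← hee]; exact hsq.2
      have h3 : 0 ≤ ∫ z, W z ^ 2 ∂((pathLaw μ).prod ν) := integral_nonneg fun _ => sq_nonneg _
      have h4 : 0 ≤ e * (V + A) := by have := h3.trans hWV; positivity
      linarith
  -- the contribution of the perturbations
  have hDi (k : ℕ) : Integrable (fun z => W z * |disp σ f k z - disp σ f' k z|)
      ((pathLaw μ).prod ν) ∧
      ∫ z, W z * |disp σ f k z - disp σ f' k z| ∂((pathLaw μ).prod ν) ≤ e * (V + A) := by
    have hsq := hf.sq_shift hW k k p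
    have hsq0 := hf.sq_shift hW 0 0 p
    have hi1 := ((hWi.const_mul e).add (hsq.1.div_const e)).div_const 2
    have hi2 := ((hWi.const_mul e).add (hsq0.1.div_const e)).div_const 2
    have hle (z : (ℕ → G) × X) : W z * |disp σ f k z - disp σ f' k z| ≤
        (e * W z ^ 2 + (f k (shift^[k] z) - f' k (shift^[k] z)) ^ 2 / e) / 2 +
        (e * W z ^ 2 + (f 0 (shift^[0] z) - f' 0 (shift^[0] z)) ^ 2 / e) / 2 := by
      refine le_trans ?_ (add_le_add (mul_abs_le_of_pos he _ _) (mul_abs_le_of_pos he _ _))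
      rw [← mul_add]
      refine mul_le_mul_of_nonneg_left ?_ (hW0 z)
      rw [show disp σ f k z - disp σ f' k z = (f k (shift^[k] z) - f' k (shift^[k] z)) -
        (f 0 (shift^[0] z) - f' 0 (shift^[0] z)) by simp only [disp, Function.iterate_zero, id]; ring]
      exact abs_sub _ _
    refine ⟨(hi1.add hi2).mono' ?_ (Eventually.of_forall fun z => ?_), ?_⟩
    · exact (hWm.mul ((measurable_disp hW.measurable hf.measurable k).sub
        (measurable_disp hW.measurable hf'm k)).norm).aestronglyMeasurable
    · rw [Real.norm_eq_abs, abs_of_nonneg (mul_nonneg (hW0 z) (abs_nonneg _))]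
      exact hle z
    · refine (integral_mono_of_nonneg (Eventually.of_forall fun z =>
        mul_nonneg (hW0 z) (abs_nonneg _)) (hi1.add hi2) (Eventually.of_forall hle)).trans ?_
      have hadd (k : ℕ) (hsq : Integrable (fun z => (f k (shift^[k] z) - f' k (shift^[k] z)) ^ 2)
          ((pathLaw μ).prod ν)) :
          ∫ z, (e * W z ^ 2 + (f k (shift^[k] z) - f' k (shift^[k] z)) ^ 2 / e) / 2
            ∂((pathLaw μ).prod ν) = (e * ∫ z, W z ^ 2 ∂((pathLaw μ).prod ν) +
            (∫ z, (f k (shift^[k] z) - f' k (shift^[k] z)) ^ 2 ∂((pathLaw μ).prod ν)) / e) / 2 := by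
        rw [integral_div, integral_add (hWi.const_mul e) (hsq.div_const e), integral_const_mul,
          integral_div]
      have h1 := mul_le_mul_of_nonneg_left hWV he.le
      have h2 (k : ℕ) (hk : ∫ z, (f k (shift^[k] z) - f' k (shift^[k] z)) ^ 2
          ∂((pathLaw μ).prod ν) ≤ A * Real.exp (-(β * p))) :
          (∫ z, (f k (shift^[k] z) - f' k (shift^[k] z)) ^ 2 ∂((pathLaw μ).prod ν)) / e ≤
            A * e := by
        rw [div_le_iff₀ he, mul_assoc, ← hee]; exact hk
      refine (integral_add hi1 hi2).trans_le ?_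
      refine (add_le_add (hadd k hsq.1).le (hadd 0 hsq0.1).le).trans ?_
      linarith [h2 k hsq.2, h2 0 hsq0.2]
  have hbd {g g' : ((ℕ → G) × X) × ℝ → ℝ} (hg : Measurable g) (hg' : Measurable g')
      (hgA : ∀ x, |g x| ≤ A) (hg1 : ∀ x, |g' x| ≤ 1) :
      Integrable (fun x => g x * w x * g' x) (fullLaw μ ν l) := by
    refine ((hW1.comp_fst l).const_mul A).mono' ((hg.mul hw).mul hg').aestronglyMeasurable ?_
    filter_upwards [hl.ae_abs_le (μ := μ) (ν := ν)] with x hx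
    rw [norm_mul, norm_mul, Real.norm_eq_abs, Real.norm_eq_abs, Real.norm_eq_abs]
    calc |g x| * |w x| * |g' x| ≤ A * W x.1 * 1 := by
          gcongr
          · exact mul_nonneg hA (hW0 _)
          · exact hgA x
          · exact hwW x.1 x.2 hx
          · exact hg1 x
      _ = _ := mul_one _
  have hind (f : ℕ → (ℕ → G) × X → ℝ) (x) : |aliveInd σ f m x| ≤ 1 := by
    rw [abs_of_nonneg (aliveInd_nonneg _ _ _ _)]; exact aliveInd_le_one _ _ _ _
  have hI := measurable_aliveInd hW.measurable hf.measurable m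
  have hI' := measurable_aliveInd hW.measurable hf'm m
  have h1 : Integrable (fun x => θ x.1.1 * w x * aliveInd σ f m x) (fullLaw μ ν l) :=
    hbd (hθ.measurable.comp (measurable_fst.comp measurable_fst)) hI
    (fun x => by
      rw [abs_of_nonneg (hθ.nonneg _)]; exact hθ.le _) (hind f)
  have h2 : Integrable (fun x => θ' x.1.1 * w x * aliveInd σ f' m x) (fullLaw μ ν l) :=
    hbd (hθ'm.comp (measurable_fst.comp measurable_fst)) hI'
    (fun x => by
      rw [abs_of_nonneg (hθ.trunc_nonneg p _)]; exact hθ.trunc_le p _) (hind f')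
  have h3 : Integrable (fun x : ((ℕ → G) × X) × ℝ => W x.1 * |aliveInd σ f m x - aliveInd σ f' m x|)
      (fullLaw μ ν l) := by
    refine (hW1.comp_fst l).mono' ((hWm.comp measurable_fst).mul
      (hI.sub hI').norm).aestronglyMeasurable (Eventually.of_forall fun x => ?_)
    rw [norm_mul, Real.norm_eq_abs, Real.norm_eq_abs, abs_abs, abs_of_nonneg (hW0 _)]
    refine mul_le_of_le_one_right (hW0 _) (abs_le.2 ⟨?_, ?_⟩)
    · linarith [aliveInd_nonneg σ f m x, aliveInd_le_one σ f' m x]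
    · linarith [aliveInd_nonneg σ f' m x, aliveInd_le_one σ f m x]
  have h4 : ∫ x, W x.1 * |aliveInd σ f m x - aliveInd σ f' m x| ∂(fullLaw μ ν l) ≤
      c * (m * (e * (V + A))) := by
    rw [integral_prod _ h3]
    have hi5 : Integrable (fun z => c * ∑ k ∈ Finset.Icc 1 m, W z * |disp σ f k z - disp σ f' k z|)
        ((pathLaw μ).prod ν) := (integrable_finsetSum _ fun k _ => (hDi k).1).const_mul c
    refine (integral_mono_of_nonneg (Eventually.of_forall fun z => integral_nonneg fun t =>
      mul_nonneg (hW0 z) (abs_nonneg _)) hi5 (Eventually.of_forall fun z => ?_)).trans ?_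
    · simp only
      rw [integral_const_mul, ← Finset.mul_sum, mul_left_comm]
      exact mul_le_mul_of_nonneg_left (hl.integral_abs_aliveInd_sub_le σ f f' m z) (hW0 z)
    · rw [integral_const_mul, integral_finsetSum _ fun k _ => (hDi k).1]
      refine mul_le_mul_of_nonneg_left ?_ hl.c_nonneg
      refine (Finset.sum_le_sum fun k _ => (hDi k).2).trans (le_of_eq ?_)
      simp
  have h5 : Integrable (fun x : ((ℕ → G) × X) × ℝ => W x.1 * |θ x.1.1 - θ' x.1.1|)
      (fullLaw μ ν l) := hTi.1.comp_fst l
  have h6 : ∫ x, W x.1 * |θ x.1.1 - θ' x.1.1| ∂(fullLaw μ ν l) ≤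
      l.real Set.univ * (e * (V + A)) := by
    have := integral_fun_fst (μ := (pathLaw μ).prod ν) (ν := l)
      (fun z : (ℕ → G) × X => W z * |θ z.1 - θ' z.1|)
    rw [this, smul_eq_mul]
    exact mul_le_mul_of_nonneg_left hTi.2 measureReal_nonneg
  rw [← integral_sub h1 h2]
  refine (abs_integral_le_integral_abs).trans ?_
  refine (integral_mono_of_nonneg (Eventually.of_forall fun _ => abs_nonneg _)
    (h5.add (h3.const_mul A)) ?_).trans ?_
  · filter_upwards [hl.ae_abs_le (μ := μ) (ν := ν)] with x hx
    simp only [Pi.add_apply]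
    rw [show θ x.1.1 * w x * aliveInd σ f m x - θ' x.1.1 * w x * aliveInd σ f' m x =
      w x * (θ x.1.1 - θ' x.1.1) * aliveInd σ f' m x +
        θ x.1.1 * (w x * (aliveInd σ f m x - aliveInd σ f' m x)) by ring]
    refine (abs_add_le _ _).trans (add_le_add ?_ ?_)
    · rw [abs_mul, abs_mul]
      refine (mul_le_of_le_one_right (by positivity) (hind f' x)).trans ?_
      gcongr
      exact hwW x.1 x.2 hx
    · rw [abs_mul, abs_mul, abs_of_nonneg (hθ.nonneg _)]
      gcongr
      · exact hθ.le _
      · exact hwW x.1 x.2 hx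
  · have h7 : ∫ x, (W x.1 * |θ x.1.1 - θ' x.1.1| + A * (W x.1 *
        |aliveInd σ f m x - aliveInd σ f' m x|)) ∂(fullLaw μ ν l) =
        ∫ x, W x.1 * |θ x.1.1 - θ' x.1.1| ∂(fullLaw μ ν l) +
        A * ∫ x, W x.1 * |aliveInd σ f m x - aliveInd σ f' m x| ∂(fullLaw μ ν l) := by
      rw [integral_add h5 (h3.const_mul A), integral_const_mul]
    refine h7.trans_le ?_
    have := mul_le_mul_of_nonneg_left h4 hA
    calc _ ≤ l.real Set.univ * (e * (V + A)) + A * (c * (m * (e * (V + A)))) := add_le_add h6 this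
      _ = _ := by ring

end Transfer

/-! ### The increments of the weighted positions -/

section Pathwise

/-- On a path, the stopped perturbed walk differs from the sum of the increments before the exit
by the size `D` of the perturbations and of one increment. -/
theorem abs_stopped_sub_sum_le {y F ξ i : ℕ → ℝ} {D : ℝ} {M : ℕ} (hM : 1 ≤ M)
    (hy : ∀ k, y (k + 1) = y k + ξ k + F (k + 1) - F k)
    (hi : ∀ k, i k = 0 ∨ i k = 1) (hanti : Antitone i)
    (hpos : ∀ k, 1 ≤ k → i k = 1 → 0 ≤ y k)
    (hneg : ∀ k, i k = 1 → i (k + 1) = 0 → y (k + 1) < 0)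
    {N : ℕ} (hMN : M ≤ N) (hF : ∀ k ≤ N, |F k| ≤ D) (hξ : ∀ k ≤ N, |ξ k| ≤ D) :
    |y N * i N - y M * i M - ∑ k ∈ Finset.Ico M N, i k * ξ k| ≤ 5 * D * i M := by
  have hD : 0 ≤ D := (abs_nonneg _).trans (hF 0 (Nat.zero_le _))
  rcases hi M with h0 | h1
  · have hz : ∀ k, M ≤ k → i k = 0 := fun k hk => by
      rcases hi k with h | h
      · exact h
      · have := hanti hk; rw [h, h0] at this; linarith
    rw [hz N hMN, h0, Finset.sum_eq_zero fun k hk => by rw [hz k (Finset.mem_Ico.1 hk).1, zero_mul]]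
    simp
  · have key : ∀ n, M ≤ n → n ≤ N →
        (i n = 1 ∧ y n - y M - ∑ k ∈ Finset.Ico M n, i k * ξ k = F n - F M) ∨
        (i n = 0 ∧ |-y M - ∑ k ∈ Finset.Ico M n, i k * ξ k| ≤ 5 * D) := by
      intro n hn
      induction n, hn using Nat.le_induction with
      | base => intro _; left; simp [h1]
      | succ n hn ih =>
        intro hnN
        rw [Finset.sum_Ico_succ_top hn]
        rcases ih (by omega) with ⟨ha, hb⟩ | ⟨ha, hb⟩
        · rw [ha, one_mul]
          rcases hi (n + 1) with h | h
          · right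
            refine ⟨h, ?_⟩
            have e1 := hneg n ha h
            have e2 := hpos n (hM.trans hn) ha
            have e3 := hy n
            obtain ⟨f1, f2⟩ := abs_le.1 (hF n (by omega))
            obtain ⟨f3, f4⟩ := abs_le.1 (hF (n + 1) hnN)
            obtain ⟨f5, f6⟩ := abs_le.1 (hF M (by omega))
            obtain ⟨f7, f8⟩ := abs_le.1 (hξ n (by omega))
            rw [abs_le]
            constructor <;> linarith
          · left
            exact ⟨h, by rw [hy n]; linarith⟩
        · right
          refine ⟨?_, by rw [ha]; simpa using hb⟩
          rcases hi (n + 1) with h | h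
          · exact h
          · have := hanti n.le_succ; rw [h, ha] at this; linarith
    rw [h1]
    rcases key N hMN le_rfl with ⟨ha, hb⟩ | ⟨ha, hb⟩
    · rw [ha, mul_one, mul_one, hb]
      have := abs_le.1 (hF N le_rfl)
      have := abs_le.1 (hF M hMN)
      rw [abs_le]; constructor <;> linarith
    · rw [ha]; simpa using hb

theorem sum_Ico_sub_lag_le {i : ℕ → ℝ} (hanti : Antitone i) (h0 : ∀ k, 0 ≤ i k) {M p N : ℕ}
    (hp : p ≤ M) (hMN : M ≤ N) :
    ∑ k ∈ Finset.Ico M N, (i (k - p) - i k) ≤ p * i (M - p) := by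
  induction p with
  | zero => simp
  | succ p ih =>
    have htel : ∀ n, M ≤ n → ∑ k ∈ Finset.Ico M n, (i (k - (p + 1)) - i (k - p)) =
        i (M - (p + 1)) - i (n - (p + 1)) := by
      intro n hn
      induction n, hn using Nat.le_induction with
      | base => simp
      | succ n hn ihn =>
        rw [Finset.sum_Ico_succ_top hn, ihn, show n + 1 - (p + 1) = n - p by omega]
        ring
    have e : ∑ k ∈ Finset.Ico M N, (i (k - (p + 1)) - i k) =
        ∑ k ∈ Finset.Ico M N, (i (k - (p + 1)) - i (k - p)) +
          ∑ k ∈ Finset.Ico M N, (i (k - p) - i k) := by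
      rw [← Finset.sum_add_distrib]; exact Finset.sum_congr rfl fun k _ => by ring
    rw [e, htel N hMN]
    have h1 := ih (by omega)
    have h2 : i (M - p) ≤ i (M - (p + 1)) := hanti (by omega)
    have h3 := h0 (N - (p + 1))
    have h4 : (p : ℝ) * i (M - p) ≤ p * i (M - (p + 1)) := by gcongr
    push_cast
    linarith

end Pathwise

section Position

variable {G X : Type*} [Group G] [MulAction G X] [MeasurableSpace G] [MeasurableMul₂ G]
  [MeasurableSpace X] [MeasurableSMul₂ G X]

/-- The probability of survival, averaged over starting points and levels. -/
noncomputable def survMass (μ : Measure G) (ν : Measure X) (l : Measure ℝ) (σ : G → X → ℝ)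
    (f : ℕ → (ℕ → G) × X → ℝ) (n : ℕ) : ℝ := ∫ w, aliveInd σ f n w ∂(fullLaw μ ν l)

/-- The expectation of the twisted position on survival, averaged over starting points and
levels. -/
noncomputable def meanPos (μ : Measure G) (ν : Measure X) (l : Measure ℝ) (σ : G → X → ℝ)
    (f : ℕ → (ℕ → G) × X → ℝ) (θ : (ℕ → G) → ℝ) (n : ℕ) : ℝ :=
  ∫ w, θ w.1.1 * (w.2 + disp σ f n w.1) * aliveInd σ f n w ∂(fullLaw μ ν l)

variable {μ : Measure G} [IsProbabilityMeasure μ] {ν : Measure X} [IsProbabilityMeasure ν]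
  {σ : G → X → ℝ} {a β A : ℝ} {f : ℕ → (ℕ → G) × X → ℝ} {θ : (ℕ → G) → ℝ}
  {l : Measure ℝ} {K c : ℝ}

theorem aliveInd_eq_zero_or_one (n : ℕ) (w) : aliveInd σ f n w = 0 ∨ aliveInd σ f n w = 1 := by
  by_cases h : w ∈ alive σ f n
  · exact Or.inr (aliveInd_of_mem h)
  · exact Or.inl (aliveInd_of_notMem h)

theorem mem_alive_of_aliveInd_eq_one {n : ℕ} {w} (h : aliveInd σ f n w = 1) : w ∈ alive σ f n := by
  by_contra h'
  rw [aliveInd_of_notMem h'] at h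
  exact zero_ne_one h

theorem disp_succ (hσ : IsCocycle σ) (k : ℕ) (z : (ℕ → G) × X) :
    disp σ f (k + 1) z = disp σ f k z + incr σ z.2 k z.1 + f (k + 1) (shift^[k + 1] z) -
      f k (shift^[k] z) := by
  simp only [disp, walk_succ hσ]; ring

variable [IsFiniteMeasure l]

theorem integrable_aliveInd (hσ : Measurable (fun z : G × X => σ z.1 z.2))
    (hf : ∀ n, Measurable (f n)) (n : ℕ) : Integrable (aliveInd σ f n) (fullLaw μ ν l) :=
  Integrable.of_bound (measurable_aliveInd hσ hf n).aestronglyMeasurable 1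
    (Eventually.of_forall fun w => by
      rw [Real.norm_eq_abs, abs_of_nonneg (aliveInd_nonneg _ _ _ _)]; exact aliveInd_le_one _ _ _ _)

theorem survMass_nonneg (n : ℕ) : 0 ≤ survMass μ ν l σ f n :=
  integral_nonneg fun _ => aliveInd_nonneg _ _ _ _

theorem survMass_le (hσ : Measurable (fun z : G × X => σ z.1 z.2))
    (hf : ∀ n, Measurable (f n)) (n : ℕ) : survMass μ ν l σ f n ≤ l.real Set.univ := by
  refine (integral_mono (integrable_aliveInd hσ hf n) (integrable_const 1)
    fun w => aliveInd_le_one _ _ _ _).trans (le_of_eq ?_)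
  rw [integral_const, smul_eq_mul, mul_one, measureReal_def, ← Set.univ_prod_univ,
    Measure.prod_prod, measure_univ, one_mul, measureReal_def]

theorem abs_le_exp_div {a : ℝ} (ha : 0 < a) (u : ℝ) : |u| ≤ Real.exp (a * |u|) / a := by
  rw [le_div_iff₀ ha]; linarith [Real.add_one_le_exp (a * |u|)]

theorem sq_le_exp_div {a : ℝ} (ha : 0 < a) (u : ℝ) : u ^ 2 ≤ 2 / a ^ 2 * Real.exp (a * |u|) := by
  have h3 := Real.pow_div_factorial_le_exp (a * |u|) (by positivity) 2
  rw [mul_pow, sq_abs] at h3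
  simp only [Nat.factorial, Nat.cast_ofNat, Nat.succ_eq_add_one, Nat.reduceAdd,
    mul_one] at h3
  rw [div_mul_eq_mul_div, le_div_iff₀ (by positivity)]
  linarith

theorem WalkHyp.walk_pow_four (hW : WalkHyp μ ν σ a A) (q : ℕ) :
    Integrable (fun z : (ℕ → G) × X => walk σ z.2 q z.1 ^ 4) ((pathLaw μ).prod ν) ∧
      ∫ z : (ℕ → G) × X, walk σ z.2 q z.1 ^ 4 ∂((pathLaw μ).prod ν) ≤
        768 / a ^ 4 * Real.exp (2 * A) * q ^ 2 :=
  integrable_prod_and_integral_le ((measurable_walk hW.measurable q).pow_const 4)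
    (fun _ => by positivity) (by positivity) fun x => hW.lintegral_walk_pow_four_le x q

theorem WalkHyp.integrable_walk (hW : WalkHyp μ ν σ a A) (q : ℕ) :
    Integrable (fun z : (ℕ → G) × X => walk σ z.2 q z.1) ((pathLaw μ).prod ν) := by
  refine ((integrable_const 1).add (hW.walk_pow_four q).1).mono'
    (measurable_walk hW.measurable q).aestronglyMeasurable (Eventually.of_forall fun z => ?_)
  simp only [Pi.add_apply]
  set u := walk σ z.2 q z.1
  rw [Real.norm_eq_abs, show u ^ 4 = (|u| ^ 2) ^ 2 by rw [sq_abs]; ring]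
  nlinarith [sq_nonneg (|u| ^ 2 - 1), sq_nonneg (|u| - 1)]

theorem PertHyp.integrable_shift (hf : PertHyp μ ν a β A f) (hW : WalkHyp μ ν σ a A) (k : ℕ) :
    Integrable (fun z => f k (shift^[k] z)) ((pathLaw μ).prod ν) := by
  refine ((hf.exp_shift hW k k).1.div_const a).mono'
    ((hf.measurable k).comp (measurable_shift_iterate k)).aestronglyMeasurable
    (Eventually.of_forall fun z => ?_)
  exact abs_le_exp_div hW.a_pos _

theorem PertHyp.integrable_disp (hf : PertHyp μ ν a β A f) (hW : WalkHyp μ ν σ a A) (k : ℕ) :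
    Integrable (disp σ f k) ((pathLaw μ).prod ν) :=
  ((hW.integrable_walk k).add (hf.integrable_shift hW k)).sub (hf.integrable_shift hW 0)

theorem TestMeasure.integrable_snd (hl : TestMeasure l K c) :
    Integrable (fun w : ((ℕ → G) × X) × ℝ => w.2) (fullLaw μ ν l) :=
  Integrable.of_bound measurable_snd.aestronglyMeasurable K hl.ae_abs_le

theorem integrable_mul_mul (hW : WalkHyp μ ν σ a A) (hf : PertHyp μ ν a β A f)
    (hθm : Measurable θ) (hθA : ∀ ω, |θ ω| ≤ A) {g : ((ℕ → G) × X) × ℝ → ℝ}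
    (hg : Integrable g (fullLaw μ ν l)) (n : ℕ) :
    Integrable (fun w => θ w.1.1 * g w * aliveInd σ f n w) (fullLaw μ ν l) := by
  refine (hg.norm.const_mul A).mono' ?_ (Eventually.of_forall fun w => ?_)
  · exact (((hθm.comp (measurable_fst.comp measurable_fst)).aestronglyMeasurable.mul
      hg.aestronglyMeasurable)).mul
        (measurable_aliveInd hW.measurable hf.measurable n).aestronglyMeasurable
  · rw [norm_mul, norm_mul]
    have hA := zero_le_one.trans hW.one_le_A
    calc ‖θ w.1.1‖ * ‖g w‖ * ‖aliveInd σ f n w‖ ≤ A * ‖g w‖ * 1 := by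
          gcongr
          · exact hθA _
          · rw [Real.norm_eq_abs, abs_of_nonneg (aliveInd_nonneg _ _ _ _)]
            exact aliveInd_le_one _ _ _ _
      _ = _ := mul_one _

theorem TwistHyp.abs_le (hθ : TwistHyp μ β A θ) (ω) : |θ ω| ≤ A := by
  rw [abs_of_nonneg (hθ.nonneg ω)]; exact hθ.le ω

theorem integrable_position (hW : WalkHyp μ ν σ a A) (hf : PertHyp μ ν a β A f)
    (hl : TestMeasure l K c) (n : ℕ) :
    Integrable (fun w : ((ℕ → G) × X) × ℝ => w.2 + disp σ f n w.1) (fullLaw μ ν l) :=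
  hl.integrable_snd.add ((hf.integrable_disp hW n).comp_fst l)

/-- The increment of the mean position between the times `M` and `N`: up to errors of the size of
the survival probability before `M`, it is a sum of expectations of increments of the walk against
functions of the past, which vanish by the centering. -/
theorem abs_meanPos_sub_le (hW : WalkHyp μ ν σ a A) (hf : PertHyp μ ν a β A f)
    (hθ : TwistHyp μ β A θ) (hl : TestMeasure l K c) {M N p : ℕ} (hM : 1 ≤ M) (hMN : M ≤ N)
    (hp : p ≤ M) {L : ℝ} (hL : 0 ≤ L) :
    |meanPos μ ν l σ f θ N - meanPos μ ν l σ f θ M| ≤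
      A * (5 + p) * (L * survMass μ ν l σ f (M - p) +
        l.real Set.univ * (2 * (N + 1) * (A * Real.exp (-(a * L)))) / a) +
      (N - M : ℕ) * (Real.exp (-(β * p / 2)) * (2 / a ^ 2 * A + A) *
        (l.real Set.univ + A * c * N)) := by
  have hA := zero_le_one.trans hW.one_le_A
  have ha := hW.a_pos
  let D : (ℕ → G) × X → ℝ := fun z => L + excess σ f a L N z / a
  have hexc := hf.integrable_excess hW L N
  have hD0 (z) : 0 ≤ D z := add_nonneg hL (div_nonneg (excess_nonneg _ _ _) ha.le)
  let ξ (k : ℕ) : ((ℕ → G) × X) × ℝ → ℝ := fun w => incr σ w.1.2 k w.1.1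
  have hξi (k : ℕ) : Integrable (ξ k) (fullLaw μ ν l) := by
    refine Integrable.comp_fst (f := fun z : (ℕ → G) × X => incr σ z.2 k z.1) ?_ l
    refine ((hW.exp_incr k).1.div_const a).mono' (measurable_incr hW.measurable k).aestronglyMeasurable
      (Eventually.of_forall fun z => abs_le_exp_div ha _)
  let y (k : ℕ) : ((ℕ → G) × X) × ℝ → ℝ := fun w => w.2 + disp σ f k w.1
  have hyi (k : ℕ) : Integrable (y k) (fullLaw μ ν l) := integrable_position hW hf hl k
  have hI (k : ℕ) {g : ((ℕ → G) × X) × ℝ → ℝ} (hg : Integrable g (fullLaw μ ν l)) :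
      Integrable (fun w => θ w.1.1 * g w * aliveInd σ f k w) (fullLaw μ ν l) :=
    integrable_mul_mul hW hf hθ.measurable hθ.abs_le hg k
  -- the pathwise bound
  have hpath (w : ((ℕ → G) × X) × ℝ) :
      |θ w.1.1 * y N w * aliveInd σ f N w - θ w.1.1 * y M w * aliveInd σ f M w -
        ∑ k ∈ Finset.Ico M N, θ w.1.1 * ξ k w * aliveInd σ f (k - p) w| ≤
      A * (5 + p) * (D w.1 * aliveInd σ f (M - p) w) := by
    have h1 := abs_stopped_sub_sum_le (y := fun k => y k w) (F := fun k => f k (shift^[k] w.1))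
      (ξ := fun k => ξ k w) (i := fun k => aliveInd σ f k w) (D := D w.1) hM
      (fun k => by simp only [y, ξ, disp_succ hW.cocycle]; ring)
      (fun k => aliveInd_eq_zero_or_one k w) (aliveInd_antitone σ f w)
      (fun k hk h => mem_alive_of_aliveInd_eq_one h k hk le_rfl)
      (fun k h h' => by
        by_contra! hcon
        have : w ∈ alive σ f (k + 1) := by
          intro j hj1 hj2
          rcases Nat.lt_or_eq_of_le hj2 with h3 | rfl
          · exact mem_alive_of_aliveInd_eq_one h j hj1 (Nat.lt_succ_iff.1 h3)
          · exact hcon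
        rw [aliveInd_of_mem this] at h'
        exact one_ne_zero h')
      hMN (fun k hk => abs_pert_le ha L hk _) (fun k hk => abs_incr_le ha L hk _)
    have h2 : |∑ k ∈ Finset.Ico M N, (aliveInd σ f (k - p) w - aliveInd σ f k w) * ξ k w| ≤
        D w.1 * (p * aliveInd σ f (M - p) w) := by
      refine (Finset.abs_sum_le_sum_abs _ _).trans ?_
      refine le_trans ?_ (mul_le_mul_of_nonneg_left (sum_Ico_sub_lag_le (aliveInd_antitone σ f w)
        (fun k => aliveInd_nonneg σ f k w) hp hMN) (hD0 w.1))
      rw [Finset.mul_sum]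
      refine Finset.sum_le_sum fun k hk => ?_
      have h3 : 0 ≤ aliveInd σ f (k - p) w - aliveInd σ f k w :=
        sub_nonneg.2 (aliveInd_antitone σ f w (Nat.sub_le _ _))
      rw [abs_mul, abs_of_nonneg h3, mul_comm]
      gcongr
      exact abs_incr_le ha L (Finset.mem_Ico.1 hk).2.le _
    have e : θ w.1.1 * y N w * aliveInd σ f N w - θ w.1.1 * y M w * aliveInd σ f M w -
        ∑ k ∈ Finset.Ico M N, θ w.1.1 * ξ k w * aliveInd σ f (k - p) w =
        θ w.1.1 * ((y N w * aliveInd σ f N w - y M w * aliveInd σ f M w -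
          ∑ k ∈ Finset.Ico M N, aliveInd σ f k w * ξ k w) -
          ∑ k ∈ Finset.Ico M N, (aliveInd σ f (k - p) w - aliveInd σ f k w) * ξ k w) := by
      have : ∑ k ∈ Finset.Ico M N, θ w.1.1 * ξ k w * aliveInd σ f (k - p) w = θ w.1.1 *
          (∑ k ∈ Finset.Ico M N, aliveInd σ f k w * ξ k w +
          ∑ k ∈ Finset.Ico M N, (aliveInd σ f (k - p) w - aliveInd σ f k w) * ξ k w) := by
        rw [← Finset.sum_add_distrib, Finset.mul_sum]
        exact Finset.sum_congr rfl fun k _ => by ring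
      rw [this]; ring
    rw [e, abs_mul, abs_of_nonneg (hθ.nonneg _)]
    have h4 : aliveInd σ f M w ≤ aliveInd σ f (M - p) w := aliveInd_antitone σ f w (Nat.sub_le _ _)
    have h5 : 5 * D w.1 * aliveInd σ f M w ≤ 5 * D w.1 * aliveInd σ f (M - p) w :=
      mul_le_mul_of_nonneg_left h4 (mul_nonneg (by norm_num) (hD0 _))
    calc _ ≤ A * (5 * D w.1 * aliveInd σ f (M - p) w + D w.1 * (p * aliveInd σ f (M - p) w)) := by
          refine mul_le_mul (hθ.le _) ?_ (abs_nonneg _) hA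
          exact (abs_sub _ _).trans (add_le_add (h1.trans h5) h2)
      _ = _ := by ring
  -- the expectations of the increments against the past
  have hzero (k : ℕ) (hk : k ∈ Finset.Ico M N) :
      |∫ w, θ w.1.1 * ξ k w * aliveInd σ f (k - p) w ∂(fullLaw μ ν l)| ≤
      Real.exp (-(β * p / 2)) * (2 / a ^ 2 * A + A) * (l.real Set.univ + A * c * N) := by
    obtain ⟨hk1, hk2⟩ := Finset.mem_Ico.1 hk
    have hsqm : Measurable fun z : (ℕ → G) × X => |incr σ z.2 k z.1| :=
      (measurable_incr hW.measurable k).norm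
    have hsqi : Integrable (fun z : (ℕ → G) × X => |incr σ z.2 k z.1| ^ 2) ((pathLaw μ).prod ν) := by
      refine ((hW.exp_incr k).1.const_mul (2 / a ^ 2)).mono' (hsqm.pow_const 2).aestronglyMeasurable
        (Eventually.of_forall fun z => ?_)
      rw [Real.norm_eq_abs, abs_of_nonneg (sq_nonneg _), sq_abs]
      exact sq_le_exp_div ha _
    have h1 := abs_integral_sub_integral_truncSeq_le hW hf hθ hl (w := ξ k)
      ((measurable_incr hW.measurable k).comp measurable_fst)
      (W := fun z => |incr σ z.2 k z.1|) hsqm (fun _ => abs_nonneg _) (fun z t _ => le_rfl)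
      (V := 2 / a ^ 2 * A) hsqi (by
        refine (integral_mono hsqi ((hW.exp_incr k).1.const_mul (2 / a ^ 2)) fun z => ?_).trans ?_
        · simp only [sq_abs]; exact sq_le_exp_div ha _
        · rw [integral_const_mul]
          exact mul_le_mul_of_nonneg_left (hW.exp_incr k).2 (by positivity)) p (k - p)
    have hf'm : ∀ n, Measurable (truncSeq μ p f n) := measurable_truncSeq hf.measurable p
    have hθ'm : Measurable (trunc μ p θ) := measurable_trunc' μ p hθ.measurable
    have h2 : ∫ w, trunc μ p θ w.1.1 * ξ k w * aliveInd σ (truncSeq μ p f) (k - p) w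
        ∂(fullLaw μ ν l) = 0 := by
      have hdep : DependsOnFirst k (fun w : ((ℕ → G) × X) × ℝ =>
          trunc μ p θ w.1.1 * aliveInd σ (truncSeq μ p f) (k - p) w) := by
        intro ω₁ ω₂ x t h
        have h3 := dependsOnFirst_aliveInd (μ := μ) (σ := σ) (f := f) p (k - p) ω₁ ω₂ x t
          fun i hi => h i (by omega)
        simp only [h3, trunc_congr μ (p := p) θ fun i hi => h i (by omega)]
      have h4 : Integrable (fun w => trunc μ p θ w.1.1 *
          aliveInd σ (truncSeq μ p f) (k - p) w * incr σ w.1.2 k w.1.1) (fullLaw μ ν l) := by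
        refine ((hξi k).norm.const_mul A).mono' ?_ (Eventually.of_forall fun w => ?_)
        · exact (((hθ'm.comp (measurable_fst.comp measurable_fst)).mul
            (measurable_aliveInd hW.measurable hf'm _)).mul
            ((measurable_incr hW.measurable k).comp measurable_fst)).aestronglyMeasurable
        · rw [norm_mul, norm_mul, Real.norm_eq_abs, Real.norm_eq_abs,
            abs_of_nonneg (hθ.trunc_nonneg _ _), abs_of_nonneg (aliveInd_nonneg _ _ _ _)]
          calc _ ≤ A * 1 * ‖ξ k w‖ := by
                gcongr
                · exact aliveInd_nonneg _ _ _ _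
                · exact hθ.trunc_le _ _
                · exact aliveInd_le_one _ _ _ _
            _ = _ := by ring
      have := hW.integral_mul_incr_eq_zero (l := l) hdep h4
      rw [← this]
      exact integral_congr_ae (Eventually.of_forall fun w => by simp only [ξ]; ring)
    rw [h2, sub_zero] at h1
    refine h1.trans ?_
    have hkN : ((k - p : ℕ) : ℝ) ≤ N := by exact_mod_cast (Nat.sub_le _ _).trans hk2.le
    have := hl.c_nonneg
    gcongr
  have hsumi : Integrable (fun w => ∑ k ∈ Finset.Ico M N, θ w.1.1 * ξ k w * aliveInd σ f (k - p) w)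
      (fullLaw μ ν l) := integrable_finsetSum _ fun k _ => hI (k - p) (hξi k)
  have hsplit : meanPos μ ν l σ f θ N - meanPos μ ν l σ f θ M =
      ∫ w, (θ w.1.1 * y N w * aliveInd σ f N w - θ w.1.1 * y M w * aliveInd σ f M w -
        ∑ k ∈ Finset.Ico M N, θ w.1.1 * ξ k w * aliveInd σ f (k - p) w) ∂(fullLaw μ ν l) +
      ∑ k ∈ Finset.Ico M N, ∫ w, θ w.1.1 * ξ k w * aliveInd σ f (k - p) w ∂(fullLaw μ ν l) := by
    have hNM : Integrable (fun w => θ w.1.1 * y N w * aliveInd σ f N w -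
        θ w.1.1 * y M w * aliveInd σ f M w) (fullLaw μ ν l) := (hI N (hyi N)).sub (hI M (hyi M))
    rw [integral_sub hNM hsumi,
      integral_sub (hI N (hyi N)) (hI M (hyi M)), integral_finsetSum _ fun k _ => hI (k - p) (hξi k),
      sub_add_cancel]
    rfl
  rw [hsplit]
  refine (abs_add_le _ _).trans (add_le_add ?_ ?_)
  · refine abs_integral_le_integral_abs.trans ?_
    have hexcf : Integrable (fun w : ((ℕ → G) × X) × ℝ => excess σ f a L N w.1) (fullLaw μ ν l) :=
      hexc.1.comp_fst l
    have hint : Integrable (fun w : ((ℕ → G) × X) × ℝ => L * aliveInd σ f (M - p) w +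
        excess σ f a L N w.1 / a) (fullLaw μ ν l) :=
      ((integrable_aliveInd hW.measurable hf.measurable _).const_mul L).add (hexcf.div_const a)
    refine (integral_mono_of_nonneg (Eventually.of_forall fun _ => abs_nonneg _)
      (hint.const_mul (A * (5 + p))) (Eventually.of_forall fun w => ?_)).trans ?_
    · refine (hpath w).trans ?_
      simp only [D]
      have h1 := aliveInd_le_one σ f (M - p) w
      have h2 : 0 ≤ excess σ f a L N w.1 / a := div_nonneg (excess_nonneg _ _ _) ha.le
      rw [add_mul]
      gcongr
      exact mul_le_of_le_one_right h2 h1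
    · rw [integral_const_mul, integral_add
        ((integrable_aliveInd hW.measurable hf.measurable _).const_mul L) (hexcf.div_const a),
        integral_const_mul, integral_div]
      have e := integral_fun_fst (μ := (pathLaw μ).prod ν) (ν := l) (excess σ f a L N)
      rw [e, smul_eq_mul]
      refine mul_le_mul_of_nonneg_left (add_le_add le_rfl ?_) (by positivity)
      gcongr
      exact hexc.2
  · refine (Finset.abs_sum_le_sum_abs _ _).trans ((Finset.sum_le_sum hzero).trans ?_)
    simp

end Position

/-! ### Comparison of the survival of the perturbed walk with its mean position -/

section Comparison

variable {G X : Type*} [Group G] [MulAction G X] [MeasurableSpace G] [MeasurableMul₂ G]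
  [MeasurableSpace X] [MeasurableSMul₂ G X]

/-- The indicator that the walk is above `c` at time `n`. -/
noncomputable def tailInd (σ : G → X → ℝ) (n : ℕ) (c : ℝ) : ((ℕ → G) × X) × ℝ → ℝ :=
  {w | c < w.2 + walk σ w.1.2 n w.1.1}.indicator 1

/-- The twisted probability of survival up to time `n` with a final position above `c`, averaged
over starting points and levels. -/
noncomputable def tailMass (μ : Measure G) (ν : Measure X) (l : Measure ℝ) (σ : G → X → ℝ)
    (f : ℕ → (ℕ → G) × X → ℝ) (θ : (ℕ → G) → ℝ) (n : ℕ) (c : ℝ) : ℝ :=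
  ∫ w, θ w.1.1 * tailInd σ n c w * aliveInd σ f n w ∂(fullLaw μ ν l)

variable {μ : Measure G} [IsProbabilityMeasure μ] {ν : Measure X} [IsProbabilityMeasure ν]
  {σ : G → X → ℝ} {a β A : ℝ} {f : ℕ → (ℕ → G) × X → ℝ} {θ : (ℕ → G) → ℝ}
  {l : Measure ℝ} {K c : ℝ}

theorem abs_walk_sub_le (hσ : IsCocycle σ) {x : X} {ω : ℕ → G} {D : ℝ} (m p : ℕ)
    (h : ∀ k < m + p, |incr σ x k ω| ≤ D) :
    |walk σ x (m + p) ω - walk σ x m ω| ≤ p * D := by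
  induction p with
  | zero => simp
  | succ p ih =>
    have h1 := ih fun k hk => h k (by omega)
    have h2 := h (m + p) (by omega)
    rw [← add_assoc, walk_succ hσ]
    push_cast
    calc _ = |(walk σ x (m + p) ω - walk σ x m ω) + incr σ x (m + p) ω| := by ring_nf
      _ ≤ _ := abs_add_le _ _
      _ ≤ _ := by linarith

theorem measurableSet_tail (hσ : Measurable (fun z : G × X => σ z.1 z.2)) (n : ℕ) (c : ℝ) :
    MeasurableSet {w : ((ℕ → G) × X) × ℝ | c < w.2 + walk σ w.1.2 n w.1.1} :=
  measurableSet_lt measurable_const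
    (measurable_snd.add ((measurable_walk hσ n).comp measurable_fst))

theorem measurable_tailInd (hσ : Measurable (fun z : G × X => σ z.1 z.2)) (n : ℕ) (c : ℝ) :
    Measurable (tailInd σ n c) := measurable_one.indicator (measurableSet_tail hσ n c)

theorem tailInd_nonneg (σ : G → X → ℝ) (n : ℕ) (c : ℝ) (w) : 0 ≤ tailInd σ n c w :=
  Set.indicator_nonneg (fun _ _ => zero_le_one) _

theorem tailInd_le_one (σ : G → X → ℝ) (n : ℕ) (c : ℝ) (w) : tailInd σ n c w ≤ 1 :=
  Set.indicator_le_self' (fun _ _ => zero_le_one) w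

theorem abs_disp_sub_walk_le (ha : 0 < a) {L : ℝ} {n k : ℕ} {z : (ℕ → G) × X}
    (hz : excess σ f a L n z < 1) (hk : k ≤ n) : |disp σ f k z - walk σ z.2 k z.1| ≤ 2 * L := by
  have h1 := abs_pert_le_of_excess_lt_one ha hz hk
  have h2 := abs_pert_le_of_excess_lt_one ha hz (Nat.zero_le n)
  simp only [Function.iterate_zero, id_eq] at h2
  have : disp σ f k z - walk σ z.2 k z.1 = f k (shift^[k] z) - f 0 z := by simp only [disp]; ring
  rw [this]
  exact (abs_sub _ _).trans (by linarith)

theorem aliveInd_mul_tailInd_le (ha : 0 < a) {L s : ℝ} (hs : 2 * L ≤ s) {m q N : ℕ} (hq : 1 ≤ q)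
    (hmq : m ≤ q) (c : ℝ) (w : ((ℕ → G) × X) × ℝ) :
    tailInd σ (q + N) c w * aliveInd σ f (q + N) w ≤
      (survEvent σ q N s c).indicator 1 w * aliveInd σ f m w + excess σ f a L (q + N) w.1 := by
  have he := excess_nonneg (σ := σ) (f := f) (a := a) L (q + N) w.1
  have hp : 0 ≤ (survEvent σ q N s c).indicator 1 w * aliveInd σ f m w :=
    mul_nonneg (Set.indicator_nonneg (fun _ _ => zero_le_one) _) (aliveInd_nonneg _ _ _ _)
  have h1 := tailInd_le_one σ (q + N) c w
  have h2 := aliveInd_le_one σ f (q + N) w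
  have h3 := aliveInd_nonneg σ f (q + N) w
  rcases le_or_gt 1 (excess σ f a L (q + N) w.1) with h | h
  · have := mul_le_one₀ h1 h3 h2
    linarith
  · by_cases hA : w ∈ alive σ f (q + N)
    · by_cases hT : w ∈ {w : ((ℕ → G) × X) × ℝ | c < w.2 + walk σ w.1.2 (q + N) w.1.1}
      · have hS : w ∈ survEvent σ q N s c := by
          refine ⟨fun j hj => ?_, hT⟩
          have e1 := (abs_le.1 (abs_disp_sub_walk_le ha h (k := q + j) (by omega))).2
          have e2 := hA (q + j) (by omega) (by omega)
          linarith
        rw [Set.indicator_of_mem hS, aliveInd_of_mem (alive_antitone σ f (show m ≤ q + N by omega) hA)]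
        have := mul_le_one₀ h1 h3 h2
        simp only [Pi.one_apply, mul_one]
        linarith
      · rw [tailInd, Set.indicator_of_notMem hT, zero_mul]
        linarith
    · rw [aliveInd_of_notMem hA, mul_zero]
      linarith

theorem le_aliveInd_mul_tailInd (hσ : IsCocycle σ) (ha : 0 < a) {L s : ℝ} {m p N : ℕ}
    (hL : 0 ≤ L) (hs : (2 + p) * L ≤ s) (c : ℝ) (w : ((ℕ → G) × X) × ℝ) :
    (survEvent σ (m + p) N (-s) c).indicator 1 w * aliveInd σ f m w ≤
      tailInd σ (m + p + N) c w * aliveInd σ f (m + p + N) w +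
        excess σ f a L (m + p + N) w.1 := by
  have he := excess_nonneg (σ := σ) (f := f) (a := a) L (m + p + N) w.1
  have hp : 0 ≤ tailInd σ (m + p + N) c w * aliveInd σ f (m + p + N) w :=
    mul_nonneg (tailInd_nonneg _ _ _ _) (aliveInd_nonneg _ _ _ _)
  have h1 : (survEvent σ (m + p) N (-s) c).indicator (1 : ((ℕ → G) × X) × ℝ → ℝ) w ≤ 1 :=
    Set.indicator_le_self' (fun _ _ => zero_le_one) w
  have h2 := aliveInd_le_one σ f m w
  have h3 := aliveInd_nonneg σ f m w
  rcases le_or_gt 1 (excess σ f a L (m + p + N) w.1) with h | h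
  · have := mul_le_one₀ h1 h3 h2
    linarith
  · by_cases hA : w ∈ alive σ f m
    · by_cases hS : w ∈ survEvent σ (m + p) N (-s) c
      · have hA' : w ∈ alive σ f (m + p + N) := by
          intro k hk1 hk2
          rcases le_or_gt k m with hkm | hkm
          · exact hA k hk1 hkm
          have e1 := (abs_le.1 (abs_disp_sub_walk_le ha h hk2)).1
          rcases le_or_gt k (m + p) with hkq | hkq
          · obtain ⟨j, rfl⟩ := Nat.exists_eq_add_of_le hkm.le
            obtain ⟨i, rfl⟩ := Nat.exists_eq_add_of_le (show j ≤ p by omega)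
            have e2 := abs_walk_sub_le hσ (x := w.1.2) (ω := w.1.1) (D := L) (m + j) i
              fun k hk => abs_incr_le_of_excess_lt_one ha h (by omega)
            have e3 := (abs_le.1 e2).2
            have e4 := hS.1 0 (Nat.zero_le _)
            rw [add_zero, ← add_assoc] at e4
            have e5 : ((i : ℕ) : ℝ) * L ≤ ((j + i : ℕ) : ℝ) * L := by gcongr; omega
            linarith
          · obtain ⟨j, rfl⟩ := Nat.exists_eq_add_of_le hkq.le
            have e4 := hS.1 j (by omega)
            have : 0 ≤ p * L := by positivity
            linarith
        have hT : w ∈ {w : ((ℕ → G) × X) × ℝ | c < w.2 + walk σ w.1.2 (m + p + N) w.1.1} := hS.2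
        rw [aliveInd_of_mem hA', tailInd, Set.indicator_of_mem hT]
        have := mul_le_one₀ h1 h3 h2
        simp only [Pi.one_apply, mul_one]
        linarith
      · rw [Set.indicator_of_notMem hS, zero_mul]
        linarith
    · rw [aliveInd_of_notMem hA, mul_zero]
      linarith

variable [IsFiniteMeasure l]

/-- The error made by replacing the perturbations and the twist by their averages over all
increments but the first `p`, up to time `m`, in front of a variable with second moment `V`. -/
noncomputable def rangeError (β A Λ c : ℝ) (p m : ℕ) (V : ℝ) : ℝ :=
  Real.exp (-(β * p / 2)) * (V + A) * (Λ + A * c * m)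

theorem integral_fullLaw_fst (h : (ℕ → G) × X → ℝ) :
    ∫ w, h w.1 ∂(fullLaw μ ν l) = l.real Set.univ * ∫ z, h z ∂((pathLaw μ).prod ν) := by
  rw [integral_fun_fst, smul_eq_mul]

theorem WalkHyp.integral_sq_le (hW : WalkHyp μ ν σ a A) (q : ℕ) (K : ℝ) :
    Integrable (fun z : (ℕ → G) × X => (K + |walk σ z.2 q z.1|) ^ 2) ((pathLaw μ).prod ν) ∧
      ∫ z : (ℕ → G) × X, (K + |walk σ z.2 q z.1|) ^ 2 ∂((pathLaw μ).prod ν) ≤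
        2 * K ^ 2 + 1 + 768 / a ^ 4 * Real.exp (2 * A) * q ^ 2 := by
  obtain ⟨h1, h2⟩ := hW.walk_pow_four q
  have hle (z : (ℕ → G) × X) : (K + |walk σ z.2 q z.1|) ^ 2 ≤
      2 * K ^ 2 + 1 + walk σ z.2 q z.1 ^ 4 := by
    set u := walk σ z.2 q z.1
    have : u ^ 4 = (|u| ^ 2) ^ 2 := by rw [sq_abs]; ring
    nlinarith [sq_nonneg (|u| ^ 2 - 1), sq_nonneg (K - |u|)]
  have hi : Integrable (fun z : (ℕ → G) × X => 2 * K ^ 2 + 1 + walk σ z.2 q z.1 ^ 4)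
      ((pathLaw μ).prod ν) := (integrable_const _).add h1
  have hi2 : Integrable (fun z : (ℕ → G) × X => (K + |walk σ z.2 q z.1|) ^ 2)
      ((pathLaw μ).prod ν) := by
    refine hi.mono' (((measurable_walk hW.measurable q).norm.const_add K).pow_const 2
      ).aestronglyMeasurable (Eventually.of_forall fun z => ?_)
    rw [Real.norm_eq_abs, abs_of_nonneg (sq_nonneg _)]
    exact hle z
  refine ⟨hi2, (integral_mono hi2 hi hle).trans ?_⟩
  rw [integral_add (integrable_const _) h1]
  simpa using h2

theorem integral_position_pow_four_le (hW : WalkHyp μ ν σ a A) (hl : TestMeasure l K c) (q : ℕ) :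
    Integrable (fun w : ((ℕ → G) × X) × ℝ => (w.2 + walk σ w.1.2 q w.1.1) ^ 4) (fullLaw μ ν l) ∧
      ∫ w : ((ℕ → G) × X) × ℝ, (w.2 + walk σ w.1.2 q w.1.1) ^ 4 ∂(fullLaw μ ν l) ≤
        l.real Set.univ * (8 * (K ^ 4 + 768 / a ^ 4 * Real.exp (2 * A) * q ^ 2)) := by
  obtain ⟨h1, h2⟩ := hW.walk_pow_four q
  have hle : ∀ᵐ w ∂(fullLaw μ ν l), (w.2 + walk σ w.1.2 q w.1.1) ^ 4 ≤
      8 * (K ^ 4 + walk σ w.1.2 q w.1.1 ^ 4) := by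
    filter_upwards [hl.ae_abs_le] with w hw
    set u := walk σ w.1.2 q w.1.1
    have h3 : w.2 ^ 4 ≤ K ^ 4 := by
      rw [← (show Even 4 by decide).pow_abs w.2]
      exact pow_le_pow_left₀ (abs_nonneg _) hw 4
    have h4 : (w.2 + u) ^ 4 ≤ 8 * (w.2 ^ 4 + u ^ 4) := by
      nlinarith [sq_nonneg (w.2 - u), sq_nonneg (w.2 + u), sq_nonneg (w.2 ^ 2 - u ^ 2),
        mul_nonneg (sq_nonneg (w.2 - u)) (sq_nonneg (w.2 + u)),
        mul_nonneg (sq_nonneg (w.2 - u)) (sq_nonneg (w.2 - u))]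
    linarith
  have hi : Integrable (fun w : ((ℕ → G) × X) × ℝ => 8 * (K ^ 4 + walk σ w.1.2 q w.1.1 ^ 4))
      (fullLaw μ ν l) := (((integrable_const _).add h1).const_mul 8).comp_fst l
  have hi2 : Integrable (fun w : ((ℕ → G) × X) × ℝ => (w.2 + walk σ w.1.2 q w.1.1) ^ 4)
      (fullLaw μ ν l) := by
    refine hi.mono' ((measurable_snd.add ((measurable_walk hW.measurable q).comp measurable_fst)
      ).pow_const 4).aestronglyMeasurable ?_
    filter_upwards [hle] with w hw
    rw [Real.norm_eq_abs, abs_of_nonneg (by positivity)]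
    exact hw
  refine ⟨hi2, (integral_mono_ae hi2 hi hle).trans ?_⟩
  rw [integral_fullLaw_fst (fun z => 8 * (K ^ 4 + walk σ z.2 q z.1 ^ 4)), integral_const_mul,
    integral_add (integrable_const _) h1]
  have : 0 ≤ l.real Set.univ := measureReal_nonneg
  gcongr
  simp

/-- The positions at the times `m` and `m + p`. -/
theorem abs_integral_posPart_sub_meanPos_le (hW : WalkHyp μ ν σ a A) (hf : PertHyp μ ν a β A f)
    (hθ : TwistHyp μ β A θ) (hl : TestMeasure l K c) {m p : ℕ} (hm : 1 ≤ m) (L : ℝ) :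
    |∫ w, θ w.1.1 * max (w.2 + walk σ w.1.2 (m + p) w.1.1) 0 * aliveInd σ f m w ∂(fullLaw μ ν l) -
      meanPos μ ν l σ f θ m| ≤ A * (p + 2) * (L * survMass μ ν l σ f m +
        l.real Set.univ * (2 * ((m + p : ℕ) + 1) * (A * Real.exp (-(a * L)))) / a) := by
  have hA := zero_le_one.trans hW.one_le_A
  have ha := hW.a_pos
  have hexc := hf.integrable_excess hW L (m + p)
  have hmaxi : Integrable (fun w : ((ℕ → G) × X) × ℝ =>
      max (w.2 + walk σ w.1.2 (m + p) w.1.1) 0) (fullLaw μ ν l) :=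
    (hl.integrable_snd.add ((hW.integrable_walk (m + p)).comp_fst l)).pos_part
  have hI {g : ((ℕ → G) × X) × ℝ → ℝ} (hg : Integrable g (fullLaw μ ν l)) :=
    integrable_mul_mul hW hf hθ.measurable hθ.abs_le hg m
  rw [meanPos, ← integral_sub (hI hmaxi) (hI (integrable_position hW hf hl m))]
  refine abs_integral_le_integral_abs.trans ?_
  have hexcf : Integrable (fun w : ((ℕ → G) × X) × ℝ => excess σ f a L (m + p) w.1)
    (fullLaw μ ν l) := hexc.1.comp_fst l
  have hint : Integrable (fun w : ((ℕ → G) × X) × ℝ => L * aliveInd σ f m w +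
      excess σ f a L (m + p) w.1 / a) (fullLaw μ ν l) :=
    ((integrable_aliveInd hW.measurable hf.measurable _).const_mul L).add (hexcf.div_const a)
  refine (integral_mono_of_nonneg (Eventually.of_forall fun _ => abs_nonneg _)
    (hint.const_mul (A * (p + 2))) (Eventually.of_forall fun w => ?_)).trans ?_
  · beta_reduce
    have he := excess_nonneg (σ := σ) (f := f) (a := a) L (m + p) w.1
    have hea : 0 ≤ excess σ f a L (m + p) w.1 / a := div_nonneg he ha.le
    by_cases hw : w ∈ alive σ f m
    · rw [aliveInd_of_mem hw, mul_one, mul_one, mul_one, ← mul_sub, abs_mul, mul_assoc]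
      refine mul_le_mul (hθ.abs_le _) ?_ (abs_nonneg _) hA
      have h1 := hw m hm le_rfl
      have h2 := abs_walk_sub_le hW.cocycle (x := w.1.2) (ω := w.1.1)
        (D := L + excess σ f a L (m + p) w.1 / a) m p fun k hk => abs_incr_le ha L hk.le _
      have h3 := abs_pert_le (σ := σ) ha (f := f) L (N := m + p) (k := m) (by omega) w.1
      have h4 := abs_pert_le (σ := σ) ha (f := f) L (N := m + p) (k := 0) (by omega) w.1
      simp only [Function.iterate_zero, id_eq] at h4
      calc _ = |max (w.2 + walk σ w.1.2 (m + p) w.1.1) 0 - max (w.2 + disp σ f m w.1) 0| := by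
            rw [max_eq_left h1]
        _ ≤ |w.2 + walk σ w.1.2 (m + p) w.1.1 - (w.2 + disp σ f m w.1)| :=
            abs_max_sub_max_le_abs _ _ _
        _ = |(walk σ w.1.2 (m + p) w.1.1 - walk σ w.1.2 m w.1.1) + (f 0 w.1 -
              f m (shift^[m] w.1))| := by simp only [disp]; ring_nf
        _ ≤ _ := by
            refine (abs_add_le _ _).trans ?_
            have h5 := abs_sub (f 0 w.1) (f m (shift^[m] w.1))
            linarith
    · rw [aliveInd_of_notMem hw]
      simp only [mul_zero, sub_zero, abs_zero, zero_add]
      positivity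
  · rw [integral_const_mul, integral_add
      ((integrable_aliveInd hW.measurable hf.measurable _).const_mul L) (hexcf.div_const a),
      integral_const_mul, integral_div, integral_fullLaw_fst (excess σ f a L (m + p))]
    have : 0 ≤ l.real Set.univ := measureReal_nonneg
    refine mul_le_mul_of_nonneg_left (add_le_add le_rfl ?_) (by positivity)
    gcongr
    exact hexc.2

/-- Survival after the time `m + p` is a matter of the unperturbed walk issued from its position at
that time: the Markov property, for the perturbations and the twist of range `p`, reduces its
probability to an estimate of `survProb`. -/
theorem abs_integral_survEvent_sub_le (hW : WalkHyp μ ν σ a A) (hf : PertHyp μ ν a β A f)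
    (hθ : TwistHyp μ β A θ) (hl : TestMeasure l K c) {m p N : ℕ} (hm : 1 ≤ m) (L : ℝ)
    {s b κ E₀ E₁ : ℝ} (hκ : 0 ≤ κ) (hE₀ : 0 ≤ E₀) (hE₁ : 0 ≤ E₁)
    (hG : ∀ (x : X) (y : ℝ), |survProb μ σ x N y s b - κ * max y 0| ≤ E₀ + E₁ * y ^ 4) :
    |∫ w, θ w.1.1 * (survEvent σ (m + p) N s b).indicator 1 w * aliveInd σ f m w
        ∂(fullLaw μ ν l) - κ * meanPos μ ν l σ f θ m| ≤
      rangeError β A (l.real Set.univ) c p m 1 +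
      A * (E₀ * (survMass μ ν l σ f m + rangeError β A (l.real Set.univ) c p m 1) +
        E₁ * (l.real Set.univ *
          (8 * (K ^ 4 + 768 / a ^ 4 * Real.exp (2 * A) * (m + p : ℕ) ^ 2)))) +
      κ * (rangeError β A (l.real Set.univ) c p m
          (2 * K ^ 2 + 1 + 768 / a ^ 4 * Real.exp (2 * A) * (m + p : ℕ) ^ 2) +
        A * (p + 2) * (L * survMass μ ν l σ f m +
        l.real Set.univ * (2 * ((m + p : ℕ) + 1) * (A * Real.exp (-(a * L)))) / a)) := by
  have hA1 := hW.one_le_A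
  have hA := zero_le_one.trans hA1
  have hΛ : 0 ≤ l.real Set.univ := measureReal_nonneg
  set q := m + p with hq
  set Y : ((ℕ → G) × X) × ℝ → ℝ := fun w => w.2 + walk σ w.1.2 q w.1.1 with hY
  have hYm : Measurable Y :=
    measurable_snd.add ((measurable_walk hW.measurable q).comp measurable_fst)
  have hf'm : ∀ n, Measurable (truncSeq μ p f n) := measurable_truncSeq hf.measurable p
  have hθ'm : Measurable (trunc μ p θ) := measurable_trunc' μ p hθ.measurable
  -- the weight of finite range
  set h : ((ℕ → G) × X) × ℝ → ℝ := fun w =>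
    trunc μ p θ w.1.1 * aliveInd σ (truncSeq μ p f) m w with hh
  have hhm : Measurable h := (hθ'm.comp (measurable_fst.comp measurable_fst)).mul
    (measurable_aliveInd hW.measurable hf'm _)
  have hh0 (w) : 0 ≤ h w := mul_nonneg (hθ.trunc_nonneg _ _) (aliveInd_nonneg _ _ _ _)
  have hhA (w) : h w ≤ A * aliveInd σ (truncSeq μ p f) m w :=
    mul_le_mul_of_nonneg_right (hθ.trunc_le _ _) (aliveInd_nonneg _ _ _ _)
  have hhA' (w) : h w ≤ A := (hhA w).trans (mul_le_of_le_one_right hA (aliveInd_le_one _ _ _ _))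
  have hhabs (w) : |h w| ≤ A := by rw [abs_of_nonneg (hh0 w)]; exact hhA' w
  have hdep : DependsOnFirst q h := by
    intro ω₁ ω₂ x t hω
    simp only [hh, dependsOnFirst_aliveInd (μ := μ) (σ := σ) (f := f) p m ω₁ ω₂ x t hω,
      trunc_congr μ (p := p) θ fun i hi => hω i (by omega)]
  -- the transfer to finite range, for the survival event, the survival and the position
  have hSm := measurableSet_survEvent (X := X) hW.measurable q N s b
  have hone : ∫ z : (ℕ → G) × X, (1 : ℝ) ^ 2 ∂((pathLaw μ).prod ν) ≤ 1 := by simp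
  have t1 := abs_integral_sub_integral_truncSeq_le hW hf hθ hl
    (w := (survEvent σ q N s b).indicator 1) (measurable_one.indicator hSm) (W := fun _ => 1)
    measurable_const (fun _ => zero_le_one) (fun z t _ => by
      by_cases hz : (z, t) ∈ survEvent σ q N s b <;> simp [hz]) (V := 1) (integrable_const _) hone p m
  have t2 := abs_integral_sub_integral_truncSeq_le hW hf (TwistHyp.one (μ := μ) (β := β) hA1) hl
    (w := fun _ => 1) measurable_const (W := fun _ => 1)
    measurable_const (fun _ => zero_le_one) (fun z t _ => by simp) (V := 1) (integrable_const _)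
    hone p m
  obtain ⟨hWi, hWV⟩ := hW.integral_sq_le q K
  have t3 := abs_integral_sub_integral_truncSeq_le hW hf hθ hl
    (w := fun w => max (Y w) 0) (hYm.max measurable_const)
    (W := fun z => K + |walk σ z.2 q z.1|) ((measurable_walk hW.measurable q).norm.const_add K)
    (fun z => by have := hl.K_nonneg; positivity) (fun z t ht => by
      rw [abs_of_nonneg (le_max_right _ _)]
      refine max_le ?_ (by have := hl.K_nonneg; positivity)
      exact add_le_add ((le_abs_self _).trans ht) (le_abs_self _)) hWi hWV p m
  have t4 := abs_integral_posPart_sub_meanPos_le hW hf hθ hl (p := p) hm L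
  -- the Markov property
  have hmark := hW.integral_mul_survEvent (l := l) N s b hhm hhabs hdep
  have e1 : ∫ x, trunc μ p θ x.1.1 * (survEvent σ q N s b).indicator 1 x *
      aliveInd σ (truncSeq μ p f) m x ∂(fullLaw μ ν l) =
      ∫ w, h w * survProb μ σ (leftProd w.1.1 q • w.1.2) N (Y w) s b ∂(fullLaw μ ν l) := by
    rw [← hmark]
    exact integral_congr_ae (Eventually.of_forall fun w => by simp only [hh]; ring)
  obtain ⟨h4i, h4⟩ := integral_position_pow_four_le hW hl q
  have hai : Integrable (aliveInd σ (truncSeq μ p f) m) (fullLaw μ ν l) :=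
    integrable_aliveInd hW.measurable hf'm m
  have hsm : Measurable fun w : ((ℕ → G) × X) × ℝ =>
      survProb μ σ (leftProd w.1.1 q • w.1.2) N (Y w) s b := by
    refine (measurable_survProb hW.measurable N s b).comp (Measurable.prodMk ?_ hYm)
    exact ((measurable_leftProd q).comp (measurable_fst.comp measurable_fst)).smul
      (measurable_snd.comp measurable_fst)
  have hsi : Integrable (fun w => h w * survProb μ σ (leftProd w.1.1 q • w.1.2) N (Y w) s b)
      (fullLaw μ ν l) := by
    refine Integrable.of_bound (hhm.mul hsm).aestronglyMeasurable (A * 1)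
      (Eventually.of_forall fun w => ?_)
    rw [norm_mul, Real.norm_eq_abs, Real.norm_eq_abs]
    refine mul_le_mul (hhabs w) ?_ (abs_nonneg _) hA
    rw [survProb, abs_of_nonneg measureReal_nonneg]
    exact measureReal_le_one
  have hmaxi : Integrable (fun w => max (Y w) 0) (fullLaw μ ν l) :=
    (hl.integrable_snd.add ((hW.integrable_walk q).comp_fst l)).pos_part
  have hpi : Integrable (fun w => h w * max (Y w) 0) (fullLaw μ ν l) :=
    hmaxi.bdd_mul hhm.aestronglyMeasurable (Eventually.of_forall hhabs)
  have e2 : |∫ w, h w * survProb μ σ (leftProd w.1.1 q • w.1.2) N (Y w) s b ∂(fullLaw μ ν l) -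
      κ * ∫ w, h w * max (Y w) 0 ∂(fullLaw μ ν l)| ≤
      A * (E₀ * ∫ w, aliveInd σ (truncSeq μ p f) m w ∂(fullLaw μ ν l) +
        E₁ * ∫ w, Y w ^ 4 ∂(fullLaw μ ν l)) := by
    rw [← integral_const_mul, ← integral_sub hsi (hpi.const_mul κ), ← integral_const_mul,
      ← integral_const_mul, ← integral_add (hai.const_mul E₀) (h4i.const_mul E₁),
      ← integral_const_mul]
    refine abs_integral_le_integral_abs.trans (integral_mono_of_nonneg
      (Eventually.of_forall fun _ => abs_nonneg _)
      (((hai.const_mul E₀).add (h4i.const_mul E₁)).const_mul A) (Eventually.of_forall fun w => ?_))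
    beta_reduce
    have e : h w * survProb μ σ (leftProd w.1.1 q • w.1.2) N (Y w) s b -
        κ * (h w * max (Y w) 0) = h w *
        (survProb μ σ (leftProd w.1.1 q • w.1.2) N (Y w) s b - κ * max (Y w) 0) := by ring
    rw [e, abs_mul, abs_of_nonneg (hh0 w)]
    have hy4 : 0 ≤ E₁ * Y w ^ 4 := by positivity
    calc _ ≤ h w * (E₀ + E₁ * Y w ^ 4) := mul_le_mul_of_nonneg_left (hG _ _) (hh0 w)
      _ = E₀ * h w + h w * (E₁ * Y w ^ 4) := by ring
      _ ≤ E₀ * (A * aliveInd σ (truncSeq μ p f) m w) + A * (E₁ * Y w ^ 4) :=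
          add_le_add (mul_le_mul_of_nonneg_left (hhA w) hE₀)
            (mul_le_mul_of_nonneg_right (hhA' w) hy4)
      _ = _ := by ring
  have e3 : ∫ x, trunc μ p θ x.1.1 * max (Y x) 0 * aliveInd σ (truncSeq μ p f) m x
      ∂(fullLaw μ ν l) = ∫ w, h w * max (Y w) 0 ∂(fullLaw μ ν l) :=
    integral_congr_ae (Eventually.of_forall fun w => by simp only [hh]; ring)
  have e4 : ∫ w, aliveInd σ (truncSeq μ p f) m w ∂(fullLaw μ ν l) ≤
      survMass μ ν l σ f m + rangeError β A (l.real Set.univ) c p m 1 := by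
    have : trunc μ p (fun _ : ℕ → G => (1 : ℝ)) = fun _ => 1 := by ext ω; simp [trunc]
    simp only [this, one_mul] at t2
    have := (abs_le.1 t2).1
    rw [rangeError, survMass]
    linarith
  rw [e1] at t1
  rw [e3] at t3
  have e5 : |κ * ∫ w, h w * max (Y w) 0 ∂(fullLaw μ ν l) - κ * meanPos μ ν l σ f θ m| ≤
      κ * (rangeError β A (l.real Set.univ) c p m
          (2 * K ^ 2 + 1 + 768 / a ^ 4 * Real.exp (2 * A) * q ^ 2) +
        A * (p + 2) * (L * survMass μ ν l σ f m +
        l.real Set.univ * (2 * ((q : ℕ) + 1) * (A * Real.exp (-(a * L)))) / a)) := by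
    rw [← mul_sub, abs_mul, abs_of_nonneg hκ]
    refine mul_le_mul_of_nonneg_left ?_ hκ
    refine (abs_sub_le _ _ _).trans (add_le_add ?_ t4)
    rw [abs_sub_comm]
    exact t3
  have e6 : A * (E₀ * ∫ w, aliveInd σ (truncSeq μ p f) m w ∂(fullLaw μ ν l) +
        E₁ * ∫ w, Y w ^ 4 ∂(fullLaw μ ν l)) ≤
      A * (E₀ * (survMass μ ν l σ f m + rangeError β A (l.real Set.univ) c p m 1) +
        E₁ * (l.real Set.univ *
          (8 * (K ^ 4 + 768 / a ^ 4 * Real.exp (2 * A) * (q : ℕ) ^ 2)))) := by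
    gcongr
  calc _ ≤ _ := abs_sub_le _ (∫ w, h w * survProb μ σ (leftProd w.1.1 q • w.1.2) N (Y w) s b
        ∂(fullLaw μ ν l)) _
    _ ≤ rangeError β A (l.real Set.univ) c p m 1 + _ :=
        add_le_add t1 ((abs_sub_le _ (κ * ∫ w, h w * max (Y w) 0 ∂(fullLaw μ ν l)) _).trans
          (add_le_add (e2.trans e6) e5))
    _ = _ := by ring

/-- The twisted mass of the survivors above a level is, up to errors, a multiple of the mean
position at a much smaller time. -/
theorem abs_tailMass_sub_le (hW : WalkHyp μ ν σ a A) (hf : PertHyp μ ν a β A f)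
    (hθ : TwistHyp μ β A θ) (hl : TestMeasure l K c) {m p N : ℕ} (hm : 1 ≤ m) {L : ℝ}
    (hL : 0 ≤ L) {s b κ E₀ E₁ : ℝ} (hs : (2 + p) * L ≤ s) (hκ : 0 ≤ κ) (hE₀ : 0 ≤ E₀)
    (hE₁ : 0 ≤ E₁)
    (hG : ∀ (x : X) (y s' : ℝ), |s'| ≤ s →
      |survProb μ σ x N y s' b - κ * max y 0| ≤ E₀ + E₁ * y ^ 4) :
    |tailMass μ ν l σ f θ (m + p + N) b - κ * meanPos μ ν l σ f θ m| ≤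
      A * (l.real Set.univ * (2 * ((m + p + N : ℕ) + 1) * (A * Real.exp (-(a * L))))) +
      (rangeError β A (l.real Set.univ) c p m 1 +
      A * (E₀ * (survMass μ ν l σ f m + rangeError β A (l.real Set.univ) c p m 1) +
        E₁ * (l.real Set.univ *
          (8 * (K ^ 4 + 768 / a ^ 4 * Real.exp (2 * A) * (m + p : ℕ) ^ 2)))) +
      κ * (rangeError β A (l.real Set.univ) c p m
          (2 * K ^ 2 + 1 + 768 / a ^ 4 * Real.exp (2 * A) * (m + p : ℕ) ^ 2) +
        A * (p + 2) * (L * survMass μ ν l σ f m +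
        l.real Set.univ * (2 * ((m + p : ℕ) + 1) * (A * Real.exp (-(a * L)))) / a))) := by
  have hA := zero_le_one.trans hW.one_le_A
  have hs0 : 0 ≤ s := le_trans (by positivity) hs
  have hs2 : 2 * L ≤ s := le_trans (by nlinarith [p.cast_nonneg (α := ℝ)]) hs
  have hu := abs_le.1 (abs_integral_survEvent_sub_le (N := N) (p := p) hW hf hθ hl hm L (s := s)
    (b := b) hκ hE₀ hE₁ fun x y => hG x y s (abs_of_nonneg hs0).le)
  have hlo := abs_le.1 (abs_integral_survEvent_sub_le (N := N) (p := p) hW hf hθ hl hm L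
    (s := -s) (b := b) hκ hE₀ hE₁ fun x y => hG x y (-s) (by rw [abs_neg, abs_of_nonneg hs0]))
  obtain ⟨hei, hele⟩ := hf.integrable_excess hW L (m + p + N)
  have hef : Integrable (fun w : ((ℕ → G) × X) × ℝ => A * excess σ f a L (m + p + N) w.1)
    (fullLaw μ ν l) := (hei.comp_fst l).const_mul A
  have hX : ∫ w : ((ℕ → G) × X) × ℝ, A * excess σ f a L (m + p + N) w.1 ∂(fullLaw μ ν l) ≤
      A * (l.real Set.univ * (2 * ((m + p + N : ℕ) + 1) * (A * Real.exp (-(a * L))))) := by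
    rw [integral_const_mul, integral_fullLaw_fst (excess σ f a L (m + p + N))]
    have : 0 ≤ l.real Set.univ := measureReal_nonneg
    gcongr
  have hSi (s : ℝ) : Integrable (fun w => θ w.1.1 * (survEvent σ (m + p) N s b).indicator 1 w *
      aliveInd σ f m w) (fullLaw μ ν l) :=
    integrable_mul_mul hW hf hθ.measurable hθ.abs_le ((integrable_const 1).indicator
      (measurableSet_survEvent hW.measurable _ N s b)) m
  have hTi : Integrable (fun w => θ w.1.1 * tailInd σ (m + p + N) b w *
      aliveInd σ f (m + p + N) w) (fullLaw μ ν l) :=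
    integrable_mul_mul hW hf hθ.measurable hθ.abs_le ((integrable_const 1).indicator
      (measurableSet_tail hW.measurable _ b)) _
  have hmul {u v' e t : ℝ} (ht0 : 0 ≤ t) (htA : t ≤ A) (he : 0 ≤ e) (h : u ≤ v' + e) :
      t * u ≤ t * v' + A * e := by
    nlinarith [mul_le_mul_of_nonneg_left h ht0, mul_le_mul_of_nonneg_right htA he]
  have h1 : tailMass μ ν l σ f θ (m + p + N) b ≤ ∫ w, θ w.1.1 *
      (survEvent σ (m + p) N s b).indicator 1 w * aliveInd σ f m w ∂(fullLaw μ ν l) +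
      ∫ w : ((ℕ → G) × X) × ℝ, A * excess σ f a L (m + p + N) w.1 ∂(fullLaw μ ν l) := by
    rw [← integral_add (hSi s) hef]
    refine integral_mono hTi ((hSi s).add hef) fun w => ?_
    simp only [mul_assoc]
    exact hmul (hθ.nonneg _) (hθ.le _) (excess_nonneg _ _ _)
      (aliveInd_mul_tailInd_le hW.a_pos hs2 (by omega) (by omega) b w)
  have h2 : ∫ w, θ w.1.1 * (survEvent σ (m + p) N (-s) b).indicator 1 w * aliveInd σ f m w
      ∂(fullLaw μ ν l) ≤ tailMass μ ν l σ f θ (m + p + N) b +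
      ∫ w : ((ℕ → G) × X) × ℝ, A * excess σ f a L (m + p + N) w.1 ∂(fullLaw μ ν l) := by
    rw [tailMass, ← integral_add hTi hef]
    refine integral_mono (hSi (-s)) (hTi.add hef) fun w => ?_
    simp only [mul_assoc]
    exact hmul (hθ.nonneg _) (hθ.le _) (excess_nonneg _ _ _)
      (le_aliveInd_mul_tailInd hW.cocycle hW.a_pos hL hs b w)
  rw [abs_le]
  constructor <;> linarith [hu.1, hu.2, hlo.1, hlo.2]

end Comparison

/-! ### Asymptotics of the survivors above a level -/

section Rates

/-- The range of the perturbations kept at time `n`. -/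
noncomputable def rangeAt (n : ℕ) : ℕ := ⌊(n : ℝ) ^ (1 / 100 : ℝ) / 2⌋₊

/-- The time after which the perturbations are neglected, for survival up to time `n`. -/
noncomputable def startTime (n : ℕ) : ℕ := ⌊(n : ℝ) ^ (3 / 5 : ℝ)⌋₊

theorem rpow_le_rpow_of_le {x r s : ℝ} (hx : 1 ≤ x) (h : r ≤ s) : x ^ r ≤ x ^ s :=
  Real.rpow_le_rpow_of_exponent_le hx h

theorem rangeAt_le (n : ℕ) : (rangeAt n : ℝ) ≤ (n : ℝ) ^ (1 / 100 : ℝ) / 2 :=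
  Nat.floor_le (by positivity)

theorem startTime_le (n : ℕ) : (startTime n : ℝ) ≤ (n : ℝ) ^ (3 / 5 : ℝ) :=
  Nat.floor_le (by positivity)

theorem one_le_startTime {n : ℕ} (hn : 1 ≤ n) : 1 ≤ startTime n :=
  Nat.le_floor (by
    rw [Nat.cast_one]; exact Real.one_le_rpow (by exact_mod_cast hn) (by norm_num))

theorem half_le_startTime {n : ℕ} (hn : 1 ≤ n) : (n : ℝ) ^ (3 / 5 : ℝ) / 2 ≤ startTime n := by
  have h1 : (n : ℝ) ^ (3 / 5 : ℝ) < startTime n + 1 := Nat.lt_floor_add_one _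
  have h2 : (1 : ℝ) ≤ startTime n := by exact_mod_cast one_le_startTime hn
  linarith

theorem startTime_add_rangeAt_le {n : ℕ} (hn : 1 ≤ n) :
    (startTime n : ℝ) + rangeAt n ≤ 2 * (n : ℝ) ^ (3 / 5 : ℝ) := by
  have hx : (1 : ℝ) ≤ n := by exact_mod_cast hn
  have h1 := startTime_le n
  have h2 := rangeAt_le n
  have h3 : (n : ℝ) ^ (1 / 100 : ℝ) ≤ (n : ℝ) ^ (3 / 5 : ℝ) := rpow_le_rpow_of_le hx (by norm_num)
  have h4 : 0 ≤ (n : ℝ) ^ (1 / 100 : ℝ) := by positivity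
  linarith

theorem four_mul_rpow_le {n : ℕ} (hn : 32 ≤ n) : 4 * (n : ℝ) ^ (3 / 5 : ℝ) ≤ n := by
  have hx : (32 : ℝ) ≤ n := by exact_mod_cast hn
  have h1 : (4 : ℝ) ≤ (n : ℝ) ^ (2 / 5 : ℝ) := by
    calc (4 : ℝ) = (32 : ℝ) ^ (2 / 5 : ℝ) := by
          rw [show (32 : ℝ) = (2 : ℝ) ^ (5 : ℝ) by norm_num, ← Real.rpow_mul (by norm_num)]
          norm_num
      _ ≤ _ := Real.rpow_le_rpow (by norm_num) hx (by norm_num)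
  calc 4 * (n : ℝ) ^ (3 / 5 : ℝ) ≤ (n : ℝ) ^ (2 / 5 : ℝ) * (n : ℝ) ^ (3 / 5 : ℝ) := by gcongr
    _ = n := by rw [← Real.rpow_add (by linarith)]; norm_num

theorem exists_exp_neg_level_le {a : ℝ} (ha : 0 < a) : ∃ C : ℝ, 0 ≤ C ∧ ∀ n : ℕ, 1 ≤ n →
    Real.exp (-(a * (n : ℝ) ^ (1 / 100 : ℝ))) ≤ C * (n : ℝ) ^ (-6 : ℝ) := by
  obtain ⟨C, hC, h⟩ := exists_exp_neg_rpow_le (δ := 1 / 100) ha (by norm_num) 6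
  exact ⟨C, hC, fun n hn => h n (by exact_mod_cast hn)⟩

theorem exists_exp_neg_rangeAt_le {β : ℝ} (hβ : 0 < β) : ∃ C : ℝ, 0 ≤ C ∧ ∀ n : ℕ, 1 ≤ n →
    Real.exp (-(β * rangeAt n / 2)) ≤ C * (n : ℝ) ^ (-6 : ℝ) := by
  obtain ⟨C, hC, h⟩ := exists_exp_neg_level_le (a := β / 4) (by positivity)
  refine ⟨Real.exp (β / 2) * C, by positivity, fun n hn => ?_⟩
  calc _ ≤ Real.exp (β / 2) * Real.exp (-(β / 4 * (n : ℝ) ^ (1 / 100 : ℝ))) := by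
        rw [← Real.exp_add, Real.exp_le_exp]
        have h1 : (n : ℝ) ^ (1 / 100 : ℝ) / 2 < rangeAt n + 1 := Nat.lt_floor_add_one _
        nlinarith
    _ ≤ _ := by rw [mul_assoc]; gcongr; exact h n hn

end Rates

section Asymptotics

variable {G X : Type*} [Group G] [MulAction G X] [MeasurableSpace G] [MeasurableMul₂ G]
  [MeasurableSpace X] [MeasurableSMul₂ G X]
  {μ : Measure G} [IsProbabilityMeasure μ] {ν : Measure X} [IsProbabilityMeasure ν]
  {σ : G → X → ℝ} {a β A v : ℝ} {l : Measure ℝ} [IsFiniteMeasure l] {K c : ℝ}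

set_option maxHeartbeats 1000000 in
/-- The survivors above the level `b v √n` at time `n` are governed by the mean position at the
time `startTime n`. -/
theorem exists_tailMass_estimate (hW : WalkHyp μ ν σ a A) (hβ : 0 < β) (hv : 0 < v)
    (happ : StrongApproximation μ σ v) (hl : TestMeasure l K c) {b₀ : ℝ} (hb₀ : 0 ≤ b₀) :
    ∃ C : ℝ, 0 ≤ C ∧ ∀ f, PertHyp μ ν a β A f → ∀ θ, TwistHyp μ β A θ → ∀ n : ℕ, 32 ≤ n →
      ∀ b ≤ b₀, |tailMass μ ν l σ f θ n (b * v * √n) -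
        2 * v⁻¹ * (√n)⁻¹ * gaussDensity (max b 0) * meanPos μ ν l σ f θ (startTime n)| ≤
        C * ((n : ℝ) ^ (-(6 / 25) : ℝ) * survMass μ ν l σ f (startTime n) +
          (n : ℝ) ^ (-(27 / 50) : ℝ)) := by
  obtain ⟨C₁, hC₁, hest⟩ := exists_survProb_estimate μ hW.measurable hv happ hb₀
    (Cs := 3) (by norm_num)
  have ha := hW.a_pos
  have hA1 := hW.one_le_A
  have hA := zero_le_one.trans hA1
  have hc := hl.c_nonneg
  have hK := hl.K_nonneg
  obtain ⟨Ca, hCa, hexpa⟩ := exists_exp_neg_level_le ha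
  obtain ⟨Cb, hCb, hexpb⟩ := exists_exp_neg_rangeAt_le hβ
  set Λ := l.real Set.univ with hΛdef
  have hΛ : 0 ≤ Λ := measureReal_nonneg
  set C₄ := 768 / a ^ 4 * Real.exp (2 * A) with hC₄def
  have hC₄ : 0 ≤ C₄ := by positivity
  set w := v⁻¹ with hwdef
  have hw : 0 ≤ w := by positivity
  set c₂ := Cb * (2 * K ^ 2 + 1 + C₄ + A) * (Λ + A * c) with hc₂
  have hc₂0 : 0 ≤ c₂ := by positivity
  set Cg := A * (2 * C₁) + 2 * w * A * 3 with hCg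
  set Ch := A * (Λ * (4 * A * Ca)) + (c₂ + A * (2 * C₁ * c₂ + C₁ * (Λ * (8 * (K ^ 4 + 4 * C₄)))) +
    2 * w * (c₂ + A * 3 * (Λ * (4 * A * Ca) / a))) with hCh
  have hCg0 : 0 ≤ Cg := by positivity
  have hCh0 : 0 ≤ Ch := by positivity
  refine ⟨Cg + Ch, by positivity, fun f hf θ hθ n hn b hb => ?_⟩
  have hn1 : 1 ≤ n := by omega
  set x : ℝ := (n : ℝ) with hx
  have hx1 : (1 : ℝ) ≤ x := Nat.one_le_cast.2 hn1
  have hx0 : 0 < x := by linarith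
  set m := startTime n with hm
  set p := rangeAt n with hp
  set L := x ^ (1 / 100 : ℝ) with hL
  have hL1 : 1 ≤ L := Real.one_le_rpow hx1 (by norm_num)
  have hpL : (p : ℝ) ≤ L / 2 := rangeAt_le n
  have hq : (m : ℝ) + p ≤ 2 * x ^ (3 / 5 : ℝ) := startTime_add_rangeAt_le hn1
  have h4 : 4 * x ^ (3 / 5 : ℝ) ≤ x := four_mul_rpow_le hn
  have hqn : m + p ≤ n := by
    have : (m : ℝ) + p ≤ n := by
      have : 0 ≤ x ^ (3 / 5 : ℝ) := by positivity
      linarith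
    exact_mod_cast this
  obtain ⟨N, hN⟩ := Nat.exists_eq_add_of_le hqn
  have hNx : x = m + p + N := by rw [hx, hN]; push_cast; ring
  have hn2N : n ≤ 2 * N := by
    have : (n : ℝ) ≤ 2 * N := by linarith
    exact_mod_cast this
  have hm1 : 1 ≤ m := one_le_startTime hn1
  set g := x ^ (-(6 / 25) : ℝ) with hg
  set h := x ^ (-(27 / 50) : ℝ) with hh
  have hg0 : 0 < g := by positivity
  have hh0 : 0 < h := by positivity
  have hg1 : g ≤ 1 := Real.rpow_le_one_of_one_le_of_nonpos hx1 (by norm_num)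
  have hsq : (√x)⁻¹ = x ^ (-(1 / 2) : ℝ) := by rw [Real.sqrt_eq_rpow, Real.rpow_neg hx0.le]
  set κ := 2 * w * (√x)⁻¹ * gaussDensity (max b 0) with hκ
  have hgd0 := gaussDensity_nonneg (max b 0)
  have hgd1 := gaussDensity_le_one (max b 0)
  have hκ0 : 0 ≤ κ := by positivity
  have hκ1 : κ ≤ 2 * w * x ^ (-(1 / 2) : ℝ) := by
    rw [hκ, hsq]; exact mul_le_of_le_one_right (by positivity) hgd1
  have hκ2 : κ ≤ 2 * w := hκ1.trans (mul_le_of_le_one_right (by positivity)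
    (Real.rpow_le_one_of_one_le_of_nonpos hx1 (by norm_num)))
  have hLL : L * L = x ^ (1 / 50 : ℝ) := by rw [hL, ← Real.rpow_add hx0]; norm_num
  have hLx : L ≤ x := by
    calc L ≤ x ^ (1 : ℝ) := rpow_le_rpow_of_le hx1 (by norm_num)
      _ = x := Real.rpow_one x
  have hpL3 : (2 + p : ℝ) * L ≤ 3 * x ^ (1 / 50 : ℝ) := by
    rw [← hLL, ← mul_assoc]; exact mul_le_mul_of_nonneg_right (by linarith) (by linarith)
  -- the estimate for the unperturbed walk, in the form required
  have hG : ∀ (z : X) (y s' : ℝ), |s'| ≤ (2 + p) * L →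
      |survProb μ σ z N y s' (b * v * √x) - κ * max y 0| ≤
        2 * C₁ * g + C₁ * x ^ (6 / 25 - 2 : ℝ) * y ^ 4 := by
    intro z y s' hs'
    have h1 := hest n N (by omega) (by omega) hn2N (by change x - N ≤ 2 * x ^ (3 / 5 : ℝ); linarith) z y s' b
      (hs'.trans (hpL3.trans (by gcongr; norm_num))) hb
    have e : 2 * v⁻¹ * max y 0 * (√n)⁻¹ * gaussDensity (max b 0) = κ * max y 0 := by
      rw [hκ, hwdef]; ring
    rw [e] at h1
    refine h1.trans ?_
    have h2 : y ^ 2 / x ≤ g + x ^ (6 / 25 - 2 : ℝ) * y ^ 4 := by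
      have e1 : x ^ (6 / 25 - 2 : ℝ) = g⁻¹ / x ^ 2 := by
        rw [hg, ← Real.rpow_neg hx0.le, Real.rpow_sub hx0, neg_neg]; norm_num
      have e2 : x ^ (6 / 25 - 2 : ℝ) * y ^ 4 = (y ^ 2 / x) ^ 2 / g := by
        rw [e1]; field_simp
      rw [e2, ← sub_nonneg]
      have : g + (y ^ 2 / x) ^ 2 / g - y ^ 2 / x =
          ((g - y ^ 2 / x / 2) ^ 2 + 3 / 4 * (y ^ 2 / x) ^ 2) / g := by field_simp; ring
      rw [this]; positivity
    calc _ ≤ C₁ * (g + (g + x ^ (6 / 25 - 2 : ℝ) * y ^ 4)) := by gcongr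
      _ = _ := by ring
  have hmain := abs_tailMass_sub_le hW hf hθ hl (m := m) (p := p) (N := N) hm1 (L := L)
    (by linarith) (b := b * v * √x) le_rfl hκ0 (E₀ := 2 * C₁ * g)
    (E₁ := C₁ * x ^ (6 / 25 - 2 : ℝ)) (by positivity) (by positivity) hG
  rw [← hN] at hmain
  refine hmain.trans ?_
  set S := survMass μ ν l σ f m with hS
  have hS0 : 0 ≤ S := survMass_nonneg _
  -- the errors
  have x6 (k : ℝ) (hk : k ≤ -1) : x ^ k ≤ h := rpow_le_rpow_of_le hx1 (by linarith)
  have hqx : ((m + p : ℕ) : ℝ) ≤ x := Nat.cast_le.2 hqn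
  have hmx : (m : ℝ) ≤ x := by
    have : (0 : ℝ) ≤ p := p.cast_nonneg
    push_cast at hqx; linarith
  have hE : Real.exp (-(a * L)) ≤ Ca * x ^ (-6 : ℝ) := hexpa n hn1
  have hE' : Real.exp (-(β * p / 2)) ≤ Cb * x ^ (-6 : ℝ) := hexpb n hn1
  have x63 : x ^ (-6 : ℝ) * x ^ 3 ≤ h := by
    rw [← Real.rpow_natCast x 3, ← Real.rpow_add hx0]; exact x6 _ (by norm_num)
  have x62 : x ^ (-6 : ℝ) * x ^ 2 ≤ h := by
    rw [← Real.rpow_natCast x 2, ← Real.rpow_add hx0]; exact x6 _ (by norm_num)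
  have hxsq : 1 ≤ x ^ 2 := one_le_pow₀ hx1
  have hq2 : ((m + p : ℕ) : ℝ) ^ 2 ≤ x ^ 2 := by gcongr
  have hR (V : ℝ) (hV0 : 0 ≤ V) (hV : V ≤ (2 * K ^ 2 + 1 + C₄) * x ^ 2) :
      rangeError β A Λ c p m V ≤ c₂ * h := by
    rw [rangeError]
    calc _ ≤ (Cb * x ^ (-6 : ℝ)) * ((2 * K ^ 2 + 1 + C₄) * x ^ 2 + A * x ^ 2) *
          (Λ * x + A * c * x) := by
          gcongr
          · exact le_mul_of_one_le_right hA hxsq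
          · exact le_mul_of_one_le_right hΛ hx1
      _ = c₂ * (x ^ (-6 : ℝ) * x ^ 3) := by rw [hc₂]; ring
      _ ≤ _ := by gcongr
  have hR1 := hR 1 zero_le_one (by
    have h1 : 1 ≤ 2 * K ^ 2 + 1 + C₄ := by linarith [sq_nonneg K]
    exact one_le_mul_of_one_le_of_one_le h1 hxsq)
  have hRV := hR (2 * K ^ 2 + 1 + C₄ * ((m + p : ℕ) : ℝ) ^ 2) (by positivity) (by
    calc _ ≤ (2 * K ^ 2 + 1) * x ^ 2 + C₄ * x ^ 2 := by
          gcongr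
          exact le_mul_of_one_le_right (by positivity) hxsq
      _ = _ := by ring)
  have hX (k : ℕ) (hk : (k : ℝ) ≤ x) (r : ℝ) (hr0 : 0 ≤ r) (hr : r ≤ x) :
      r * (2 * ((k : ℝ) + 1) * (A * Real.exp (-(a * L)))) ≤ 4 * A * Ca * h := by
    calc _ ≤ x * (2 * (x + x) * (A * (Ca * x ^ (-6 : ℝ)))) := by gcongr
      _ = 4 * A * Ca * (x ^ (-6 : ℝ) * x ^ 2) := by ring
      _ ≤ _ := by gcongr
  have hX1 := hX n le_rfl 1 zero_le_one hx1
  rw [one_mul] at hX1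
  have hX2 := hX (m + p) hqx (L) (by linarith) hLx
  have hY : x ^ (6 / 25 - 2 : ℝ) * (K ^ 4 + C₄ * ((m + p : ℕ) : ℝ) ^ 2) ≤ (K ^ 4 + 4 * C₄) * h := by
    have e1 : (x ^ (3 / 5 : ℝ)) ^ 2 = x ^ (6 / 5 : ℝ) := by
      rw [← Real.rpow_natCast, ← Real.rpow_mul hx0.le]; norm_num
    have e2 : 1 ≤ x ^ (6 / 5 : ℝ) := Real.one_le_rpow hx1 (by norm_num)
    have e3 : ((m + p : ℕ) : ℝ) ^ 2 ≤ 4 * x ^ (6 / 5 : ℝ) := by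
      rw [← e1]
      calc _ ≤ (2 * x ^ (3 / 5 : ℝ)) ^ 2 := by gcongr; push_cast; exact hq
        _ = _ := by ring
    have e4 : x ^ (6 / 25 - 2 : ℝ) * x ^ (6 / 5 : ℝ) ≤ h := by
      rw [← Real.rpow_add hx0]; exact rpow_le_rpow_of_le hx1 (by norm_num)
    calc _ ≤ x ^ (6 / 25 - 2 : ℝ) * (K ^ 4 * x ^ (6 / 5 : ℝ) + C₄ * (4 * x ^ (6 / 5 : ℝ))) := by
          gcongr
          exact le_mul_of_one_le_right (by positivity) e2
      _ = (K ^ 4 + 4 * C₄) * (x ^ (6 / 25 - 2 : ℝ) * x ^ (6 / 5 : ℝ)) := by ring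
      _ ≤ _ := by gcongr
  have hκL : κ * ((p + 2) * L) ≤ 2 * w * 3 * g := by
    calc _ ≤ (2 * w * x ^ (-(1 / 2) : ℝ)) * (3 * x ^ (1 / 50 : ℝ)) := by
          rw [add_comm (p : ℝ) 2]; gcongr
      _ = 2 * w * 3 * (x ^ (-(1 / 2) : ℝ) * x ^ (1 / 50 : ℝ)) := by ring
      _ ≤ _ := by
          rw [← Real.rpow_add hx0]
          exact mul_le_mul_of_nonneg_left (rpow_le_rpow_of_le hx1 (by norm_num)) (by positivity)
  have hp3 : (p + 2 : ℝ) ≤ 3 * L := by linarith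
  -- collecting the errors
  have t1 : A * (Λ * (2 * ((n : ℕ) + 1) * (A * Real.exp (-(a * L))))) ≤
      A * (Λ * (4 * A * Ca)) * h := by
    calc _ ≤ A * (Λ * (4 * A * Ca * h)) := by gcongr
      _ = _ := by ring
  have t2 : A * (2 * C₁ * g * (S + rangeError β A Λ c p m 1) + C₁ * x ^ (6 / 25 - 2 : ℝ) *
      (Λ * (8 * (K ^ 4 + C₄ * ((m + p : ℕ) : ℝ) ^ 2)))) ≤
      A * (2 * C₁) * g * S + A * (2 * C₁ * c₂ + C₁ * (Λ * (8 * (K ^ 4 + 4 * C₄)))) * h := by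
    have e1 : g * rangeError β A Λ c p m 1 ≤ c₂ * h := by
      calc _ ≤ g * (c₂ * h) := by gcongr
        _ ≤ _ := mul_le_of_le_one_left (by positivity) hg1
    calc _ = A * (2 * C₁) * g * S + A * (2 * C₁ * (g * rangeError β A Λ c p m 1) + C₁ * (Λ * (8 *
          (x ^ (6 / 25 - 2 : ℝ) * (K ^ 4 + C₄ * ((m + p : ℕ) : ℝ) ^ 2))))) := by ring
      _ ≤ A * (2 * C₁) * g * S + A * (2 * C₁ * (c₂ * h) + C₁ * (Λ * (8 *
          ((K ^ 4 + 4 * C₄) * h)))) := by gcongr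
      _ = _ := by ring
  have t3 : κ * (rangeError β A Λ c p m (2 * K ^ 2 + 1 + C₄ * ((m + p : ℕ) : ℝ) ^ 2) +
      A * (p + 2) * (L * S + Λ * (2 * ((m + p : ℕ) + 1) * (A * Real.exp (-(a * L)))) / a)) ≤
      2 * w * A * 3 * g * S + 2 * w * (c₂ + A * 3 * (Λ * (4 * A * Ca) / a)) * h := by
    have e1 : (p + 2 : ℝ) * (2 * ((m + p : ℕ) + 1) * (A * Real.exp (-(a * L)))) ≤
        3 * (4 * A * Ca * h) := by
      calc _ ≤ 3 * L * (2 * ((m + p : ℕ) + 1) * (A * Real.exp (-(a * L)))) := by gcongr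
        _ = 3 * (L * (2 * ((m + p : ℕ) + 1) * (A * Real.exp (-(a * L))))) := by ring
        _ ≤ _ := by gcongr
    have e2 : 0 ≤ rangeError β A Λ c p m (2 * K ^ 2 + 1 + C₄ * ((m + p : ℕ) : ℝ) ^ 2) := by
      rw [rangeError]; positivity
    calc _ = κ * ((p + 2) * L) * (A * S) +
          κ * (rangeError β A Λ c p m (2 * K ^ 2 + 1 + C₄ * ((m + p : ℕ) : ℝ) ^ 2) +
          A * (Λ * ((p + 2) * (2 * ((m + p : ℕ) + 1) * (A * Real.exp (-(a * L))))) / a)) := by ring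
      _ ≤ 2 * w * 3 * g * (A * S) + 2 * w * (c₂ * h + A * (Λ * (3 * (4 * A * Ca * h)) / a)) := by
          gcongr
      _ = _ := by ring
  have hsum : A * (Λ * (4 * A * Ca)) * h + (c₂ * h + (A * (2 * C₁) * g * S +
      A * (2 * C₁ * c₂ + C₁ * (Λ * (8 * (K ^ 4 + 4 * C₄)))) * h) +
      (2 * w * A * 3 * g * S + 2 * w * (c₂ + A * 3 * (Λ * (4 * A * Ca) / a)) * h)) =
      Cg * (g * S) + Ch * h := by rw [hCg, hCh]; ring
  calc _ ≤ _ := add_le_add t1 (add_le_add (add_le_add hR1 t2) t3)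
    _ = Cg * (g * S) + Ch * h := hsum
    _ ≤ (Cg + Ch) * (g * S + h) := by
        have h1 : 0 ≤ Ch * (g * S) := by positivity
        have h2 : 0 ≤ Cg * h := by positivity
        linarith

end Asymptotics

/-! ### Convergence of the mean position and decay of the survival probability -/

section DyadicCauchy

/-- A sequence that varies little on dyadic blocks varies little. -/
theorem abs_sub_le_of_dyadic {u : ℕ → ℝ} {C γ : ℝ} (hC : 0 ≤ C) (hγ : 0 < γ)
    (h : ∀ M N : ℕ, 1 ≤ M → M ≤ N → N ≤ 2 * M → |u N - u M| ≤ C * (M : ℝ) ^ (-γ)) :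
    ∀ M N : ℕ, 1 ≤ M → M ≤ N → |u N - u M| ≤ C / (1 - 2 ^ (-γ)) * (M : ℝ) ^ (-γ) := by
  have h2 : (2 : ℝ) ^ (-γ) < 1 := Real.rpow_lt_one_of_one_lt_of_neg (by norm_num) (by linarith)
  have h3 : (0 : ℝ) < 2 ^ (-γ) := by positivity
  set r : ℝ := 2 ^ (-γ)
  have h1r : 0 < 1 - r := by linarith
  suffices H : ∀ d M N : ℕ, N - M ≤ d → 1 ≤ M → M ≤ N →
      |u N - u M| ≤ C / (1 - r) * (M : ℝ) ^ (-γ) from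
    fun M N hM hMN => H (N - M) M N le_rfl hM hMN
  intro d
  induction d with
  | zero =>
    intro M N hd hM hMN
    obtain rfl : M = N := by omega
    rw [sub_self, abs_zero]; positivity
  | succ d ih =>
    intro M N hd hM hMN
    have hM0 : (0 : ℝ) ≤ (M : ℝ) ^ (-γ) := by positivity
    rcases le_or_gt N (2 * M) with hN | hN
    · refine (h M N hM hMN hN).trans ?_
      gcongr
      rw [le_div_iff₀ h1r]
      nlinarith
    · have e1 := ih (2 * M) N (by omega) (by omega) hN.le
      have e2 := h M (2 * M) hM (by omega) le_rfl
      push_cast at e1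
      rw [Real.mul_rpow (by norm_num) (Nat.cast_nonneg _)] at e1
      calc _ ≤ |u N - u (2 * M)| + |u (2 * M) - u M| := abs_sub_le _ _ _
        _ ≤ C / (1 - r) * (r * (M : ℝ) ^ (-γ)) + C * (M : ℝ) ^ (-γ) := add_le_add e1 e2
        _ = _ := by field_simp; ring

end DyadicCauchy

section MeanPosition

variable {G X : Type*} [Group G] [MulAction G X] [MeasurableSpace G] [MeasurableMul₂ G]
  [MeasurableSpace X] [MeasurableSMul₂ G X]
  {μ : Measure G} [IsProbabilityMeasure μ] {ν : Measure X} [IsProbabilityMeasure ν]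
  {σ : G → X → ℝ} {a β A v : ℝ} {l : Measure ℝ} [IsFiniteMeasure l] {K c : ℝ}
  {f : ℕ → (ℕ → G) × X → ℝ} {θ : (ℕ → G) → ℝ}

/-- The mean position is at most of the order of the square root of the time. -/
theorem exists_abs_meanPos_le (hW : WalkHyp μ ν σ a A) (hl : TestMeasure l K c) :
    ∃ C : ℝ, 0 ≤ C ∧ ∀ f, PertHyp μ ν a β A f → ∀ θ, TwistHyp μ β A θ → ∀ m : ℕ, 1 ≤ m →
      |meanPos μ ν l σ f θ m| ≤ C * √m := by
  have ha := hW.a_pos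
  have hA := zero_le_one.trans hW.one_le_A
  have hK := hl.K_nonneg
  set C₄ := 768 / a ^ 4 * Real.exp (2 * A) with hC₄
  set Λ := l.real Set.univ with hΛdef
  have hΛ : 0 ≤ Λ := measureReal_nonneg
  refine ⟨A * (Λ * (K + (1 + C₄) + 2 * (A / a))), by positivity, fun f hf θ hθ m hm => ?_⟩
  set r := √(m : ℝ) with hr
  have hr1 : 1 ≤ r := Real.one_le_sqrt.2 (by exact_mod_cast hm)
  have hr0 : 0 < r := by linarith
  have hrr : r ^ 2 = m := Real.sq_sqrt (Nat.cast_nonneg _)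
  obtain ⟨h4i, h4⟩ := hW.walk_pow_four m
  obtain ⟨hmi, hm'⟩ := hf.exp_shift hW m m
  obtain ⟨h0i, h0⟩ := hf.exp_shift hW 0 0
  simp only [Function.iterate_zero, id_eq] at h0i h0
  let H : (ℕ → G) × X → ℝ := fun z => K + (r + (r ^ 3)⁻¹ * walk σ z.2 m z.1 ^ 4) +
    (Real.exp (a * |f m (shift^[m] z)|) / a + Real.exp (a * |f 0 z|) / a)
  have i1 : Integrable (fun z : (ℕ → G) × X => K + (r + (r ^ 3)⁻¹ * walk σ z.2 m z.1 ^ 4))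
      ((pathLaw μ).prod ν) :=
    (integrable_const _).add ((integrable_const _).add (h4i.const_mul _))
  have i1' : Integrable (fun z : (ℕ → G) × X => r + (r ^ 3)⁻¹ * walk σ z.2 m z.1 ^ 4)
      ((pathLaw μ).prod ν) := (integrable_const _).add (h4i.const_mul _)
  have i2 : Integrable (fun z => Real.exp (a * |f m (shift^[m] z)|) / a +
      Real.exp (a * |f 0 z|) / a) ((pathLaw μ).prod ν) := (hmi.div_const a).add (h0i.div_const a)
  have hHi : Integrable H ((pathLaw μ).prod ν) := i1.add i2
  have hH : ∫ z, H z ∂((pathLaw μ).prod ν) ≤ (K + (1 + C₄) + 2 * (A / a)) * r := by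
    simp only [H]
    rw [integral_add i1 i2, integral_add (integrable_const _) i1',
      integral_add (integrable_const _) (h4i.const_mul _), integral_const_mul,
      integral_add (hmi.div_const a) (h0i.div_const a), integral_div, integral_div]
    simp only [integral_const, probReal_univ, one_smul]
    have e1 : (r ^ 3)⁻¹ * ∫ z : (ℕ → G) × X, walk σ z.2 m z.1 ^ 4 ∂((pathLaw μ).prod ν) ≤
        C₄ * r := by
      calc _ ≤ (r ^ 3)⁻¹ * (C₄ * (m : ℝ) ^ 2) := by gcongr
        _ = C₄ * r := by rw [← hrr]; field_simp
    have e2 : A / a ≤ A / a * r := le_mul_of_one_le_right (by positivity) hr1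
    have e3 : K ≤ K * r := le_mul_of_one_le_right hK hr1
    have e4 := div_le_div_of_nonneg_right hm' ha.le
    have e5 := div_le_div_of_nonneg_right h0 ha.le
    linarith
  calc _ ≤ ∫ w, A * H w.1 ∂(fullLaw μ ν l) := by
        refine abs_integral_le_integral_abs.trans (integral_mono_of_nonneg
          (Eventually.of_forall fun _ => abs_nonneg _) ((hHi.comp_fst l).const_mul A) ?_)
        filter_upwards [hl.ae_abs_le] with w hw
        rw [abs_mul, abs_mul]
        have e1 : |w.2 + disp σ f m w.1| ≤ H w.1 := by
          have u1 := abs_le_exp_div ha (f m (shift^[m] w.1))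
          have u2 := abs_le_exp_div ha (f 0 w.1)
          set S := walk σ w.1.2 m w.1.1 with hS
          have u3 : |S| ≤ r + (r ^ 3)⁻¹ * S ^ 4 := by
            have hS4 : S ^ 4 = |S| ^ 4 := ((show Even 4 by decide).pow_abs S).symm
            rcases le_total |S| r with h | h
            · have : 0 ≤ (r ^ 3)⁻¹ * S ^ 4 := by positivity
              linarith
            · have : |S| ≤ (r ^ 3)⁻¹ * S ^ 4 := by
                rw [hS4, ← div_eq_inv_mul, le_div_iff₀ (by positivity)]
                calc |S| * r ^ 3 ≤ |S| * |S| ^ 3 := by gcongr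
                  _ = _ := by ring
              linarith
          have e : w.2 + disp σ f m w.1 = w.2 + S + (f m (shift^[m] w.1) - f 0 w.1) := by
            simp only [disp, hS]; ring
          rw [e]
          refine (abs_add_le _ _).trans (add_le_add ((abs_add_le _ _).trans (add_le_add hw u3))
            ((abs_sub _ _).trans (add_le_add u1 u2)))
        calc _ ≤ A * H w.1 * 1 := by
              have := (abs_nonneg _).trans e1
              gcongr
              · exact hθ.abs_le _
              · rw [abs_of_nonneg (aliveInd_nonneg _ _ _ _)]; exact aliveInd_le_one _ _ _ _
          _ = _ := mul_one _
    _ = A * (Λ * ∫ z, H z ∂((pathLaw μ).prod ν)) := by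
        rw [integral_const_mul, integral_fullLaw_fst H]
    _ ≤ A * (Λ * ((K + (1 + C₄) + 2 * (A / a)) * r)) := by gcongr
    _ = _ := by ring

/-- The survivors are above a slightly negative level. -/
theorem abs_twistedMass_sub_tailMass_le (hW : WalkHyp μ ν σ a A) (hf : PertHyp μ ν a β A f)
    (hθ : TwistHyp μ β A θ) {n : ℕ} (hn : 1 ≤ n) (L : ℝ) :
    |∫ w, θ w.1.1 * 1 * aliveInd σ f n w ∂(fullLaw μ ν l) -
      tailMass μ ν l σ f θ n (-(2 * L + 1))| ≤
      A * (l.real Set.univ * (2 * (n + 1) * (A * Real.exp (-(a * L))))) := by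
  have hA := zero_le_one.trans hW.one_le_A
  obtain ⟨hei, hele⟩ := hf.integrable_excess hW L n
  have hef : Integrable (fun w : ((ℕ → G) × X) × ℝ => A * excess σ f a L n w.1)
    (fullLaw μ ν l) := (hei.comp_fst l).const_mul A
  have hX : ∫ w : ((ℕ → G) × X) × ℝ, A * excess σ f a L n w.1 ∂(fullLaw μ ν l) ≤
      A * (l.real Set.univ * (2 * (n + 1) * (A * Real.exp (-(a * L))))) := by
    rw [integral_const_mul, integral_fullLaw_fst (excess σ f a L n)]
    have : 0 ≤ l.real Set.univ := measureReal_nonneg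
    gcongr
  have h1 : Integrable (fun w => θ w.1.1 * 1 * aliveInd σ f n w) (fullLaw μ ν l) :=
    integrable_mul_mul hW hf hθ.measurable hθ.abs_le (integrable_const 1) n
  have h2 : Integrable (fun w => θ w.1.1 * tailInd σ n (-(2 * L + 1)) w * aliveInd σ f n w)
      (fullLaw μ ν l) :=
    integrable_mul_mul hW hf hθ.measurable hθ.abs_le ((integrable_const 1).indicator
      (measurableSet_tail hW.measurable _ _)) _
  rw [tailMass, ← integral_sub h1 h2]
  refine (abs_integral_le_integral_abs.trans (integral_mono_of_nonneg
    (Eventually.of_forall fun _ => abs_nonneg _) hef (Eventually.of_forall fun w => ?_))).trans hX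
  beta_reduce
  rw [mul_assoc, mul_assoc, ← mul_sub, abs_mul, ← sub_mul, abs_mul]
  refine mul_le_mul (hθ.abs_le _) ?_ (by positivity) hA
  have he := excess_nonneg (σ := σ) (f := f) (a := a) L n w.1
  have t0 := tailInd_nonneg σ n (-(2 * L + 1)) w
  have t1 := tailInd_le_one σ n (-(2 * L + 1)) w
  rw [abs_of_nonneg (sub_nonneg.2 t1), abs_of_nonneg (aliveInd_nonneg _ _ _ _)]
  by_cases hw : w ∈ alive σ f n
  · rw [aliveInd_of_mem hw, mul_one]
    rcases le_or_gt 1 (excess σ f a L n w.1) with h | h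
    · linarith
    · have e1 := (abs_le.1 (abs_disp_sub_walk_le hW.a_pos h (le_refl n))).2
      have e2 := hw n hn le_rfl
      have hT : w ∈ {w : ((ℕ → G) × X) × ℝ | -(2 * L + 1) < w.2 + walk σ w.1.2 n w.1.1} := by
        simp only [Set.mem_ofPred_eq]; linarith
      rw [tailInd, Set.indicator_of_mem hT]
      simpa using he
  · rw [aliveInd_of_notMem hw, mul_zero]
    exact he

/-- The survivors at time `n` are governed by the mean position at the time `startTime n`. -/
theorem exists_twistedMass_estimate (hW : WalkHyp μ ν σ a A) (hβ : 0 < β) (hv : 0 < v)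
    (happ : StrongApproximation μ σ v) (hl : TestMeasure l K c) :
    ∃ C : ℝ, 0 ≤ C ∧ ∀ f, PertHyp μ ν a β A f → ∀ θ, TwistHyp μ β A θ → ∀ n : ℕ, 32 ≤ n →
      |∫ w, θ w.1.1 * 1 * aliveInd σ f n w ∂(fullLaw μ ν l) -
        2 * v⁻¹ * (√n)⁻¹ * gaussDensity 0 * meanPos μ ν l σ f θ (startTime n)| ≤
        C * ((n : ℝ) ^ (-(6 / 25) : ℝ) * survMass μ ν l σ f (startTime n) +
          (n : ℝ) ^ (-(27 / 50) : ℝ)) := by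
  obtain ⟨C, hC, hest⟩ := exists_tailMass_estimate (β := β) hW hβ hv happ hl (b₀ := 0) le_rfl
  obtain ⟨Ca, hCa, hexpa⟩ := exists_exp_neg_level_le hW.a_pos
  have hA := zero_le_one.trans hW.one_le_A
  set Λ := l.real Set.univ with hΛdef
  have hΛ : 0 ≤ Λ := measureReal_nonneg
  refine ⟨C + 4 * A ^ 2 * Λ * Ca, by positivity, fun f hf θ hθ n hn => ?_⟩
  have hn1 : 1 ≤ n := by omega
  have hx1 : (1 : ℝ) ≤ n := Nat.one_le_cast.2 hn1
  have hx0 : (0 : ℝ) < n := by linarith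
  set L := (n : ℝ) ^ (1 / 100 : ℝ) with hL
  have hL0 : 0 < L := by positivity
  have hs0 : 0 < √(n : ℝ) := Real.sqrt_pos.2 hx0
  have hb : -(2 * L + 1) / (v * √n) ≤ 0 := div_nonpos_of_nonpos_of_nonneg (by linarith)
    (by positivity)
  have h1 := hest f hf θ hθ n hn _ hb
  rw [max_eq_right hb] at h1
  have e : -(2 * L + 1) / (v * √n) * v * √n = -(2 * L + 1) := by field_simp
  rw [e] at h1
  have h2 := abs_twistedMass_sub_tailMass_le (l := l) hW hf hθ hn1 L
  have h3 := hexpa n hn1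
  have h4 : A * (Λ * (2 * (n + 1) * (A * Real.exp (-(a * L))))) ≤
      4 * A ^ 2 * Λ * Ca * (n : ℝ) ^ (-(27 / 50) : ℝ) := by
    calc _ ≤ A * (Λ * (2 * (n + n) * (A * (Ca * (n : ℝ) ^ (-6 : ℝ))))) := by gcongr
      _ = 4 * A ^ 2 * Λ * Ca * ((n : ℝ) ^ (1 : ℝ) * (n : ℝ) ^ (-6 : ℝ)) := by
          rw [Real.rpow_one]; ring
      _ ≤ _ := by
          rw [← Real.rpow_add hx0]
          gcongr
          norm_num
  have h5 : 0 ≤ (n : ℝ) ^ (-(6 / 25) : ℝ) * survMass μ ν l σ f (startTime n) :=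
    mul_nonneg (by positivity) (survMass_nonneg _)
  have h6 : 0 ≤ 4 * A ^ 2 * Λ * Ca * ((n : ℝ) ^ (-(6 / 25) : ℝ) *
    survMass μ ν l σ f (startTime n)) := by positivity
  refine (abs_sub_le _ (tailMass μ ν l σ f θ n (-(2 * L + 1))) _).trans ?_
  linarith

theorem survMass_eq (n : ℕ) : survMass μ ν l σ f n =
    ∫ w, (fun _ => 1 : (ℕ → G) → ℝ) w.1.1 * 1 * aliveInd σ f n w ∂(fullLaw μ ν l) := by
  simp [survMass]

/-- The control of the survivors by the mean position, in the form of an upper bound that also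
covers small times. -/
theorem exists_survMass_le_of_meanPos_le (hW : WalkHyp μ ν σ a A) (hβ : 0 < β) (hv : 0 < v)
    (happ : StrongApproximation μ σ v) (hl : TestMeasure l K c) {C₀ r s t : ℝ} (hC₀ : 0 ≤ C₀)
    (hs : 0 ≤ s) (ht : t ≤ 1 / 2) (htr : t ≤ 1 / 2 - 3 / 5 * r) (hts : t ≤ 6 / 25 + 3 / 5 * s)
    (hr : 0 ≤ r)
    (hu : ∀ f, PertHyp μ ν a β A f → ∀ m : ℕ, 1 ≤ m →
      |meanPos μ ν l σ f (fun _ => 1) m| ≤ C₀ * (m : ℝ) ^ r)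
    (hsurv : ∀ f, PertHyp μ ν a β A f → ∀ m : ℕ, 1 ≤ m →
      survMass μ ν l σ f m ≤ C₀ * (m : ℝ) ^ (-s)) :
    ∃ C : ℝ, 0 ≤ C ∧ ∀ f, PertHyp μ ν a β A f → ∀ n : ℕ, 1 ≤ n →
      survMass μ ν l σ f n ≤ C * (n : ℝ) ^ (-t) := by
  obtain ⟨C, hC, hest⟩ := exists_twistedMass_estimate (β := β) hW hβ hv happ hl
  set Λ := l.real Set.univ with hΛdef
  have hΛ : 0 ≤ Λ := measureReal_nonneg
  have hw : 0 ≤ v⁻¹ := by positivity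
  refine ⟨2 * v⁻¹ * C₀ + C * (C₀ * 2 ^ s + 1) + 6 * Λ, by positivity, fun f hf n hn1 => ?_⟩
  have hx1 : (1 : ℝ) ≤ n := Nat.one_le_cast.2 hn1
  have hx0 : (0 : ℝ) < n := by linarith
  have hnt : 0 < (n : ℝ) ^ (-t) := by positivity
  rcases lt_or_ge n 32 with hn | hn
  · have h1 : survMass μ ν l σ f n ≤ Λ := survMass_le hW.measurable hf.measurable n
    have h2 : (1 : ℝ) ≤ 6 * (n : ℝ) ^ (-t) := by
      have h3 : (n : ℝ) ^ (-(1 / 2) : ℝ) ≤ (n : ℝ) ^ (-t) := rpow_le_rpow_of_le hx1 (by linarith)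
      have h4 : 1 / 6 ≤ (n : ℝ) ^ (-(1 / 2) : ℝ) := by
        rw [Real.rpow_neg hx0.le, ← Real.sqrt_eq_rpow, one_div]
        have h5 : √(n : ℝ) ≤ 6 := by
          rw [Real.sqrt_le_left (by norm_num)]
          have : (n : ℝ) ≤ 32 := by exact_mod_cast hn.le
          linarith
        have : 0 < √(n : ℝ) := Real.sqrt_pos.2 hx0
        gcongr
      linarith
    have h6 : 0 ≤ (2 * v⁻¹ * C₀ + C * (C₀ * 2 ^ s + 1)) * (n : ℝ) ^ (-t) := by positivity
    calc _ ≤ Λ * 1 := by rw [mul_one]; exact h1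
      _ ≤ Λ * (6 * (n : ℝ) ^ (-t)) := by gcongr
      _ ≤ _ := by linarith
  · have h1 := hest f hf _ (TwistHyp.one hW.one_le_A) n hn
    have hm1 := one_le_startTime hn1
    have h2 := hu f hf _ hm1
    have h3 := hsurv f hf _ hm1
    set m := startTime n
    have hm := startTime_le n
    have hm' := half_le_startTime hn1
    rw [← survMass_eq] at h1
    have h4 : 2 * v⁻¹ * (√n)⁻¹ * gaussDensity 0 * meanPos μ ν l σ f (fun _ => 1) m ≤
        2 * v⁻¹ * C₀ * (n : ℝ) ^ (-t) := by
      have e1 : (√(n : ℝ))⁻¹ = (n : ℝ) ^ (-(1 / 2) : ℝ) := by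
        rw [Real.sqrt_eq_rpow, Real.rpow_neg hx0.le]
      have e2 : (m : ℝ) ^ r ≤ (n : ℝ) ^ (3 / 5 * r) := by
        rw [Real.rpow_mul hx0.le]; gcongr
      calc _ ≤ 2 * v⁻¹ * (√n)⁻¹ * 1 * (C₀ * (n : ℝ) ^ (3 / 5 * r)) := by
            refine mul_le_mul_of_nonneg ?_ ((le_abs_self _).trans (h2.trans ?_))
              ?_ (by positivity)
            · gcongr
              exact gaussDensity_le_one 0
            · gcongr
            · have := gaussDensity_nonneg 0
              positivity
        _ = 2 * v⁻¹ * C₀ * ((n : ℝ) ^ (-(1 / 2) : ℝ) * (n : ℝ) ^ (3 / 5 * r)) := by rw [e1]; ring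
        _ ≤ _ := by
            rw [← Real.rpow_add hx0]
            gcongr
            linarith
    have h5 : (n : ℝ) ^ (-(6 / 25) : ℝ) * survMass μ ν l σ f m ≤ C₀ * 2 ^ s * (n : ℝ) ^ (-t) := by
      have e2 : (m : ℝ) ^ (-s) ≤ 2 ^ s * (n : ℝ) ^ (-(3 / 5 * s)) := by
        calc (m : ℝ) ^ (-s) ≤ ((n : ℝ) ^ (3 / 5 : ℝ) / 2) ^ (-s) :=
              Real.rpow_le_rpow_of_nonpos (by positivity) hm' (by linarith)
          _ = _ := by
              rw [Real.div_rpow (by positivity) (by norm_num), ← Real.rpow_mul hx0.le,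
                Real.rpow_neg (x := 2) (by norm_num), div_inv_eq_mul, mul_comm]
              ring_nf
      calc _ ≤ (n : ℝ) ^ (-(6 / 25) : ℝ) * (C₀ * (2 ^ s * (n : ℝ) ^ (-(3 / 5 * s)))) := by
            gcongr
            exact h3.trans (by gcongr)
        _ = C₀ * 2 ^ s * ((n : ℝ) ^ (-(6 / 25) : ℝ) * (n : ℝ) ^ (-(3 / 5 * s))) := by ring
        _ ≤ _ := by
            rw [← Real.rpow_add hx0]
            gcongr
            linarith
    have h6 : (n : ℝ) ^ (-(27 / 50) : ℝ) ≤ (n : ℝ) ^ (-t) := rpow_le_rpow_of_le hx1 (by linarith)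
    have h7 := (abs_le.1 h1).2
    have h8 : C * ((n : ℝ) ^ (-(6 / 25) : ℝ) * survMass μ ν l σ f m +
        (n : ℝ) ^ (-(27 / 50) : ℝ)) ≤ C * (C₀ * 2 ^ s * (n : ℝ) ^ (-t) + (n : ℝ) ^ (-t)) := by
      gcongr
    have h9 : 0 ≤ 6 * Λ * (n : ℝ) ^ (-t) := by positivity
    linarith

/-- The first rate, from the bound of order `√m` on the mean position and the trivial bound on the
mass of the survivors. -/
theorem exists_survMass_le_fifth (hW : WalkHyp μ ν σ a A) (hβ : 0 < β) (hv : 0 < v)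
    (happ : StrongApproximation μ σ v) (hl : TestMeasure l K c) :
    ∃ C : ℝ, 0 ≤ C ∧ ∀ f, PertHyp μ ν a β A f → ∀ n : ℕ, 1 ≤ n →
      survMass μ ν l σ f n ≤ C * (n : ℝ) ^ (-(1 / 5) : ℝ) := by
  obtain ⟨C, hC, hu⟩ := exists_abs_meanPos_le (β := β) hW hl
  have hΛ : 0 ≤ l.real Set.univ := measureReal_nonneg
  refine exists_survMass_le_of_meanPos_le hW hβ hv happ hl (C₀ := C + l.real Set.univ)
    (r := 1 / 2) (s := 0) (t := 1 / 5) (by positivity) le_rfl (by norm_num) (by norm_num)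
    (by norm_num) (by norm_num) (fun f hf m hm => ?_) (fun f hf m hm => ?_)
  · refine (hu f hf _ (TwistHyp.one hW.one_le_A) m hm).trans ?_
    rw [Real.sqrt_eq_rpow]
    gcongr
    linarith
  · rw [neg_zero, Real.rpow_zero, mul_one]
    exact (survMass_le hW.measurable hf.measurable m).trans (by linarith)

/-- The mean position is a Cauchy sequence, with a rate: it is almost constant on dyadic blocks. -/
theorem exists_abs_meanPos_sub_le (hW : WalkHyp μ ν σ a A) (hβ : 0 < β) (hv : 0 < v)
    (happ : StrongApproximation μ σ v) (hl : TestMeasure l K c) :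
    ∃ C : ℝ, 0 ≤ C ∧ ∀ f, PertHyp μ ν a β A f → ∀ θ, TwistHyp μ β A θ → ∀ M N : ℕ, 1 ≤ M → M ≤ N →
      |meanPos μ ν l σ f θ N - meanPos μ ν l σ f θ M| ≤ C * (M : ℝ) ^ (-(1 / 10) : ℝ) := by
  obtain ⟨C₅, hC₅, hsurv⟩ := exists_survMass_le_fifth (β := β) hW hβ hv happ hl
  have ha := hW.a_pos
  have hA1 := hW.one_le_A
  have hA := zero_le_one.trans hA1
  have hc := hl.c_nonneg
  obtain ⟨Ca, hCa, hexpa⟩ := exists_exp_neg_level_le ha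
  obtain ⟨Cb, hCb, hexpb⟩ := exists_exp_neg_rangeAt_le hβ
  set Λ := l.real Set.univ with hΛdef
  have hΛ : 0 ≤ Λ := measureReal_nonneg
  set C := A * 6 * (C₅ * 2 + Λ * (6 * (A * Ca)) / a) + Cb * (2 / a ^ 2 * A + A) *
    (Λ + A * c * 2) with hC
  have hC0 : 0 ≤ C := by positivity
  have h2 : (2 : ℝ) ^ (-(1 / 10) : ℝ) < 1 :=
    Real.rpow_lt_one_of_one_lt_of_neg (by norm_num) (by norm_num)
  refine ⟨C / (1 - 2 ^ (-(1 / 10) : ℝ)), div_nonneg hC0 (by linarith), fun f hf θ hθ =>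
    abs_sub_le_of_dyadic hC0 (by norm_num) fun M N hM hMN hN2 => ?_⟩
  set x : ℝ := (M : ℝ) with hx
  have hx1 : (1 : ℝ) ≤ x := Nat.one_le_cast.2 hM
  have hx0 : 0 < x := by linarith
  set p := rangeAt M with hp
  set L := x ^ (1 / 100 : ℝ) with hL
  have hL1 : 1 ≤ L := Real.one_le_rpow hx1 (by norm_num)
  have hpL : (p : ℝ) ≤ L / 2 := rangeAt_le M
  have hLx : L ≤ x := by
    calc L ≤ x ^ (1 : ℝ) := rpow_le_rpow_of_le hx1 (by norm_num)
      _ = x := Real.rpow_one x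
  have hpx : (p : ℝ) ≤ x / 2 := by linarith
  have h2p : 2 * p ≤ M := by
    have : (2 : ℝ) * p ≤ M := by linarith
    exact_mod_cast this
  have h1 := abs_meanPos_sub_le hW hf hθ hl (M := M) (N := N) (p := p) hM hMN (by omega) (L := L)
    (by linarith)
  refine h1.trans ?_
  have hNx : (N : ℝ) ≤ 2 * x := by rw [hx]; exact_mod_cast hN2
  have hE : Real.exp (-(a * L)) ≤ Ca * x ^ (-6 : ℝ) := hexpa M hM
  have hE' : Real.exp (-(β * p / 2)) ≤ Cb * x ^ (-6 : ℝ) := hexpb M hM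
  have hMp : ((M - p : ℕ) : ℝ) = x - p := by rw [Nat.cast_sub (by omega)]
  have e1 : survMass μ ν l σ f (M - p) ≤ C₅ * (2 * x ^ (-(1 / 5) : ℝ)) := by
    refine (hsurv f hf (M - p) (by omega)).trans ?_
    gcongr
    rw [hMp]
    calc (x - p) ^ (-(1 / 5) : ℝ) ≤ (x / 2) ^ (-(1 / 5) : ℝ) :=
          Real.rpow_le_rpow_of_nonpos (by positivity) (by linarith) (by norm_num)
      _ = 2 ^ (1 / 5 : ℝ) * x ^ (-(1 / 5) : ℝ) := by
          rw [Real.div_rpow hx0.le (by norm_num), Real.rpow_neg (x := 2) (by norm_num),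
            div_inv_eq_mul, mul_comm]
      _ ≤ 2 * x ^ (-(1 / 5) : ℝ) := by
          gcongr
          calc (2 : ℝ) ^ (1 / 5 : ℝ) ≤ 2 ^ (1 : ℝ) :=
                rpow_le_rpow_of_le (by norm_num) (by norm_num)
            _ = 2 := Real.rpow_one 2
  set h := x ^ (-(1 / 10) : ℝ) with hh
  have hh0 : 0 < h := by positivity
  have hNM : ((N - M : ℕ) : ℝ) ≤ x := by
    have : N - M ≤ M := by omega
    rw [hx]; exact_mod_cast this
  have e2 : L * (L * x ^ (-(1 / 5) : ℝ)) ≤ h := by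
    rw [hL, ← Real.rpow_add hx0, ← Real.rpow_add hx0]
    exact rpow_le_rpow_of_le hx1 (by norm_num)
  have e3 : x ^ (-6 : ℝ) * x ^ 2 ≤ h := by
    rw [← Real.rpow_natCast x 2, ← Real.rpow_add hx0]
    exact rpow_le_rpow_of_le hx1 (by norm_num)
  have p1 : A * (5 + p) * (L * survMass μ ν l σ f (M - p) +
        Λ * (2 * (N + 1) * (A * Real.exp (-(a * L)))) / a) ≤
      A * 6 * (C₅ * 2 + Λ * (6 * (A * Ca)) / a) * h := by
    calc _ ≤ A * (6 * L) * (L * (C₅ * (2 * x ^ (-(1 / 5) : ℝ))) +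
          Λ * (2 * (2 * x + x) * (A * (Ca * x ^ (-6 : ℝ)))) / a) := by
          have := survMass_nonneg (μ := μ) (ν := ν) (l := l) (σ := σ) (f := f) (M - p)
          gcongr
          linarith
      _ = A * 6 * (C₅ * 2 * (L * (L * x ^ (-(1 / 5) : ℝ))) +
          Λ * (6 * (A * Ca)) / a * (x ^ (-6 : ℝ) * (L * x))) := by ring
      _ ≤ A * 6 * (C₅ * 2 * h + Λ * (6 * (A * Ca)) / a * (x ^ (-6 : ℝ) * x ^ 2)) := by
          rw [sq]; gcongr
      _ ≤ A * 6 * (C₅ * 2 * h + Λ * (6 * (A * Ca)) / a * h) := by gcongr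
      _ = _ := by ring
  have p2 : (N - M : ℕ) * (Real.exp (-(β * p / 2)) * (2 / a ^ 2 * A + A) *
        (Λ + A * c * N)) ≤ Cb * (2 / a ^ 2 * A + A) * (Λ + A * c * 2) * h := by
    calc _ ≤ x * (Cb * x ^ (-6 : ℝ) * (2 / a ^ 2 * A + A) * (Λ * x + A * c * (2 * x))) := by
          gcongr
          exact le_mul_of_one_le_right hΛ hx1
      _ = Cb * (2 / a ^ 2 * A + A) * (Λ + A * c * 2) * (x ^ (-6 : ℝ) * x ^ 2) := by ring
      _ ≤ _ := by gcongr
  calc _ ≤ _ := add_le_add p1 p2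
    _ = _ := by rw [hC]; ring

/-- The mean positions converge. -/
theorem exists_tendsto_meanPos (hW : WalkHyp μ ν σ a A) (hβ : 0 < β) (hv : 0 < v)
    (happ : StrongApproximation μ σ v) (hl : TestMeasure l K c) (hf : PertHyp μ ν a β A f)
    (hθ : TwistHyp μ β A θ) : ∃ u, Tendsto (meanPos μ ν l σ f θ) atTop (𝓝 u) := by
  obtain ⟨C, hC, h⟩ := exists_abs_meanPos_sub_le (β := β) hW hβ hv happ hl
  have h0 : Tendsto (fun n : ℕ => 2 * (C * (n : ℝ) ^ (-(1 / 10) : ℝ))) atTop (𝓝 0) := by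
    have h1 := (tendsto_rpow_neg_atTop (y := 1 / 10) (by norm_num)).comp
      tendsto_natCast_atTop_atTop
    simpa using ((h1.const_mul C).const_mul 2)
  refine cauchySeq_tendsto_of_complete (Metric.cauchySeq_iff.2 fun ε hε => ?_)
  obtain ⟨n₀, hn₀⟩ := ((h0.eventually (gt_mem_nhds hε)).and (eventually_ge_atTop 1)).exists
  refine ⟨n₀, fun m hm n hn => ?_⟩
  rw [Real.dist_eq]
  have e1 := h f hf θ hθ n₀ m hn₀.2 hm
  have e2 := h f hf θ hθ n₀ n hn₀.2 hn
  have e3 := abs_sub_le (meanPos μ ν l σ f θ m) (meanPos μ ν l σ f θ n₀) (meanPos μ ν l σ f θ n)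
  rw [abs_sub_comm (meanPos μ ν l σ f θ n₀)] at e3
  linarith [hn₀.1]

theorem exists_meanPos_bounded (hW : WalkHyp μ ν σ a A) (hβ : 0 < β) (hv : 0 < v)
    (happ : StrongApproximation μ σ v) (hl : TestMeasure l K c) :
    ∃ C : ℝ, 0 ≤ C ∧ ∀ f, PertHyp μ ν a β A f → ∀ θ, TwistHyp μ β A θ → ∀ n : ℕ, 1 ≤ n →
      |meanPos μ ν l σ f θ n| ≤ C := by
  obtain ⟨C, hC, h⟩ := exists_abs_meanPos_sub_le (β := β) hW hβ hv happ hl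
  obtain ⟨C', hC', h'⟩ := exists_abs_meanPos_le (β := β) hW hl
  refine ⟨C + C', by positivity, fun f hf θ hθ n hn => ?_⟩
  have h1 := h f hf θ hθ 1 n le_rfl hn
  have h2 := h' f hf θ hθ 1 le_rfl
  rw [Nat.cast_one, Real.one_rpow, mul_one] at h1
  rw [Nat.cast_one, Real.sqrt_one, mul_one] at h2
  have h3 := abs_add_le (meanPos μ ν l σ f θ n - meanPos μ ν l σ f θ 1) (meanPos μ ν l σ f θ 1)
  rw [sub_add_cancel] at h3
  linarith

/-- The survival probability decays almost like `n ^ (-1/2)`: the mean position being bounded, the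
control of the survivors by the mean position improves any rate of decay. -/
theorem exists_survMass_le (hW : WalkHyp μ ν σ a A) (hβ : 0 < β) (hv : 0 < v)
    (happ : StrongApproximation μ σ v) (hl : TestMeasure l K c) :
    ∃ C : ℝ, 0 ≤ C ∧ ∀ f, PertHyp μ ν a β A f → ∀ n : ℕ, 1 ≤ n →
      survMass μ ν l σ f n ≤ C * (n : ℝ) ^ (-(57 / 125) : ℝ) := by
  obtain ⟨C₁, hC₁, h1⟩ := exists_survMass_le_fifth (β := β) hW hβ hv happ hl
  obtain ⟨C₀, hC₀, h0⟩ := exists_meanPos_bounded (β := β) hW hβ hv happ hl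
  have step {s t C₁ : ℝ} (hs : 0 ≤ s) (ht : t ≤ 1 / 2) (hts : t ≤ 6 / 25 + 3 / 5 * s)
      (hC₁ : 0 ≤ C₁) (h1 : ∀ f, PertHyp μ ν a β A f → ∀ n : ℕ, 1 ≤ n →
        survMass μ ν l σ f n ≤ C₁ * (n : ℝ) ^ (-s)) :=
    exists_survMass_le_of_meanPos_le hW hβ hv happ hl (C₀ := C₀ + C₁) (r := 0) (s := s) (t := t)
      (by positivity) hs ht (by linarith) hts le_rfl (fun f hf m hm => by
        rw [Real.rpow_zero, mul_one]
        linarith [h0 f hf _ (TwistHyp.one hW.one_le_A) m hm]) (fun f hf m hm =>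
        (h1 f hf m hm).trans (by gcongr; linarith))
  obtain ⟨C₂, hC₂, h2⟩ := step (t := 9 / 25) (by norm_num) (by norm_num) (by norm_num) hC₁ h1
  exact step (by norm_num) (by norm_num) (by norm_num) hC₂ h2

end MeanPosition

/-! ### The conditioned limit theorem for test measures -/

section Rayleigh

theorem integral_rayleigh {s : ℝ} (hs : 0 ≤ s) :
    ∫ r in (0 : ℝ)..s, rayleigh r = 1 - Real.exp (-s ^ 2 / 2) := by
  have h1 : ∀ r ∈ Set.uIcc 0 s, HasDerivAt (fun r : ℝ => -Real.exp (-r ^ 2 / 2)) (rayleigh r) r := by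
    intro r hr
    rw [Set.uIcc_of_le hs] at hr
    rw [rayleigh, if_pos hr.1]
    have h2 : HasDerivAt (fun r : ℝ => -r ^ 2 / 2) (-r) r := by
      refine ((hasDerivAt_pow 2 r).fun_neg.div_const 2).congr_deriv ?_
      norm_num
      ring
    have h3 := h2.exp.neg
    rwa [mul_neg, neg_neg, mul_comm] at h3
  rw [intervalIntegral.integral_eq_sub_of_hasDerivAt h1]
  · simp; ring
  · have : IntervalIntegrable (fun r : ℝ => r * Real.exp (-r ^ 2 / 2)) volume 0 s :=
      Continuous.intervalIntegrable (by fun_prop) _ _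
    refine this.congr (fun r hr => ?_)
    rw [Set.uIoc_of_le hs] at hr
    rw [rayleigh, if_pos hr.1.le]

end Rayleigh

section Conditioned

variable {G X : Type*} [Group G] [MulAction G X] [MeasurableSpace G] [MeasurableMul₂ G]
  [MeasurableSpace X] [MeasurableSMul₂ G X]
  {μ : Measure G} [IsProbabilityMeasure μ] {ν : Measure X} [IsProbabilityMeasure ν]
  {σ : G → X → ℝ} {a β A v : ℝ} {l : Measure ℝ} [IsFiniteMeasure l] {K c : ℝ}
  {f : ℕ → (ℕ → G) × X → ℝ} {θ : (ℕ → G) → ℝ}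

/-- The twisted mass of the survivors below a level is the twisted mass of all survivors, minus
that of the survivors above the level. Both are governed by the limit of the mean position. -/
theorem exists_conditioned_estimate (hW : WalkHyp μ ν σ a A) (hβ : 0 < β) (hv : 0 < v)
    (happ : StrongApproximation μ σ v) (hl : TestMeasure l K c) {b₀ : ℝ} (hb₀ : 0 ≤ b₀) :
    ∃ C : ℝ, 0 ≤ C ∧ ∀ f, PertHyp μ ν a β A f → ∀ θ, TwistHyp μ β A θ → ∀ n : ℕ, 32 ≤ n →
      ∀ b ≤ b₀, ∀ u, Tendsto (meanPos μ ν l σ f θ) atTop (𝓝 u) →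
      |v * √(2 * Real.pi * n) / 2 * ∫ w, θ w.1.1 * (1 - tailInd σ n (b * v * √n) w) *
          aliveInd σ f n w ∂(fullLaw μ ν l) - u * (1 - Real.exp (-(max b 0) ^ 2 / 2))| ≤
        C * (n : ℝ) ^ (-(1 / 100) : ℝ) := by
  obtain ⟨C₁, hC₁, h1⟩ := exists_tailMass_estimate (β := β) hW hβ hv happ hl hb₀
  obtain ⟨C₂, hC₂, h2⟩ := exists_twistedMass_estimate (β := β) hW hβ hv happ hl
  obtain ⟨C₃, hC₃, h3⟩ := exists_survMass_le (β := β) hW hβ hv happ hl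
  obtain ⟨C₄, hC₄, h4⟩ := exists_abs_meanPos_sub_le (β := β) hW hβ hv happ hl
  have hπ : 0 < √(2 * Real.pi) := Real.sqrt_pos.2 (by positivity)
  refine ⟨v * √(2 * Real.pi) / 2 * ((C₁ + C₂) * (C₃ * 2 + 1)) + C₄ * 2, by positivity,
    fun f hf θ hθ n hn b hb u hu => ?_⟩
  have hn1 : 1 ≤ n := by omega
  have hx1 : (1 : ℝ) ≤ n := Nat.one_le_cast.2 hn1
  have hx0 : (0 : ℝ) < n := by linarith
  have hsq0 : 0 < √(n : ℝ) := Real.sqrt_pos.2 hx0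
  have hsq : √(n : ℝ) = (n : ℝ) ^ (1 / 2 : ℝ) := Real.sqrt_eq_rpow _
  have e1 := h1 f hf θ hθ n hn b hb
  have e2 := h2 f hf θ hθ n hn
  have hm1 := one_le_startTime hn1
  have hm := half_le_startTime hn1
  set m := startTime n with hmdef
  have hpow (r : ℝ) (hr0 : 0 ≤ r) (hr1 : r ≤ 1) :
      (m : ℝ) ^ (-r) ≤ 2 * (n : ℝ) ^ (-(3 / 5 * r)) := by
    calc (m : ℝ) ^ (-r) ≤ ((n : ℝ) ^ (3 / 5 : ℝ) / 2) ^ (-r) :=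
          Real.rpow_le_rpow_of_nonpos (by positivity) hm (by linarith)
      _ = 2 ^ r * (n : ℝ) ^ (-(3 / 5 * r)) := by
          rw [Real.div_rpow (by positivity) (by norm_num), ← Real.rpow_mul hx0.le,
            Real.rpow_neg (x := 2) (by norm_num), div_inv_eq_mul, mul_comm]
          ring_nf
      _ ≤ 2 * (n : ℝ) ^ (-(3 / 5 * r)) := by
          gcongr
          calc (2 : ℝ) ^ r ≤ 2 ^ (1 : ℝ) := rpow_le_rpow_of_le (by norm_num) hr1
            _ = 2 := Real.rpow_one 2
  set g := (n : ℝ) ^ (-(1 / 100) : ℝ) with hg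
  -- the mean position at time `m` is close to its limit
  have e4 : |meanPos μ ν l σ f θ m - u| ≤ C₄ * 2 * g := by
    have := (hu.sub_const (meanPos μ ν l σ f θ m)).abs
    have h5 := le_of_tendsto this ((eventually_ge_atTop m).mono fun N hN => h4 f hf θ hθ m N hm1 hN)
    rw [abs_sub_comm]
    refine h5.trans ?_
    rw [mul_assoc]
    refine mul_le_mul_of_nonneg_left ((hpow (1 / 10) (by norm_num) (by norm_num)).trans ?_) hC₄
    refine mul_le_mul_of_nonneg_left (rpow_le_rpow_of_le hx1 ?_) zero_le_two
    norm_num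
  have e3 : √(n : ℝ) * ((n : ℝ) ^ (-(6 / 25) : ℝ) * survMass μ ν l σ f m +
      (n : ℝ) ^ (-(27 / 50) : ℝ)) ≤ (C₃ * 2 + 1) * g := by
    calc _ ≤ √(n : ℝ) * ((n : ℝ) ^ (-(6 / 25) : ℝ) *
          (C₃ * (2 * (n : ℝ) ^ (-(3 / 5 * (57 / 125)) : ℝ))) + (n : ℝ) ^ (-(27 / 50) : ℝ)) := by
          gcongr
          refine (h3 f hf m hm1).trans ?_
          exact mul_le_mul_of_nonneg_left (hpow _ (by norm_num) (by norm_num)) hC₃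
      _ = C₃ * 2 * ((n : ℝ) ^ (1 / 2 : ℝ) * ((n : ℝ) ^ (-(6 / 25) : ℝ) *
          (n : ℝ) ^ (-(3 / 5 * (57 / 125)) : ℝ))) +
          (n : ℝ) ^ (1 / 2 : ℝ) * (n : ℝ) ^ (-(27 / 50) : ℝ) := by rw [hsq]; ring
      _ ≤ C₃ * 2 * g + g := by
          rw [← Real.rpow_add hx0, ← Real.rpow_add hx0, ← Real.rpow_add hx0]
          have k1 : (n : ℝ) ^ (1 / 2 + (-(6 / 25) + -(3 / 5 * (57 / 125))) : ℝ) ≤ g :=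
            rpow_le_rpow_of_le hx1 (by norm_num)
          have k2 : (n : ℝ) ^ (1 / 2 + -(27 / 50) : ℝ) ≤ g :=
            rpow_le_rpow_of_le hx1 (by norm_num)
          gcongr
      _ = _ := by ring
  set E := (n : ℝ) ^ (-(6 / 25) : ℝ) * survMass μ ν l σ f m + (n : ℝ) ^ (-(27 / 50) : ℝ) with hE
  have i1 : Integrable (fun w => θ w.1.1 * 1 * aliveInd σ f n w) (fullLaw μ ν l) :=
    integrable_mul_mul hW hf hθ.measurable hθ.abs_le (integrable_const 1) n
  have i2 : Integrable (fun w => θ w.1.1 * tailInd σ n (b * v * √n) w * aliveInd σ f n w)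
      (fullLaw μ ν l) :=
    integrable_mul_mul hW hf hθ.measurable hθ.abs_le ((integrable_const 1).indicator
      (measurableSet_tail hW.measurable _ _)) _
  have hsplit : ∫ w, θ w.1.1 * (1 - tailInd σ n (b * v * √n) w) * aliveInd σ f n w
      ∂(fullLaw μ ν l) = ∫ w, θ w.1.1 * 1 * aliveInd σ f n w ∂(fullLaw μ ν l) -
        tailMass μ ν l σ f θ n (b * v * √n) := by
    rw [tailMass, ← integral_sub i1 i2]
    exact integral_congr_ae (Eventually.of_forall fun w => by ring)
  rw [hsplit]
  set T := ∫ w, θ w.1.1 * 1 * aliveInd σ f n w ∂(fullLaw μ ν l)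
  set T' := tailMass μ ν l σ f θ n (b * v * √n)
  set um := meanPos μ ν l σ f θ m
  have hr : √(2 * Real.pi * n) = √(2 * Real.pi) * √n := Real.sqrt_mul (by positivity) _
  -- the normalisation turns the Gaussian density into the survival function of the Rayleigh law
  have hnorm (s : ℝ) : v * √(2 * Real.pi * n) / 2 * (2 * v⁻¹ * (√n)⁻¹ * gaussDensity s * um) =
      Real.exp (-s ^ 2 / 2) * um := by
    rw [hr, gaussDensity]; field_simp
  set ρ := Real.exp (-(max b 0) ^ 2 / 2) with hρ
  have hρ0 : 0 ≤ ρ := (Real.exp_pos _).le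
  have hρ1 : ρ ≤ 1 := Real.exp_le_one_iff.2 (by
    have := sq_nonneg (max b 0); linarith)
  have e5 : |v * √(2 * Real.pi * n) / 2 * (T - T') - (1 - ρ) * um| ≤
      v * √(2 * Real.pi * n) / 2 * ((C₁ + C₂) * E) := by
    have k0 := hnorm 0
    have k1 := hnorm (max b 0)
    rw [show -(0 : ℝ) ^ 2 / 2 = 0 by norm_num, Real.exp_zero, one_mul] at k0
    rw [← hρ] at k1
    have k2 : v * √(2 * Real.pi * n) / 2 * (T - T') - (1 - ρ) * um =
        v * √(2 * Real.pi * n) / 2 * ((T - 2 * v⁻¹ * (√n)⁻¹ * gaussDensity 0 * um) -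
          (T' - 2 * v⁻¹ * (√n)⁻¹ * gaussDensity (max b 0) * um)) := by
      rw [mul_sub, mul_sub, mul_sub, mul_sub, k0, k1]; ring
    rw [k2, abs_mul, abs_of_nonneg (by positivity : 0 ≤ v * √(2 * Real.pi * n) / 2)]
    refine mul_le_mul_of_nonneg_left ((abs_sub _ _).trans ?_) (by positivity)
    linarith
  have e6 : v * √(2 * Real.pi * n) / 2 * ((C₁ + C₂) * E) ≤
      v * √(2 * Real.pi) / 2 * ((C₁ + C₂) * (C₃ * 2 + 1)) * g := by
    calc _ = v * √(2 * Real.pi) / 2 * ((C₁ + C₂) * (√n * E)) := by rw [hr]; ring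
      _ ≤ v * √(2 * Real.pi) / 2 * ((C₁ + C₂) * ((C₃ * 2 + 1) * g)) := by gcongr
      _ = _ := by ring
  have e7 : |(1 - ρ) * um - u * (1 - ρ)| ≤ C₄ * 2 * g := by
    rw [mul_comm u, ← mul_sub, abs_mul, abs_of_nonneg (by linarith)]
    exact (mul_le_of_le_one_left (abs_nonneg _) (by linarith)).trans e4
  calc _ ≤ _ := abs_sub_le _ ((1 - ρ) * um) _
    _ ≤ _ := add_le_add (e5.trans e6) e7
    _ = _ := by ring

end Conditioned

/-! ### Limits of monotone functions -/

section MonotoneLimit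

/-- Non-negative monotone functions whose integrals over all compact intervals converge have a
monotone limit, outside of the discontinuities of the latter. -/
theorem exists_monotone_limit {V : ℕ → ℝ → ℝ} (hmono : ∀ n, Monotone (V n))
    (hnn : ∀ n t, 0 ≤ V n t)
    (hconv : ∀ s e : ℝ, s < e → ∃ J, Tendsto (fun n => ∫ t in Set.Icc s e, V n t) atTop (𝓝 J)) :
    ∃ U : ℝ → ℝ, Monotone U ∧ (∀ t, 0 ≤ U t) ∧ ∀ ψ : ℝ → ℝ, Continuous ψ → HasCompactSupport ψ →
      Tendsto (fun n => ∫ t, V n t * ψ t) atTop (𝓝 (∫ t, U t * ψ t)) := by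
  have hint (n : ℕ) (s e : ℝ) : IntegrableOn (V n) (Set.Icc s e) := by
    by_cases hse : s ≤ e
    · exact (hmono n).monotoneOn _ |>.integrableOn_of_measure_ne_top (a := s) (b := e)
        ⟨⟨le_rfl, hse⟩, fun x hx => hx.1⟩ ⟨⟨hse, le_rfl⟩, fun x hx => hx.2⟩
        measure_Icc_lt_top.ne measurableSet_Icc
    · rw [Set.Icc_eq_empty hse]; exact integrableOn_empty
  have hlow (n : ℕ) {s e : ℝ} (hse : s < e) : V n s * (e - s) ≤ ∫ t in Set.Icc s e, V n t := by
    have := setIntegral_mono_on (μ := volume) (integrableOn_const (C := V n s)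
      (measure_Icc_lt_top (a := s) (b := e)).ne) (hint n s e) measurableSet_Icc
      fun t ht => hmono n ht.1
    rwa [setIntegral_const, Real.volume_real_Icc_of_le hse.le, smul_eq_mul, mul_comm] at this
  have hhigh (n : ℕ) {s e : ℝ} (hse : s < e) : ∫ t in Set.Icc s e, V n t ≤ V n e * (e - s) := by
    have := setIntegral_mono_on (μ := volume) (hint n s e) (integrableOn_const (C := V n e)
      (measure_Icc_lt_top (a := s) (b := e)).ne) measurableSet_Icc
      fun t ht => hmono n ht.2
    rwa [setIntegral_const, Real.volume_real_Icc_of_le hse.le, smul_eq_mul, mul_comm] at this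
  have hbd (t : ℝ) : ∃ M, ∀ n, V n t ≤ M := by
    obtain ⟨J, hJ⟩ := hconv t (t + 1) (by linarith)
    obtain ⟨M, hM⟩ := hJ.bddAbove_range
    refine ⟨M, fun n => ?_⟩
    have h1 := hlow n (s := t) (e := t + 1) (by linarith)
    have h2 := hM ⟨n, rfl⟩
    simp only [add_sub_cancel_left, mul_one] at h1
    exact h1.trans h2
  have hub (t : ℝ) : IsBoundedUnder (· ≤ ·) atTop fun n => V n t := by
    obtain ⟨M, hM⟩ := hbd t
    exact isBoundedUnder_of ⟨M, hM⟩
  have hlb (t : ℝ) : IsBoundedUnder (· ≥ ·) atTop fun n => V n t := isBoundedUnder_of ⟨0, fun n => hnn n t⟩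
  set U : ℝ → ℝ := fun t => limsup (fun n => V n t) atTop with hU
  set W : ℝ → ℝ := fun t => liminf (fun n => V n t) atTop with hW
  have hUm : Monotone U := fun s t hst => limsup_le_limsup
    (Eventually.of_forall fun n => hmono n hst) (hlb s).isCoboundedUnder_le (hub t)
  have hWm : Monotone W := fun s t hst => liminf_le_liminf
    (Eventually.of_forall fun n => hmono n hst) (hlb s) (hub t).isCoboundedUnder_ge
  have hWU (t : ℝ) : W t ≤ U t := liminf_le_limsup (hub t) (hlb t)
  have hUnn (t : ℝ) : 0 ≤ U t := by
    refine le_trans ?_ (hWU t)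
    exact le_liminf_of_le (hub t).isCoboundedUnder_ge (Eventually.of_forall fun n => hnn n t)
  -- the mean over `[s, e]` separates the upper limit at `s` and the lower limit at `e`
  have hUW {s e : ℝ} (hse : s < e) : U s ≤ W e := by
    obtain ⟨J, hJ⟩ := hconv s e hse
    have hpos : 0 < e - s := by linarith
    have hJ' := hJ.div_const (e - s)
    have h1 : U s ≤ J / (e - s) := by
      rw [← hJ'.limsup_eq]
      refine limsup_le_limsup (Eventually.of_forall fun n => ?_) (hlb s).isCoboundedUnder_le
        hJ'.isBoundedUnder_le
      simp only [le_div_iff₀ hpos]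
      exact hlow n hse
    have h2 : J / (e - s) ≤ W e := by
      rw [← hJ'.liminf_eq]
      refine liminf_le_liminf (Eventually.of_forall fun n => ?_) hJ'.isBoundedUnder_ge
        (hub e).isCoboundedUnder_ge
      simp only [div_le_iff₀ hpos]
      exact hhigh n hse
    exact h1.trans h2
  have hae : ∀ᵐ t, Tendsto (fun n => V n t) atTop (𝓝 (U t)) := by
    have hcount : ∀ᵐ t : ℝ, ContinuousAt W t :=
      hWm.countable_not_continuousAt.ae_notMem volume |>.mono fun t ht => by
        by_contra h; exact ht h
    filter_upwards [hcount] with t ht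
    have h1 : U t ≤ W t := by
      refine ge_of_tendsto (ht.tendsto.mono_left nhdsWithin_le_nhds : Tendsto W (𝓝[>] t) _) ?_
      filter_upwards [self_mem_nhdsWithin] with s hs
      exact hUW hs
    exact tendsto_of_liminf_eq_limsup (le_antisymm (hWU t) h1) rfl (hub t) (hlb t)
  refine ⟨U, hUm, hUnn, fun ψ hψ hψc => ?_⟩
  obtain ⟨K, hK⟩ := hψc.isCompact.isBounded.subset_closedBall 0
  obtain ⟨M, hM⟩ := hbd K
  refine tendsto_integral_of_dominated_convergence (fun t => M * |ψ t|)
    (fun n => ((hmono n).measurable.mul hψ.measurable).aestronglyMeasurable)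
    (((hψ.integrable_of_hasCompactSupport hψc).abs).const_mul M) (fun n => ?_) ?_
  · refine Eventually.of_forall fun t => ?_
    rw [norm_mul, Real.norm_eq_abs, Real.norm_eq_abs, abs_of_nonneg (hnn n t)]
    by_cases ht : ψ t = 0
    · simp [ht]
    · have h1 := hK (subset_tsupport ψ ht)
      rw [Metric.mem_closedBall, Real.dist_eq, sub_zero] at h1
      gcongr
      exact (hmono n ((le_abs_self t).trans h1)).trans (hM n)
  · filter_upwards [hae] with t ht
    exact ht.mul_const _

end MonotoneLimit

/-! ### Test measures -/

section TestMeasures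

theorem testMeasure_restrict_Icc (s e : ℝ) :
    TestMeasure (volume.restrict (Set.Icc s e)) (max |s| |e|) 1 where
  le t := by rw [ENNReal.ofReal_one, one_mul]; exact Measure.restrict_apply_le _ _
  supp := by
    filter_upwards [ae_restrict_mem measurableSet_Icc] with t ht
    exact abs_le_max_abs_abs ht.1 ht.2
  K_nonneg := (abs_nonneg _).trans (le_max_left _ _)
  c_nonneg := zero_le_one

/-- The measure of density `ψ⁺`. -/
noncomputable def densityMeasure (ψ : ℝ → ℝ) : Measure ℝ :=
  volume.withDensity fun t => ENNReal.ofReal (ψ t)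

variable {ψ : ℝ → ℝ}

theorem exists_testMeasure_densityMeasure (hψ : Continuous ψ) (hc : HasCompactSupport ψ) :
    ∃ K c, TestMeasure (densityMeasure ψ) K c := by
  obtain ⟨K, hK⟩ := hc.isCompact.isBounded.subset_closedBall 0
  obtain ⟨c, hc⟩ := hc.exists_bound_of_continuous hψ
  refine ⟨max K 0, max c 0, fun s => ?_, ?_, le_max_right _ _, le_max_right _ _⟩
  · have h1 : densityMeasure ψ ≤ ENNReal.ofReal (max c 0) • volume := by
      rw [← withDensity_const]
      refine withDensity_mono (Eventually.of_forall fun t => ENNReal.ofReal_le_ofReal ?_)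
      exact ((le_abs_self _).trans (hc t)).trans (le_max_left _ _)
    simpa using h1 s
  · rw [densityMeasure, ae_withDensity_iff hψ.measurable.ennreal_ofReal]
    refine Eventually.of_forall fun t ht => ?_
    have : ψ t ≠ 0 := fun h => ht (by rw [h, ENNReal.ofReal_zero])
    have h1 := hK (subset_tsupport ψ this)
    rw [Metric.mem_closedBall, Real.dist_eq, sub_zero] at h1
    exact h1.trans (le_max_left _ _)

theorem isFiniteMeasure_densityMeasure (hψ : Continuous ψ) (hc : HasCompactSupport ψ) :
    IsFiniteMeasure (densityMeasure ψ) :=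
  isFiniteMeasure_withDensity_ofReal (hψ.integrable_of_hasCompactSupport hc).2

theorem integral_densityMeasure (hψ : Continuous ψ) (g : ℝ → ℝ) :
    ∫ t, g t ∂(densityMeasure ψ) = ∫ t, g t * max (ψ t) 0 := by
  rw [densityMeasure, integral_withDensity_eq_integral_toReal_smul hψ.measurable.ennreal_ofReal
    (Eventually.of_forall fun _ => ENNReal.ofReal_lt_top)]
  refine integral_congr_ae (Eventually.of_forall fun t => ?_)
  simp only [ENNReal.toReal_ofReal', smul_eq_mul]
  ring

theorem integrable_densityMeasure_iff (hψ : Continuous ψ) {g : ℝ → ℝ} :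
    Integrable g (densityMeasure ψ) ↔ Integrable (fun t => g t * max (ψ t) 0) := by
  rw [densityMeasure, integrable_withDensity_iff hψ.measurable.ennreal_ofReal
    (Eventually.of_forall fun _ => ENNReal.ofReal_lt_top)]
  simp only [ENNReal.toReal_ofReal']

/-- Integration against a function, as a difference of integrations against measures. -/
theorem integral_mul_eq_sub (hψ : Continuous ψ) {g : ℝ → ℝ} (h1 : Integrable g (densityMeasure ψ))
    (h2 : Integrable g (densityMeasure fun t => -ψ t)) :
    ∫ t, g t * ψ t = ∫ t, g t ∂(densityMeasure ψ) - ∫ t, g t ∂(densityMeasure fun t => -ψ t) := by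
  rw [integral_densityMeasure hψ, integral_densityMeasure (ψ := fun t => -ψ t) hψ.neg, ← integral_sub
    ((integrable_densityMeasure_iff hψ).1 h1) ((integrable_densityMeasure_iff (ψ := fun t => -ψ t) hψ.neg).1 h2)]
  refine integral_congr_ae (Eventually.of_forall fun t => ?_)
  beta_reduce
  rw [← mul_sub, max_zero_sub_max_neg_zero_eq_self]

end TestMeasures

/-! ### The iterated integrals of the statement -/

section Fubini

variable {G X : Type*} [Group G] [MulAction G X] [MeasurableSpace G] [MeasurableMul₂ G]
  [MeasurableSpace X] [MeasurableSMul₂ G X]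
  {μ : Measure G} [IsProbabilityMeasure μ] {ν : Measure X} [IsProbabilityMeasure ν]
  {σ : G → X → ℝ} {a β A v : ℝ} {l : Measure ℝ} [IsFiniteMeasure l] {K c : ℝ}
  {f : ℕ → (ℕ → G) × X → ℝ} {θ : (ℕ → G) → ℝ}

theorem preLimit_congr {θ θ' : (ℕ → G) → ℝ} (h : θ =ᵐ[pathLaw μ] θ') :
    preLimit μ ν σ f θ = preLimit μ ν σ f θ' := by
  ext n t
  refine integral_congr_ae (Eventually.of_forall fun x => integral_congr_ae (ae_restrict_of_ae ?_))
  filter_upwards [h] with ω hω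
  rw [hω]

theorem scaledConditioned_congr {θ θ' : (ℕ → G) → ℝ} (h : θ =ᵐ[pathLaw μ] θ') (φ : ℝ → ℝ) (b : ℝ)
    (n : ℕ) : scaledConditioned μ ν σ v f θ φ b n = scaledConditioned μ ν σ v f θ' φ b n := by
  have (s : Set (ℕ → G)) : ∫ ω in s, θ ω ∂(pathLaw μ) = ∫ ω in s, θ' ω ∂(pathLaw μ) :=
    integral_congr_ae (ae_restrict_of_ae h)
  simp only [scaledConditioned, this]

theorem integrable_slice (hW : WalkHyp μ ν σ a A) (hf : PertHyp μ ν a β A f)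
    (hθ : TwistHyp μ β A θ) (n : ℕ) (t : ℝ) :
    Integrable (fun z : (ℕ → G) × X => θ z.1 * (t + disp σ f n z) * aliveInd σ f n (z, t))
      ((pathLaw μ).prod ν) := by
  have hi : Integrable (fun z : (ℕ → G) × X => t + disp σ f n z) ((pathLaw μ).prod ν) :=
    (integrable_const t).add (hf.integrable_disp hW n)
  refine (hi.norm.const_mul A).mono' ?_ (Eventually.of_forall fun z => ?_)
  · exact (((hθ.measurable.comp measurable_fst).mul
      ((measurable_disp hW.measurable hf.measurable n).const_add t)).mul
      ((measurable_aliveInd hW.measurable hf.measurable n).comp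
        (measurable_id.prodMk measurable_const))).aestronglyMeasurable
  · rw [norm_mul, norm_mul]
    have hA := zero_le_one.trans hW.one_le_A
    calc _ ≤ A * ‖t + disp σ f n z‖ * 1 := by
          gcongr
          · exact hθ.abs_le _
          · rw [Real.norm_eq_abs, abs_of_nonneg (aliveInd_nonneg _ _ _ _)]
            exact aliveInd_le_one _ _ _ _
      _ = _ := mul_one _

theorem measurableSet_alive_slice (hW : WalkHyp μ ν σ a A) (hf : ∀ n, Measurable (f n)) (n : ℕ)
    (x : X) (t : ℝ) : MeasurableSet {ω : ℕ → G | ((ω, x), t) ∈ alive σ f n} :=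
  (measurableSet_alive hW.measurable hf n).preimage
    ((measurable_id.prodMk measurable_const).prodMk measurable_const)

theorem preLimit_eq (hW : WalkHyp μ ν σ a A) (hf : PertHyp μ ν a β A f)
    (hθ : TwistHyp μ β A θ) (n : ℕ) (t : ℝ) : preLimit μ ν σ f θ n t =
      ∫ z, θ z.1 * (t + disp σ f n z) * aliveInd σ f n (z, t) ∂((pathLaw μ).prod ν) := by
  rw [integral_prod_symm _ (integrable_slice hW hf hθ n t), preLimit]
  refine integral_congr_ae (Eventually.of_forall fun x => ?_)
  simp only [lt_exitTime_iff]
  rw [← integral_indicator (measurableSet_alive_slice hW hf.measurable n x t)]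
  refine integral_congr_ae (Eventually.of_forall fun ω => ?_)
  by_cases h : ((ω, x), t) ∈ alive σ f n
  · simp only
    rw [Set.indicator_of_mem (by exact h), aliveInd_of_mem h, pertWalk_eq]; ring
  · simp only
    rw [Set.indicator_of_notMem (by exact h), aliveInd_of_notMem h, mul_zero]

theorem integrable_meanPos (hW : WalkHyp μ ν σ a A) (hf : PertHyp μ ν a β A f)
    (hθ : TwistHyp μ β A θ) (hl : TestMeasure l K c) (n : ℕ) :
    Integrable (fun w => θ w.1.1 * (w.2 + disp σ f n w.1) * aliveInd σ f n w) (fullLaw μ ν l) :=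
  integrable_mul_mul hW hf hθ.measurable hθ.abs_le (integrable_position hW hf hl n) n

theorem integrable_preLimit (hW : WalkHyp μ ν σ a A) (hf : PertHyp μ ν a β A f)
    (hθ : TwistHyp μ β A θ) (hl : TestMeasure l K c) (n : ℕ) :
    Integrable (preLimit μ ν σ f θ n) l := by
  have := (integrable_meanPos hW hf hθ hl n).integral_prod_right
  exact this.congr (Eventually.of_forall fun t => (preLimit_eq hW hf hθ n t).symm)

theorem meanPos_eq (hW : WalkHyp μ ν σ a A) (hf : PertHyp μ ν a β A f)
    (hθ : TwistHyp μ β A θ) (hl : TestMeasure l K c) (n : ℕ) :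
    meanPos μ ν l σ f θ n = ∫ t, preLimit μ ν σ f θ n t ∂l := by
  rw [meanPos, integral_prod_symm _ (integrable_meanPos hW hf hθ hl n)]
  exact integral_congr_ae (Eventually.of_forall fun t => (preLimit_eq hW hf hθ n t).symm)

theorem position_nonneg {n : ℕ} (hn : 1 ≤ n) (z : (ℕ → G) × X) (t : ℝ) :
    0 ≤ (t + disp σ f n z) * aliveInd σ f n (z, t) := by
  by_cases h : (z, t) ∈ alive σ f n
  · rw [aliveInd_of_mem h, mul_one]; exact h n hn le_rfl
  · rw [aliveInd_of_notMem h, mul_zero]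

theorem preLimit_nonneg (hW : WalkHyp μ ν σ a A) (hf : PertHyp μ ν a β A f)
    (hθ : TwistHyp μ β A θ) {n : ℕ} (hn : 1 ≤ n) (t : ℝ) : 0 ≤ preLimit μ ν σ f θ n t := by
  rw [preLimit_eq hW hf hθ]
  refine integral_nonneg fun z => ?_
  simp only [mul_assoc]
  exact mul_nonneg (hθ.nonneg _) (position_nonneg hn z t)

theorem preLimit_mono (hW : WalkHyp μ ν σ a A) (hf : PertHyp μ ν a β A f)
    (hθ : TwistHyp μ β A θ) {n : ℕ} (hn : 1 ≤ n) : Monotone (preLimit μ ν σ f θ n) := by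
  intro s t hst
  rw [preLimit_eq hW hf hθ, preLimit_eq hW hf hθ]
  refine integral_mono (integrable_slice hW hf hθ n s) (integrable_slice hW hf hθ n t) fun z => ?_
  simp only [mul_assoc]
  refine mul_le_mul_of_nonneg_left ?_ (hθ.nonneg _)
  by_cases h : (z, s) ∈ alive σ f n
  · have h' : (z, t) ∈ alive σ f n := fun k hk1 hk2 => by
      have := h k hk1 hk2
      simp only at this ⊢
      linarith
    rw [aliveInd_of_mem h, aliveInd_of_mem h']
    linarith
  · rw [aliveInd_of_notMem h, mul_zero]
    exact position_nonneg hn z t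

/-- The order of integration: first the path, then the level, then the starting point. -/
theorem integral_fullLaw_eq {H : ((ℕ → G) × X) × ℝ → ℝ} (hH : Measurable H) {M : ℝ}
    (hM : ∀ w, |H w| ≤ M) :
    Integrable (fun x => ∫ t, ∫ ω, H ((ω, x), t) ∂(pathLaw μ) ∂l) ν ∧
    ∫ w, H w ∂(fullLaw μ ν l) = ∫ x, ∫ t, ∫ ω, H ((ω, x), t) ∂(pathLaw μ) ∂l ∂ν := by
  have hi : Integrable H (fullLaw μ ν l) :=
    Integrable.of_bound hH.aestronglyMeasurable M (Eventually.of_forall hM)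
  have hslice (t : ℝ) : Integrable (fun z => H (z, t)) ((pathLaw μ).prod ν) :=
    Integrable.of_bound (hH.comp (measurable_id.prodMk measurable_const)).aestronglyMeasurable M
      (Eventually.of_forall fun z => hM _)
  have hm : StronglyMeasurable fun u : ℝ × X => ∫ ω, H ((ω, u.2), u.1) ∂(pathLaw μ) := by
    refine StronglyMeasurable.integral_prod_right (f := fun (u : ℝ × X) (ω : ℕ → G) =>
      H ((ω, u.2), u.1)) ?_
    exact (hH.comp ((measurable_snd.prodMk (measurable_snd.comp measurable_fst)).prodMk
      (measurable_fst.comp measurable_fst))).stronglyMeasurable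
  have hj : Integrable (fun u : ℝ × X => ∫ ω, H ((ω, u.2), u.1) ∂(pathLaw μ)) (l.prod ν) := by
    refine Integrable.of_bound hm.aestronglyMeasurable M (Eventually.of_forall fun u => ?_)
    refine (norm_integral_le_of_norm_le_const (Eventually.of_forall fun ω => hM _)).trans ?_
    simp
  refine ⟨hj.integral_prod_right, ?_⟩
  rw [integral_prod_symm _ hi, ← integral_integral_swap (f := fun t x => ∫ ω, H ((ω, x), t)
    ∂(pathLaw μ)) hj]
  refine integral_congr_ae (Eventually.of_forall fun t => ?_)
  exact integral_prod_symm _ (hslice t)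

theorem scaledConditioned_eq (hW : WalkHyp μ ν σ a A) (hf : PertHyp μ ν a β A f)
    (hθ : TwistHyp μ β A θ) (hv : 0 < v) {φ : ℝ → ℝ} (hφ : Continuous φ)
    (hφc : HasCompactSupport φ) (b : ℝ) {n : ℕ} (hn : 1 ≤ n) :
    scaledConditioned μ ν σ v f θ φ b n =
      v * √(2 * Real.pi * n) / 2 * ∫ w, θ w.1.1 * (1 - tailInd σ n (b * v * √n) w) *
          aliveInd σ f n w ∂(fullLaw μ ν (densityMeasure φ)) -
      v * √(2 * Real.pi * n) / 2 * ∫ w, θ w.1.1 * (1 - tailInd σ n (b * v * √n) w) *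
          aliveInd σ f n w ∂(fullLaw μ ν (densityMeasure fun t => -φ t)) := by
  have := isFiniteMeasure_densityMeasure hφ hφc
  have := isFiniteMeasure_densityMeasure hφ.neg hφc.neg
  have hA := zero_le_one.trans hW.one_le_A
  set H : ((ℕ → G) × X) × ℝ → ℝ := fun w => θ w.1.1 * (1 - tailInd σ n (b * v * √n) w) *
    aliveInd σ f n w with hHdef
  have hH : Measurable H := ((hθ.measurable.comp (measurable_fst.comp measurable_fst)).mul
    ((measurable_tailInd hW.measurable n _).const_sub 1)).mul
    (measurable_aliveInd hW.measurable hf.measurable n)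
  have hM (w) : |H w| ≤ A := by
    have t0 := tailInd_nonneg σ n (b * v * √n) w
    have t1 := tailInd_le_one σ n (b * v * √n) w
    rw [hHdef, abs_mul, abs_mul, abs_of_nonneg (sub_nonneg.2 t1),
      abs_of_nonneg (aliveInd_nonneg _ _ _ _)]
    calc _ ≤ A * 1 * 1 := by
          gcongr
          · exact aliveInd_nonneg _ _ _ _
          · exact hθ.abs_le _
          · linarith
          · exact aliveInd_le_one _ _ _ _
      _ = A := by ring
  have hn0 : (0 : ℝ) < n := by exact_mod_cast hn
  have hs0 : 0 < √(n : ℝ) := Real.sqrt_pos.2 hn0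
  have hset (x : X) (t : ℝ) : ∫ ω in {ω | (t + walk σ x n ω) / (v * √n) ≤ b ∧
      (n : ℕ∞) < exitTime σ f x t ω}, θ ω ∂(pathLaw μ) = ∫ ω, H ((ω, x), t) ∂(pathLaw μ) := by
    simp only [lt_exitTime_iff]
    have hm : MeasurableSet {ω : ℕ → G | (t + walk σ x n ω) / (v * √n) ≤ b ∧
        ((ω, x), t) ∈ alive σ f n} := by
      rw [Set.ofPred_and]
      refine MeasurableSet.inter (measurableSet_le ?_ measurable_const)
        (measurableSet_alive_slice hW hf.measurable n x t)
      exact (((measurable_walk hW.measurable n).comp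
        (measurable_id.prodMk measurable_const)).const_add t).div_const _
    rw [← integral_indicator hm]
    refine integral_congr_ae (Eventually.of_forall fun ω => ?_)
    have hiff : (t + walk σ x n ω) / (v * √n) ≤ b ↔ ¬ b * v * √n < t + walk σ x n ω := by
      rw [div_le_iff₀ (by positivity), not_lt, mul_assoc]
    simp only [hHdef]
    by_cases h1 : (t + walk σ x n ω) / (v * √n) ≤ b
    · rw [tailInd, Set.indicator_of_notMem (s := {w : ((ℕ → G) × X) × ℝ |
        b * v * √n < w.2 + walk σ w.1.2 n w.1.1}) (hiff.1 h1), sub_zero, mul_one]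
      by_cases h2 : ((ω, x), t) ∈ alive σ f n
      · rw [Set.indicator_of_mem (by exact ⟨h1, h2⟩), aliveInd_of_mem h2, mul_one]
      · rw [Set.indicator_of_notMem (fun h => h2 h.2), aliveInd_of_notMem h2, mul_zero]
    · rw [tailInd, Set.indicator_of_mem (s := {w : ((ℕ → G) × X) × ℝ |
        b * v * √n < w.2 + walk σ w.1.2 n w.1.1}) (not_not.1 fun h => h1 (hiff.2 h)),
        Set.indicator_of_notMem (fun h => h1 h.1)]
      simp
  obtain ⟨i1, e1⟩ := integral_fullLaw_eq (μ := μ) (ν := ν) (l := densityMeasure φ) hH hM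
  obtain ⟨i2, e2⟩ := integral_fullLaw_eq (μ := μ) (ν := ν) (l := densityMeasure fun t => -φ t) hH hM
  rw [e1, e2, ← mul_sub, ← integral_sub i1 i2, scaledConditioned]
  congr 1
  refine integral_congr_ae (Eventually.of_forall fun x => ?_)
  simp only [hset]
  have hb (l : Measure ℝ) [IsFiniteMeasure l] :
      Integrable (fun t => ∫ ω, H ((ω, x), t) ∂(pathLaw μ)) l := by
    refine Integrable.of_bound (StronglyMeasurable.integral_prod_right
      (f := fun (t : ℝ) (ω : ℕ → G) => H ((ω, x), t)) ?_).aestronglyMeasurable A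
      (Eventually.of_forall fun t => ?_)
    · exact (hH.comp ((measurable_snd.prodMk measurable_const).prodMk
        measurable_fst)).stronglyMeasurable
    · refine (norm_integral_le_of_norm_le_const (Eventually.of_forall fun ω => hM _)).trans ?_
      simp
  rw [← integral_mul_eq_sub hφ (hb _) (hb _)]
  exact integral_congr_ae (Eventually.of_forall fun t => mul_comm _ _)

end Fubini

/-! ### From the constants of the statement to moments and mean squares -/

section Constants

theorem le_of_exp_mul_le {u B : ℝ} {I : ℝ≥0∞}
    (h : ENNReal.ofReal (Real.exp u) * I ≤ ENNReal.ofReal B) :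
    I ≤ ENNReal.ofReal (B * Real.exp (-u)) := by
  have h1 := mul_le_mul_right h (ENNReal.ofReal (Real.exp (-u)))
  rw [← mul_assoc, ← ENNReal.ofReal_mul (Real.exp_pos _).le, ← Real.exp_add, neg_add_cancel,
    Real.exp_zero, ENNReal.ofReal_one, one_mul, ← ENNReal.ofReal_mul (Real.exp_pos _).le,
    mul_comm] at h1
  exact h1

variable {G X : Type*} [Group G] [MulAction G X] [MeasurableSpace G] [MeasurableMul₂ G]
  [MeasurableSpace X] [MeasurableSMul₂ G X]
  {μ : Measure G} [IsProbabilityMeasure μ] {ν : Measure X} [IsProbabilityMeasure ν]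
  {σ : G → X → ℝ} {α β A B : ℝ} {f : ℕ → (ℕ → G) × X → ℝ} {θ : (ℕ → G) → ℝ}

theorem exists_walkHyp (hσm : Measurable (fun z : G × X => σ z.1 z.2)) (hσ : IsCocycle σ)
    (hν : IsStationary μ ν) (hexp : HasExpMoment μ σ) (hc : IsCentered μ σ) :
    ∃ a₀ M : ℝ, 0 < a₀ ∧ 0 ≤ M ∧ ∀ a A : ℝ, 0 < a → a ≤ a₀ → 1 ≤ A → M ≤ A →
      WalkHyp μ ν σ a A := by
  obtain ⟨a₀, ha₀, hfin⟩ := hexp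
  refine ⟨a₀, (∫⁻ g, ⨆ x : X, ENNReal.ofReal (Real.exp (a₀ * |σ g x|)) ∂μ).toReal, ha₀,
    ENNReal.toReal_nonneg, fun a A ha haa hA hMA =>
    ⟨hσm, hσ, hν, hc, ha, hA, fun x => ?_⟩⟩
  calc _ ≤ ∫⁻ g, ⨆ x : X, ENNReal.ofReal (Real.exp (a₀ * |σ g x|)) ∂μ := by
        refine lintegral_mono fun g => le_iSup_of_le x ?_
        gcongr
    _ = _ := (ENNReal.ofReal_toReal hfin.ne).symm
    _ ≤ _ := ENNReal.ofReal_le_ofReal hMA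

/-- The exponential rate of approximation in the sense of exponential moments implies one in mean
square. -/
theorem AdmissiblePerturbation.pertHyp (h : AdmissiblePerturbation μ ν α β B f) (hα : 0 < α)
    {a : ℝ} (haα : a ≤ α) (hBA : B ≤ A) (hA : 2 / α ^ 2 * B ≤ A) :
    PertHyp μ ν a β A f := by
  have hexp (n : ℕ) : ∫⁻ z, ENNReal.ofReal (Real.exp (α * |f n z|)) ∂((pathLaw μ).prod ν) ≤
      ENNReal.ofReal B := by
    have hm : Measurable fun z => ENNReal.ofReal (Real.exp (α * |f n z|)) :=
      ((h.measurable n).norm.const_mul α).exp.ennreal_ofReal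
    rw [lintegral_prod_symm' _ hm]
    exact (le_iSup (fun n => ∫⁻ x, ∫⁻ ω, ENNReal.ofReal (Real.exp (α * |f n (ω, x)|))
      ∂(pathLaw μ) ∂ν) n).trans h.expMoment_le
  refine ⟨h.measurable, fun n => ?_, fun n p => ?_⟩
  · refine le_trans (lintegral_mono fun z => ?_) ((hexp n).trans (ENNReal.ofReal_le_ofReal hBA))
    gcongr
  · have hint : Integrable (f n) ((pathLaw μ).prod ν) := by
      have hi : Integrable (fun z => Real.exp (α * |f n z|)) ((pathLaw μ).prod ν) := by
        refine ⟨(((h.measurable n).norm.const_mul α).exp).aestronglyMeasurable, ?_⟩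
        rw [hasFiniteIntegral_iff_ofReal (Eventually.of_forall fun _ => (Real.exp_pos _).le)]
        exact (hexp n).trans_lt ENNReal.ofReal_lt_top
      exact (hi.div_const α).mono' (h.measurable n).aestronglyMeasurable
        (Eventually.of_forall fun z => abs_le_exp_div hα _)
    set d : (ℕ → G) × X → ℝ := fun z => f n z - truncSeq μ p f n z with hd
    have hdm : Measurable d := (h.measurable n).sub (measurable_truncSeq h.measurable p n)
    have hem : Measurable fun z => ENNReal.ofReal (Real.exp (α * |d z|)) :=
      ((hdm.norm.const_mul α).exp).ennreal_ofReal
    -- the truncation is the conditional expectation, for almost every starting point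
    have hE : ∫⁻ z, ENNReal.ofReal (Real.exp (α * |d z|)) ∂((pathLaw μ).prod ν) =
        ∫⁻ x, ∫⁻ ω, ENNReal.ofReal (Real.exp (α * |f n (ω, x) -
          ((pathLaw μ)[fun ω' => f n (ω', x) | coordAlgebra G p]) ω|)) ∂(pathLaw μ) ∂ν := by
      rw [lintegral_prod_symm' _ hem]
      refine lintegral_congr_ae ?_
      filter_upwards [hint.prod_left_ae] with x hx
      refine lintegral_congr_ae ?_
      have hmx : Measurable fun ω => f n (ω, x) :=
        (h.measurable n).comp (measurable_id.prodMk measurable_const)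
      filter_upwards [condExp_ae_eq_trunc μ p hmx hx] with ω hω
      rw [hω]
      rfl
    have hle : ∫⁻ z, ENNReal.ofReal (Real.exp (α * |d z|)) ∂((pathLaw μ).prod ν) - 1 ≤
        ENNReal.ofReal (B * Real.exp (-(β * p))) := by
      refine le_of_exp_mul_le (le_trans ?_ h.approx_le)
      rw [hE]
      exact le_iSup₂ (f := fun (n p : ℕ) => ENNReal.ofReal (Real.exp (β * p)) *
        ((∫⁻ x, ∫⁻ ω, ENNReal.ofReal (Real.exp (α *
        |f n (ω, x) - ((pathLaw μ)[fun ω' => f n (ω', x) | coordAlgebra G p]) ω|))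
        ∂(pathLaw μ) ∂ν) - 1)) n p
    have hsq (u : ℝ) : ENNReal.ofReal (u ^ 2) ≤
        ENNReal.ofReal (2 / α ^ 2) * ENNReal.ofReal (Real.exp (α * |u|) - 1) := by
      rw [← ENNReal.ofReal_mul (by positivity)]
      refine ENNReal.ofReal_le_ofReal ?_
      have h1 := Real.quadratic_le_exp_of_nonneg (x := α * |u|) (by positivity)
      rw [mul_pow, sq_abs] at h1
      have h2 : 0 ≤ α * |u| := by positivity
      rw [div_mul_eq_mul_div, le_div_iff₀ (by positivity)]
      linarith
    calc _ ≤ ∫⁻ z, ENNReal.ofReal (2 / α ^ 2) * ENNReal.ofReal (Real.exp (α * |d z|) - 1)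
          ∂((pathLaw μ).prod ν) := lintegral_mono fun z => hsq _
      _ = ENNReal.ofReal (2 / α ^ 2) * ∫⁻ z, ENNReal.ofReal (Real.exp (α * |d z|) - 1)
          ∂((pathLaw μ).prod ν) := lintegral_const_mul' _ _ ENNReal.ofReal_ne_top
      _ ≤ ENNReal.ofReal (2 / α ^ 2) * ENNReal.ofReal (B * Real.exp (-(β * p))) := by
          gcongr
          refine le_trans (ENNReal.le_sub_of_add_le_right ENNReal.one_ne_top ?_) hle
          have h1 : (1 : ℝ≥0∞) = ∫⁻ _, 1 ∂((pathLaw μ).prod ν) := by simp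
          rw [h1, ← lintegral_add_right _ measurable_const]
          refine lintegral_mono fun z => ?_
          beta_reduce
          rw [← ENNReal.ofReal_one, ← ENNReal.ofReal_add
            (sub_nonneg.2 (Real.one_le_exp (by positivity))) zero_le_one, sub_add_cancel]
      _ ≤ _ := by
          rw [← ENNReal.ofReal_mul (by positivity)]
          refine ENNReal.ofReal_le_ofReal ?_
          rw [← mul_assoc]
          gcongr

/-- An admissible twist agrees almost surely with one that is measurable and takes its values in
`[0, B]`; as both it and its truncations are bounded by `B`, the rate of approximation in mean
implies one in mean square. -/
theorem AdmissibleTwist.exists_twistHyp (h : AdmissibleTwist μ β B θ) (hB : 0 ≤ B) (hBA : B ≤ A)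
    (hA : B * B ≤ A) : ∃ θ', TwistHyp μ β A θ' ∧ θ =ᵐ[pathLaw μ] θ' := by
  have hle : ∀ᵐ ω ∂(pathLaw μ), θ ω ≤ B := by
    have h1 := h.norm_le
    rw [eLpNorm_exponent_top] at h1
    filter_upwards [ae_le_eLpNormEssSup (f := θ) (μ := pathLaw μ)] with ω hω
    have h2 := hω.trans h1
    rw [← ofReal_norm, ENNReal.ofReal_le_ofReal_iff hB] at h2
    exact (le_abs_self _).trans h2
  have hsm := h.memLp.1
  let θ' : (ℕ → G) → ℝ := fun ω => max 0 (min B (hsm.mk θ ω))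
  have hm : Measurable θ' :=
    measurable_const.max (measurable_const.min hsm.stronglyMeasurable_mk.measurable)
  have h0 (ω) : 0 ≤ θ' ω := le_max_left _ _
  have h1 (ω) : θ' ω ≤ B := max_le hB (min_le_left _ _)
  have hae : θ =ᵐ[pathLaw μ] θ' := by
    filter_upwards [hle, h.nonneg, hsm.ae_eq_mk] with ω e1 e2 e3
    simp only [θ']
    rw [← e3, min_eq_right e1, max_eq_right e2]
  refine ⟨θ', ⟨hm, h0, fun ω => (h1 ω).trans hBA, fun p => ?_⟩, hae⟩
  have hint : Integrable θ' (pathLaw μ) := Integrable.of_bound hm.aestronglyMeasurable B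
    (Eventually.of_forall fun ω => by rw [Real.norm_eq_abs, abs_of_nonneg (h0 ω)]; exact h1 ω)
  have t0 (ω) : 0 ≤ trunc μ p θ' ω := integral_nonneg fun _ => h0 _
  have t1 (ω) : trunc μ p θ' ω ≤ B := by
    have h := norm_integral_le_of_norm_le_const (μ := pathLaw μ) (C := B)
      (f := fun ω' => θ' (concat p ω ω'))
      (Eventually.of_forall fun ω' => by
        rw [Real.norm_eq_abs, abs_of_nonneg (h0 _)]; exact h1 _)
    rw [probReal_univ, mul_one] at h
    exact (le_abs_self _).trans h
  have hE : ∫⁻ ω, ENNReal.ofReal |θ ω - ((pathLaw μ)[θ | coordAlgebra G p]) ω| ∂(pathLaw μ) =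
      ∫⁻ ω, ENNReal.ofReal |θ' ω - trunc μ p θ' ω| ∂(pathLaw μ) := by
    refine lintegral_congr_ae ?_
    filter_upwards [hae, condExp_congr_ae (m := coordAlgebra G p) hae,
      condExp_ae_eq_trunc μ p hm hint] with ω e1 e2 e3
    rw [e2, e3, e1]
  have hbound : ∫⁻ ω, ENNReal.ofReal |θ' ω - trunc μ p θ' ω| ∂(pathLaw μ) ≤
      ENNReal.ofReal (B * Real.exp (-(β * p))) := by
    rw [← hE]
    exact le_of_exp_mul_le ((le_iSup (fun p : ℕ => ENNReal.ofReal (Real.exp (β * p)) *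
      ∫⁻ ω, ENNReal.ofReal |θ ω - ((pathLaw μ)[θ | coordAlgebra G p]) ω| ∂(pathLaw μ)) p).trans
        h.approx_le)
  calc _ ≤ ∫⁻ ω, ENNReal.ofReal B * ENNReal.ofReal |θ' ω - trunc μ p θ' ω| ∂(pathLaw μ) := by
        refine lintegral_mono fun ω => ?_
        rw [← ENNReal.ofReal_mul hB]
        refine ENNReal.ofReal_le_ofReal ?_
        have h2 : |θ' ω - trunc μ p θ' ω| ≤ B := by
          rw [abs_le]; constructor <;> linarith [h0 ω, h1 ω, t0 ω, t1 ω]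
        rw [← sq_abs, sq]
        gcongr
    _ = ENNReal.ofReal B * ∫⁻ ω, ENNReal.ofReal |θ' ω - trunc μ p θ' ω| ∂(pathLaw μ) :=
        lintegral_const_mul' _ _ ENNReal.ofReal_ne_top
    _ ≤ ENNReal.ofReal B * ENNReal.ofReal (B * Real.exp (-(β * p))) := by gcongr
    _ ≤ _ := by
        rw [← ENNReal.ofReal_mul hB, ← mul_assoc]
        gcongr

end Constants

/-! ### The limit function and the conditioned limit theorem -/

section Limit

variable {G X : Type*} [Group G] [MulAction G X] [MeasurableSpace G] [MeasurableMul₂ G]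
  [MeasurableSpace X] [MeasurableSMul₂ G X]
  {μ : Measure G} [IsProbabilityMeasure μ] {ν : Measure X} [IsProbabilityMeasure ν]
  {σ : G → X → ℝ} {a β A v : ℝ} {f : ℕ → (ℕ → G) × X → ℝ} {θ : (ℕ → G) → ℝ}

theorem exists_isLimitFunction (hW : WalkHyp μ ν σ a A) (hβ : 0 < β) (hv : 0 < v)
    (happ : StrongApproximation μ σ v) (hf : PertHyp μ ν a β A f) (hθ : TwistHyp μ β A θ) :
    ∃ U, IsLimitFunction μ ν σ f θ U := by
  obtain ⟨U, h1, h2, h3⟩ := exists_monotone_limit (V := fun n => preLimit μ ν σ f θ (n + 1))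
    (fun n => preLimit_mono hW hf hθ n.succ_pos) (fun n => preLimit_nonneg hW hf hθ n.succ_pos)
    (fun s e _ => by
      have hl := testMeasure_restrict_Icc s e
      obtain ⟨u, hu⟩ := exists_tendsto_meanPos hW hβ hv happ hl hf hθ
      refine ⟨u, ?_⟩
      have := (tendsto_add_atTop_iff_nat 1).2 hu
      exact this.congr fun n => meanPos_eq hW hf hθ hl (n + 1))
  exact ⟨U, h1, h2, fun ψ hψ hψc => (tendsto_add_atTop_iff_nat 1).1 (h3 ψ hψ hψc)⟩

/-- The limits of the mean positions for the measures of densities `φ⁺` and `φ⁻` determine the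
integral of `φ` against the limit function. -/
theorem exists_scaledConditioned_estimate (hW : WalkHyp μ ν σ a A) (hβ : 0 < β) (hv : 0 < v)
    (happ : StrongApproximation μ σ v) {b₀ : ℝ} (hb₀ : 0 ≤ b₀) {φ : ℝ → ℝ} (hφ : Continuous φ)
    (hφc : HasCompactSupport φ) :
    ∃ C : ℝ, 0 ≤ C ∧ ∀ f, PertHyp μ ν a β A f → ∀ θ, TwistHyp μ β A θ → ∀ n : ℕ, 32 ≤ n →
      ∀ b ≤ b₀, ∀ U, IsLimitFunction μ ν σ f θ U →
      |scaledConditioned μ ν σ v f θ φ b n -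
        (∫ t, φ t * U t) * ∫ s in (0 : ℝ)..(max b 0), rayleigh s| ≤
        C * (n : ℝ) ^ (-(1 / 100) : ℝ) := by
  have := isFiniteMeasure_densityMeasure hφ hφc
  have := isFiniteMeasure_densityMeasure hφ.neg hφc.neg
  obtain ⟨K, c, hl⟩ := exists_testMeasure_densityMeasure hφ hφc
  obtain ⟨K', c', hl'⟩ := exists_testMeasure_densityMeasure (ψ := fun t => -φ t) hφ.neg hφc.neg
  obtain ⟨C, hC, h1⟩ := exists_conditioned_estimate (β := β) hW hβ hv happ hl hb₀
  obtain ⟨C', hC', h2⟩ := exists_conditioned_estimate (β := β) hW hβ hv happ hl' hb₀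
  refine ⟨C + C', by positivity, fun f hf θ hθ n hn b hb U hU => ?_⟩
  obtain ⟨u, hu⟩ := exists_tendsto_meanPos hW hβ hv happ hl hf hθ
  obtain ⟨u', hu'⟩ := exists_tendsto_meanPos hW hβ hv happ hl' hf hθ
  have hlim : ∫ t, φ t * U t = u - u' := by
    have h3 := hU.tendsto φ hφ hφc
    have h4 : Tendsto (fun n : ℕ => ∫ t, preLimit μ ν σ f θ n t * φ t) atTop (𝓝 (u - u')) := by
      refine (hu.sub hu').congr fun n => ?_
      rw [meanPos_eq hW hf hθ hl, meanPos_eq hW hf hθ hl']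
      exact (integral_mul_eq_sub hφ (integrable_preLimit hW hf hθ hl n)
        (integrable_preLimit hW hf hθ hl' n)).symm
    rw [← tendsto_nhds_unique h3 h4]
    exact integral_congr_ae (Eventually.of_forall fun t => mul_comm _ _)
  rw [hlim, integral_rayleigh (le_max_right _ _),
    scaledConditioned_eq hW hf hθ hv hφ hφc b (by omega)]
  have e1 := h1 f hf θ hθ n hn b hb u hu
  have e2 := h2 f hf θ hθ n hn b hb u' hu'
  refine le_trans (le_of_eq ?_) ((abs_sub _ _).trans ((add_le_add e1 e2).trans
    (le_of_eq (add_mul _ _ _).symm)))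
  congr 1
  ring

end Limit

end PerturbedWalk

theorem theoremA3
    {G : Type u₁} [Group G] [TopologicalSpace G] [IsTopologicalGroup G] [T2Space G]
    [LocallyCompactSpace G] [SecondCountableTopology G] [MeasurableSpace G] [BorelSpace G]
    {X : Type u₂} [TopologicalSpace X] [T2Space X] [LocallyCompactSpace X]
    [SecondCountableTopology X] [MeasurableSpace X] [BorelSpace X]
    [MulAction G X] [ContinuousSMul G X]
    (μ : Measure G) [IsProbabilityMeasure μ]
    (ν : Measure X) [IsProbabilityMeasure ν] (hν : PerturbedWalk.IsStationary μ ν)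
    (σ : G → X → ℝ) (hσ_cont : Continuous (fun z : G × X => σ z.1 z.2))
    (hσ_cocycle : PerturbedWalk.IsCocycle σ)
    (hσ_exp : PerturbedWalk.HasExpMoment μ σ)
    (hσ_centered : PerturbedWalk.IsCentered μ σ)
    (v : ℝ) (hv : 0 < v) (hσ_approx : PerturbedWalk.StrongApproximation.{u₁, u₂, u₃} μ σ v)
    (α β B : ℝ) (hα : 0 < α) (hβ : 0 < β) (hB : 1 ≤ B) :
    -- the limit functions exist
    (∀ (f : ℕ → (ℕ → G) × X → ℝ) (θ : (ℕ → G) → ℝ),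
      PerturbedWalk.AdmissiblePerturbation μ ν α β B f → PerturbedWalk.AdmissibleTwist μ β B θ →
      ∃ U : ℝ → ℝ, PerturbedWalk.IsLimitFunction μ ν σ f θ U) ∧
    -- the conditioned central limit theorem, uniformly in `b`, `f`, `θ`
    ∀ (b₀ : ℝ), 0 < b₀ → ∀ φ : ℝ → ℝ, Continuous φ → HasCompactSupport φ →
      ∀ ε : ℝ, 0 < ε → ∃ N : ℕ, ∀ n : ℕ, N ≤ n → ∀ b : ℝ, b ≤ b₀ →
        ∀ (f : ℕ → (ℕ → G) × X → ℝ) (θ : (ℕ → G) → ℝ),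
          PerturbedWalk.AdmissiblePerturbation μ ν α β B f →
          PerturbedWalk.AdmissibleTwist μ β B θ →
          ∀ U : ℝ → ℝ, PerturbedWalk.IsLimitFunction μ ν σ f θ U →
            |PerturbedWalk.scaledConditioned μ ν σ v f θ φ b n -
              (∫ t, φ t * U t) * ∫ s in (0 : ℝ)..(max b 0), PerturbedWalk.rayleigh s| < ε := by
  obtain ⟨a₀, M, ha₀, hM, hwalk⟩ := PerturbedWalk.exists_walkHyp hσ_cont.measurable hσ_cocycle hν
    hσ_exp hσ_centered
  have hB0 : 0 ≤ B := zero_le_one.trans hB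
  have hαB : 0 ≤ 2 / α ^ 2 * B := by positivity
  have hBB : 0 ≤ B * B := by positivity
  -- one constant for all the moments
  set A := M + B + 2 / α ^ 2 * B + B * B with hA
  have hW : PerturbedWalk.WalkHyp μ ν σ (min a₀ α) A :=
    hwalk _ _ (lt_min ha₀ hα) (min_le_left _ _) (by linarith) (by linarith)
  have hpert (f : ℕ → (ℕ → G) × X → ℝ) (hf : PerturbedWalk.AdmissiblePerturbation μ ν α β B f) :
      PerturbedWalk.PertHyp μ ν (min a₀ α) β A f :=
    hf.pertHyp hα (min_le_right _ _) (by linarith) (by linarith)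
  have htwist (θ : (ℕ → G) → ℝ) (hθ : PerturbedWalk.AdmissibleTwist μ β B θ) :=
    hθ.exists_twistHyp (A := A) hB0 (by linarith) (by linarith)
  -- the statement only involves the class of the twist up to almost sure equality
  have hcongr (f : ℕ → (ℕ → G) × X → ℝ) {θ θ' : (ℕ → G) → ℝ}
      (h : θ =ᵐ[PerturbedWalk.pathLaw μ] θ') (U : ℝ → ℝ) :
      PerturbedWalk.IsLimitFunction μ ν σ f θ U ↔ PerturbedWalk.IsLimitFunction μ ν σ f θ' U := by
    constructor <;> rintro ⟨h1, h2, h3⟩ <;> refine ⟨h1, h2, ?_⟩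
    · rwa [← PerturbedWalk.preLimit_congr h]
    · rwa [PerturbedWalk.preLimit_congr h]
  refine ⟨fun f θ hf hθ => ?_, fun b₀ hb₀ φ hφ hφc ε hε => ?_⟩
  · obtain ⟨θ', hθ', hae⟩ := htwist θ hθ
    obtain ⟨U, hU⟩ := PerturbedWalk.exists_isLimitFunction hW hβ hv hσ_approx (hpert f hf) hθ'
    exact ⟨U, (hcongr f hae U).2 hU⟩
  · obtain ⟨C, hC, hest⟩ := PerturbedWalk.exists_scaledConditioned_estimate (β := β) hW hβ hv
      hσ_approx hb₀.le hφ hφc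
    have h0 : Tendsto (fun n : ℕ => C * (n : ℝ) ^ (-(1 / 100) : ℝ)) atTop (𝓝 0) := by
      have h1 := (tendsto_rpow_neg_atTop (y := 1 / 100) (by norm_num)).comp
        tendsto_natCast_atTop_atTop
      simpa using h1.const_mul C
    obtain ⟨N, hN⟩ := eventually_atTop.1 (h0.eventually (gt_mem_nhds hε))
    refine ⟨max N 32, fun n hn b hb f θ hf hθ U hU => ?_⟩
    obtain ⟨θ', hθ', hae⟩ := htwist θ hθ
    rw [PerturbedWalk.scaledConditioned_congr hae]
    exact (hest f (hpert f hf) θ' hθ' n ((le_max_right _ _).trans hn) b hb U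
      ((hcongr f hae U).1 hU)).trans_lt (hN n ((le_max_left _ _).trans hn))
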